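/- Theorem. There is an algorithm with the following property. Its input is a finite connected undirected simple graph $G$, a tree decomposition $\mathcal D=(T,(X_v)_{v\in V(T)})$ of $G$ (that is, a finite tree $T$ with bags $X_v\subseteq V(G)$ such that every vertex and both ends of every edge of $G$ lie in some bag, and $X_u\cap X_v\subseteq X_w$ whenever $w$ lies on the path of $T$ from $u$ to $v$), and an integer $\ell>3$ such that $G$ has no geodesic cycle of length more than $\ell$; here a cycle of $G$ is geodesic if, for any two of its vertices, some shortest path of $G$ between them is contained in the cycle. Let $L=|V(T)|$ and let $k=\max_{v}|X_v|$. Then the algorithm runs in time $O\bigl(Lk^2(k+\ell)\bigr)$, with an absolute implied constant, and outputs a tree decomposition $\mathcal D''=(T'',(X''_v)_{v\in V(T'')})$ of $G$ in which every bag $X''_v$ induces a connected subgraph of $G$ and $|X''_v|\le k^2\ell$. (Time is the number of steps of a random access machine with unit-cost addition, subtraction, comparison and indirect memory access; graphs are given by lists of edges, bags by lists of vertices.) -/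

import Mathlib

namespace ConnTD

/-- A tree decomposition of `G` whose tree has node set `ι`. -/
structure TreeDecomposition {V : Type*} (G : SimpleGraph V) (ι : Type*) where
  tree : SimpleGraph ι
  isTree : tree.IsTree
  bag : ι → Finset V
  vertex_mem : ∀ x : V, ∃ i, x ∈ bag i
  edge_mem : ∀ x y : V, G.Adj x y → ∃ i, x ∈ bag i ∧ y ∈ bag i
  path_mem : ∀ (i j : ι) (p : tree.Walk i j), p.IsPath →
    ∀ m ∈ p.support, ∀ x, x ∈ bag i → x ∈ bag j → x ∈ bag m

/-- The maximum size of a bag. -/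
def TreeDecomposition.maxBagSize {V ι : Type*} [Fintype ι] {G : SimpleGraph V}
    (D : TreeDecomposition G ι) : ℕ :=
  Finset.univ.sup fun i => (D.bag i).card

/-- Every bag induces a connected (in particular nonempty) subgraph. -/
def TreeDecomposition.HasConnectedBags {V ι : Type*} {G : SimpleGraph V}
    (D : TreeDecomposition G ι) : Prop :=
  ∀ i, (G.induce (D.bag i : Set V)).Connected

/-- A cycle `c` is geodesic if, for any two of its vertices, some shortest path of `G`
between them runs along `c`. -/
def IsGeodesicCycle {V : Type*} (G : SimpleGraph V) {v : V} (c : G.Walk v v) : Prop :=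
  c.IsCycle ∧ ∀ x ∈ c.support, ∀ y ∈ c.support,
    ∃ p : G.Walk x y, p.length = G.dist x y ∧ ∀ e ∈ p.edges, e ∈ c.edges

/-! ### Random access machine

Programs are structured programs over finitely many registers and a memory addressed by natural
numbers (indirect addressing). The arithmetic is addition and truncated subtraction only, and
each elementary instruction and each test costs one step. -/

/-- Registers and memory. -/
structure State where
  reg : ℕ → ℕ
  mem : ℕ → ℕ

/-- Programs; the arguments `r`, `a`, `b` are register numbers. -/
inductive Prog where
  /-- `r := c` -/
  | const (r c : ℕ)
  /-- `r := a + b` -/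
  | add (r a b : ℕ)
  /-- `r := a - b` (truncated) -/
  | sub (r a b : ℕ)
  /-- `r := mem[a]` -/
  | load (r a : ℕ)
  /-- `mem[a] := b` -/
  | store (a b : ℕ)
  | seq (p q : Prog)
  /-- `if a < b then p else q` -/
  | ifLt (a b : ℕ) (p q : Prog)
  /-- `while a < b do p` -/
  | whileLt (a b : ℕ) (p : Prog)

def State.setReg (s : State) (r x : ℕ) : State :=
  { s with reg := Function.update s.reg r x }

def State.setMem (s : State) (a x : ℕ) : State :=
  { s with mem := Function.update s.mem a x }

/-- `Exec p s s' t`: started in `s`, the program `p` halts in `s'` after exactly `t` steps. -/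
inductive Exec : Prog → State → State → ℕ → Prop where
  | const (r c : ℕ) (s : State) : Exec (.const r c) s (s.setReg r c) 1
  | add (r a b : ℕ) (s : State) : Exec (.add r a b) s (s.setReg r (s.reg a + s.reg b)) 1
  | sub (r a b : ℕ) (s : State) : Exec (.sub r a b) s (s.setReg r (s.reg a - s.reg b)) 1
  | load (r a : ℕ) (s : State) : Exec (.load r a) s (s.setReg r (s.mem (s.reg a))) 1
  | store (a b : ℕ) (s : State) : Exec (.store a b) s (s.setMem (s.reg a) (s.reg b)) 1
  | seq {p q : Prog} {s s₁ s₂ : State} {t₁ t₂ : ℕ} :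
      Exec p s s₁ t₁ → Exec q s₁ s₂ t₂ → Exec (.seq p q) s s₂ (t₁ + t₂)
  | ifTrue {a b : ℕ} {p q : Prog} {s s₁ : State} {t : ℕ} :
      s.reg a < s.reg b → Exec p s s₁ t → Exec (.ifLt a b p q) s s₁ (t + 1)
  | ifFalse {a b : ℕ} {p q : Prog} {s s₁ : State} {t : ℕ} :
      ¬ s.reg a < s.reg b → Exec q s s₁ t → Exec (.ifLt a b p q) s s₁ (t + 1)
  | whileTrue {a b : ℕ} {p : Prog} {s s₁ s₂ : State} {t₁ t₂ : ℕ} :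
      s.reg a < s.reg b → Exec p s s₁ t₁ → Exec (.whileLt a b p) s₁ s₂ t₂ →
      Exec (.whileLt a b p) s s₂ (t₁ + t₂ + 1)
  | whileFalse {a b : ℕ} {p : Prog} {s : State} :
      ¬ s.reg a < s.reg b → Exec (.whileLt a b p) s s 1

/-- The initial state: the input word stands in memory from address `0` on, and all other
memory cells and all registers are `0`. -/
def initState (w : List ℕ) : State where
  reg := fun _ => 0
  mem := fun i => w.getD i 0

/-- The word `w` stands in the memory of `s` from address `a` on. -/
def State.HoldsAt (s : State) (a : ℕ) (w : List ℕ) : Prop :=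
  ∀ i (h : i < w.length), s.mem (a + i) = w[i]

/-! ### Encoding of graphs and tree decompositions as words over `ℕ` -/

/-- `es` lists every edge of `G` exactly once, in any order and orientation. -/
def IsEdgeList {n : ℕ} (G : SimpleGraph (Fin n)) (es : List (Fin n × Fin n)) : Prop :=
  (es.map fun e => s(e.1, e.2)).Nodup ∧
    ∀ x y, G.Adj x y ↔ s(x, y) ∈ es.map fun e => s(e.1, e.2)

/-- `bs i` lists every element of the bag of node `i` exactly once, in any order. -/
def IsBagList {n L : ℕ} (X : Fin L → Finset (Fin n)) (bs : Fin L → List (Fin n)) : Prop :=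
  ∀ i, (bs i).Nodup ∧ ∀ x, x ∈ bs i ↔ x ∈ X i

/-- A graph on `Fin n` as a word: number of vertices, number of edges, list of edges. -/
def encodeGraph (n : ℕ) (es : List (Fin n × Fin n)) : List ℕ :=
  n :: es.length :: es.flatMap fun e => [e.1.val, e.2.val]

/-- The bags as a word: for each node in turn, the size and the elements of its bag. -/
def encodeBags {n L : ℕ} (bs : Fin L → List (Fin n)) : List ℕ :=
  (List.ofFn bs).flatMap fun b => b.length :: b.map Fin.val

/-- `w` is a word that encodes the tree decomposition `D`: its tree, followed by its bags. -/
def EncodesDecomposition {n L : ℕ} {G : SimpleGraph (Fin n)}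
    (D : TreeDecomposition G (Fin L)) (w : List ℕ) : Prop :=
  ∃ (ts : List (Fin L × Fin L)) (bs : Fin L → List (Fin n)),
    IsEdgeList D.tree ts ∧ IsBagList D.bag bs ∧ w = encodeGraph L ts ++ encodeBags bs

/-- `w` is a word that encodes the number `l`, the graph `G` and its tree decomposition `D`. -/
def EncodesInput {n L : ℕ} (l : ℕ) (G : SimpleGraph (Fin n))
    (D : TreeDecomposition G (Fin L)) (w : List ℕ) : Prop :=
  ∃ (es : List (Fin n × Fin n)) (w' : List ℕ),
    IsEdgeList G es ∧ EncodesDecomposition D w' ∧ w = l :: (encodeGraph n es ++ w')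

end ConnTD

set_option linter.constructorNameAsVariable false

namespace ConnTD

/-! ### A small structured language with arrays, compiled to the random access machine -/

/-! In each bag, join two vertices when their distance in `G` is at most `l`. The connectivity
classes of this relation, taken over all bags, are the nodes of the new tree; two classes are
adjacent when their nodes are adjacent in `D` and they share a vertex (`Classes.tree`). The heart of
the proof is that this graph is a tree. It is connected because the ends of an edge of `G` share a
class and all classes containing a given vertex hang together. Acyclicity is where the hypothesis on
cycles enters. Geodesic cycles generate the cycle space modulo two (`walkSum_closed_eq_zero`), so an
edge functional over `ZMod 2` that vanishes on them has a potential. For adjacent classes `N`, `N'`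
such a functional is made from the indicator of their intersection, cut off to one side of the tree
edge between their nodes. A cycle of length at most `l` has diameter at most `l`, so within the
intersection of the two bags it cannot meet both `N ∩ N'` and its complement; hence the functional
vanishes on it. Its potential yields a two-colouring of the classes that changes across the edge
from `N` to `N'` and across no other, so every edge is a bridge (`Classes.tree_isAcyclic`).

A class becomes connected when, for each pair of its vertices at distance at most `l`, the interior
of a shortest path is added. The paths must be chosen coherently to keep the path axiom. A function
`mid` assigns to a pair an intermediate vertex on a geodesic, such that some bag contains both ends
and this vertex; the path arises by splitting recursively. As every split happens inside a bag, an
added vertex `v` can be followed through the tree of classes to a class that contains `v` itself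
(`Classes.exists_walk_inBag`). A class of size `c` grows to at most `c + c(c-1)(l-1) ≤ c²l`
vertices.

Exact distances inside bags, and `mid` with them, come from closing each bag under the triangle
inequality (Floyd–Warshall), once from the leaves to the root and once back (`StepsExact.pred`,
`ExactBelow.succ`); this and the search for the classes take `O(Lk³)`. A pair is expanded in `O(l)`
steps and the class sizes add up to at most `Lk` (`Classes.sum_card_le`), so the bags are written in
`O(Lk²l)`.

The program is written in a language with arrays and bounded loops, reasoned about by Hoare-style
rules that count commands (`Spec`), and compiled to the machine at the cost of a constant factor
(`Cmd.exec_compile`). Memory that is initially zero spares the clearing of the large matrices. -/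

/-- Scalar variables. -/
inductive Var where
  | l | n | m | L | mt | tb | q | len | acc | t | u | v | x | y | z | i | j | h | e | c | f
  | nc | tail | hd | lo | hi | op | sp | p | ne
  deriving DecidableEq

/-- Arrays of the main phase. -/
inductive Arr where
  | inp | row | bst | bsz | deg | nbr | vis | ord | dist | mid | comp | que | cst | emat | stamp
  | sta | stb | out
  deriving DecidableEq

/-- Expressions over arrays named by `A`. -/
inductive Exp (A : Type) where
  | lit (c : ℕ)
  | var (x : Var)
  | add (e f : Exp A)
  | sub (e f : Exp A)
  | get (q : A) (e : Exp A)

/-- Commands; `loop x e c` runs `c` for `x = 0, 1, …` below the value of `e` at the start. -/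
inductive Cmd (A : Type) where
  | skip
  | set (x : Var) (e : Exp A)
  | put (q : A) (e f : Exp A)
  | seq (c d : Cmd A)
  | ite (e f : Exp A) (c d : Cmd A)
  | loop (x : Var) (e : Exp A) (c : Cmd A)

/-- Values of variables and arrays. -/
structure Store (A : Type) where
  v : Var → ℕ
  a : A → ℕ → ℕ

section Semantics

variable {A : Type} [DecidableEq A]

def Store.setV (s : Store A) (x : Var) (k : ℕ) : Store A :=
  { s with v := Function.update s.v x k }

def Store.setA (s : Store A) (q : A) (i k : ℕ) : Store A :=
  { s with a := Function.update s.a q (Function.update (s.a q) i k) }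

omit [DecidableEq A] in
@[simp] theorem Store.setV_a (s : Store A) (x : Var) (k : ℕ) : (s.setV x k).a = s.a := rfl

omit [DecidableEq A] in
theorem Store.setV_v (s : Store A) (x y : Var) (k : ℕ) :
    (s.setV x k).v y = if y = x then k else s.v y := by
  simp [Store.setV, Function.update_apply]

@[simp] theorem Store.setA_v (s : Store A) (q : A) (i k : ℕ) : (s.setA q i k).v = s.v := rfl

theorem Store.setA_a (s : Store A) (q r : A) (i k : ℕ) :
    (s.setA q i k).a r = if r = q then Function.update (s.a q) i k else s.a r := by
  by_cases h : r = q
  · subst h; simp [Store.setA]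
  · simp [Store.setA, h]

def Exp.eval (s : Store A) : Exp A → ℕ
  | .lit c => c
  | .var x => s.v x
  | .add e f => e.eval s + f.eval s
  | .sub e f => e.eval s - f.eval s
  | .get q e => s.a q (e.eval s)

/-- The store after `i` rounds of a loop. -/
def iterStore (x : Var) (f : Store A → Store A) (s : Store A) : ℕ → Store A
  | 0 => s
  | i + 1 => f ((iterStore x f s i).setV x i)

def Cmd.run : Cmd A → Store A → Store A
  | .skip, s => s
  | .set x e, s => s.setV x (e.eval s)
  | .put q e f, s => s.setA q (e.eval s) (f.eval s)
  | .seq c d, s => d.run (c.run s)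
  | .ite e f c d, s => if e.eval s < f.eval s then c.run s else d.run s
  | .loop x e c, s => iterStore x c.run s (e.eval s)

/-- The number of commands executed. -/
def Cmd.ticks : Cmd A → Store A → ℕ
  | .skip, _ => 1
  | .set _ _, _ => 1
  | .put _ _ _, _ => 1
  | .seq c d, s => c.ticks s + d.ticks (c.run s)
  | .ite e f c d, s => 1 + if e.eval s < f.eval s then c.ticks s else d.ticks s
  | .loop x e c, s =>
      1 + ∑ i ∈ Finset.range (e.eval s), (c.ticks ((iterStore x c.run s i).setV x i) + 1)

/-- Does the command write the variable? -/
def Cmd.writesV : Cmd A → Var → Bool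
  | .skip, _ => false
  | .set x _, y => x == y
  | .put _ _ _, _ => false
  | .seq c d, y => c.writesV y || d.writesV y
  | .ite _ _ c d, y => c.writesV y || d.writesV y
  | .loop x _ c, y => x == y || c.writesV y

/-- Does the command write the array? -/
def Cmd.writesA : Cmd A → A → Bool
  | .skip, _ => false
  | .set _ _, _ => false
  | .put q _ _, r => q == r
  | .seq c d, r => c.writesA r || d.writesA r
  | .ite _ _ c d, r => c.writesA r || d.writesA r
  | .loop _ _ c, r => c.writesA r

/-- `s'` agrees with `s` on everything the command `c` does not write. -/
structure Frame (c : Cmd A) (s s' : Store A) : Prop where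
  v : ∀ y, c.writesV y = false → s'.v y = s.v y
  a : ∀ r, c.writesA r = false → s'.a r = s.a r

theorem frame_iter {x : Var} {e : Exp A} {c : Cmd A} (hc : ∀ s, Frame c s (c.run s))
    (s : Store A) (i : ℕ) : Frame (.loop x e c) s (iterStore x c.run s i) := by
  induction i with
  | zero => exact ⟨fun _ _ => rfl, fun _ _ => rfl⟩
  | succ i ih =>
    have h := hc ((iterStore x c.run s i).setV x i)
    constructor
    · intro y hy
      have hy' := hy
      simp only [Cmd.writesV, Bool.or_eq_false_iff, beq_eq_false_iff_ne] at hy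
      rw [iterStore, h.v y hy.2, Store.setV_v, if_neg (Ne.symm hy.1)]
      exact ih.v y hy'
    · intro r hr
      rw [iterStore, h.a r hr]
      exact ih.a r hr

theorem Cmd.frame (c : Cmd A) (s : Store A) : Frame c s (c.run s) := by
  induction c generalizing s with
  | skip => exact ⟨fun _ _ => rfl, fun _ _ => rfl⟩
  | set x e =>
    refine ⟨fun y hy => ?_, fun _ _ => rfl⟩
    simp only [Cmd.writesV, beq_eq_false_iff_ne] at hy
    simp [Cmd.run, Store.setV_v, Ne.symm hy]
  | put q e f =>
    refine ⟨fun _ _ => rfl, fun r hr => ?_⟩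
    simp only [Cmd.writesA, beq_eq_false_iff_ne] at hr
    simp [Cmd.run, Store.setA_a, Ne.symm hr]
  | seq c d hc hd =>
    constructor
    · intro y hy
      simp only [Cmd.writesV, Bool.or_eq_false_iff] at hy
      rw [Cmd.run, (hd _).v y hy.2, (hc _).v y hy.1]
    · intro y hy
      simp only [Cmd.writesA, Bool.or_eq_false_iff] at hy
      rw [Cmd.run, (hd _).a y hy.2, (hc _).a y hy.1]
  | ite e f c d hc hd =>
    constructor
    · intro y hy
      simp only [Cmd.writesV, Bool.or_eq_false_iff] at hy
      rw [Cmd.run]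
      split_ifs
      · exact (hc _).v y hy.1
      · exact (hd _).v y hy.2
    · intro y hy
      simp only [Cmd.writesA, Bool.or_eq_false_iff] at hy
      rw [Cmd.run]
      split_ifs
      · exact (hc _).a y hy.1
      · exact (hd _).a y hy.2
  | loop x e c hc => exact frame_iter hc s _

/-- `Spec c s Q T`: run from `s`, the command `c` establishes `Q` within `T` ticks. -/
structure Spec (c : Cmd A) (s : Store A) (Q : Store A → Prop) (T : ℕ) : Prop where
  post : Q (c.run s)
  time : c.ticks s ≤ T

/-- The second command also receives the frame of the first, so a postcondition has to speak only of
what its command changes; everything else is recovered by evaluating `writesV` and `writesA`. -/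
theorem Spec.seq {c d : Cmd A} {s : Store A} {P Q : Store A → Prop} {T U : ℕ}
    (hc : Spec c s P T) (hd : ∀ s', P s' → Frame c s s' → Spec d s' Q U) :
    Spec (.seq c d) s Q (T + U) := by
  have h := hd _ hc.post (c.frame s)
  exact ⟨h.post, Nat.add_le_add hc.time h.time⟩

theorem Spec.mono {c : Cmd A} {s : Store A} {P Q : Store A → Prop} {T U : ℕ}
    (h : Spec c s P T) (hPQ : ∀ s', P s' → Frame c s s' → Q s') (hTU : T ≤ U) : Spec c s Q U :=
  ⟨hPQ _ h.post (c.frame s), h.time.trans hTU⟩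

theorem Spec.skip {s : Store A} {Q : Store A → Prop} (h : Q s) : Spec .skip s Q 1 := ⟨h, le_rfl⟩

theorem Spec.put {s : Store A} {Q : Store A → Prop} {q : A} {e f : Exp A}
    (h : Q (s.setA q (e.eval s) (f.eval s))) : Spec (.put q e f) s Q 1 := ⟨h, le_rfl⟩

theorem Spec.ite {s : Store A} {Q : Store A → Prop} {e f : Exp A} {c d : Cmd A} {T : ℕ}
    (h₁ : e.eval s < f.eval s → Spec c s Q T) (h₂ : ¬ e.eval s < f.eval s → Spec d s Q T) :
    Spec (.ite e f c d) s Q (1 + T) := by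
  by_cases h : e.eval s < f.eval s
  · exact ⟨by simpa [Cmd.run, h] using (h₁ h).post, by simpa [Cmd.ticks, h] using (h₁ h).time⟩
  · exact ⟨by simpa [Cmd.run, h] using (h₂ h).post, by simpa [Cmd.ticks, h] using (h₂ h).time⟩

/-- The number of rounds is fixed on entry, so an invariant suffices and no termination argument is
needed. The step sees the frame of the whole loop relative to the store at its start. -/
theorem Spec.loop_sum {s : Store A} (I : ℕ → Store A → Prop) {x : Var} {e : Exp A} {c : Cmd A}
    (T : ℕ → ℕ) {b : ℕ} (hb : e.eval s = b) (h0 : I 0 s)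
    (hstep : ∀ i < b, ∀ s', I i s' → Frame (.loop x e c) s s' →
      Spec c (s'.setV x i) (I (i + 1)) (T i)) :
    Spec (.loop x e c) s (I b) (1 + ∑ i ∈ Finset.range b, (T i + 1)) := by
  have key : ∀ i ≤ b, I i (iterStore x c.run s i) := by
    intro i
    induction i with
    | zero => intro _; exact h0
    | succ i ih =>
      intro hi
      exact (hstep i hi _ (ih (by lia)) (frame_iter c.frame s i)).post
  constructor
  · rw [Cmd.run, hb]; exact key b le_rfl
  · rw [Cmd.ticks, hb]
    refine Nat.add_le_add_left (Finset.sum_le_sum fun i hi => ?_) 1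
    rw [Finset.mem_range] at hi
    exact Nat.add_le_add_right
      (hstep i hi _ (key i hi.le) (frame_iter c.frame s i)).time 1

theorem Spec.loop {s : Store A} (I : ℕ → Store A → Prop) {x : Var} {e : Exp A} {c : Cmd A}
    {T b : ℕ} (hb : e.eval s = b) (h0 : I 0 s)
    (hstep : ∀ i < b, ∀ s', I i s' → Frame (.loop x e c) s s' →
      Spec c (s'.setV x i) (I (i + 1)) T) :
    Spec (.loop x e c) s (I b) (1 + b * (T + 1)) := by
  have := Spec.loop_sum I (fun _ => T) hb h0 hstep
  simpa using this

end Semantics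

/-! ### Compilation -/

/-- Register that holds a variable; register `0` is the base of the arrays, `1` is always zero. -/
def vreg (x : Var) : ℕ := 4 * x.ctorIdx + 4
-- Residues modulo 4 keep apart the variables, the counters and bounds of loops (indexed by nesting
-- depth) and the temporaries (indexed by position on the evaluation stack).
def creg (d : ℕ) : ℕ := 4 * d + 5
def breg (d : ℕ) : ℕ := 4 * d + 6
def treg (d : ℕ) : ℕ := 4 * d + 7

/-- Cell `i` of array `q` is at address `base + 2 ^ sh * i + off q`. -/
structure Layout (A : Type) where
  b : ℕ
  hb : b ≤ 1
  sh : ℕ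
  off : A → ℕ
  off_lt : ∀ q, off q < 2 ^ sh
  off_inj : Function.Injective off

section Compile

variable {A : Type} [DecidableEq A] (Λ : Layout A)

/-- Doubling stands in for the missing multiplication. The last addition is of register `1`, which
is zero, and merely gives the base case an instruction. -/
def dblProg (r : ℕ) : ℕ → Prog
  | 0 => .add r r 1
  | k + 1 => .seq (.add r r r) (dblProg r k)

/-- Turn the index in temporary `d` into the address of that cell of `q`. -/
def addrProg (q : A) (d : ℕ) : Prog :=
  .seq (dblProg (treg d) Λ.sh) (.seq (.const (treg (d + 1)) (Λ.off q))
    (.seq (.add (treg d) (treg d) (treg (d + 1))) (.add (treg d) (treg d) Λ.b)))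

def Exp.compile : Exp A → ℕ → Prog
  | .lit c, d => .const (treg d) c
  | .var x, d => .add (treg d) (vreg x) 1
  | .add e f, d => .seq (e.compile d) (.seq (f.compile (d + 1)) (.add (treg d) (treg d) (treg (d + 1))))
  | .sub e f, d => .seq (e.compile d) (.seq (f.compile (d + 1)) (.sub (treg d) (treg d) (treg (d + 1))))
  | .get q e, d => .seq (e.compile d) (.seq (addrProg Λ q d) (.load (treg d) (treg d)))

def Exp.cost : Exp A → ℕ
  | .lit _ => 1
  | .var _ => 1
  | .add e f => e.cost + (f.cost + 1)
  | .sub e f => e.cost + (f.cost + 1)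
  | .get _ e => e.cost + (Λ.sh + 4 + 1)

def Cmd.compile : Cmd A → ℕ → Prog
  | .skip, _ => .const (treg 0) 0
  | .set x e, _ => .seq (e.compile Λ 0) (.add (vreg x) (treg 0) 1)
  | .put q e f, _ => .seq (e.compile Λ 0) (.seq (addrProg Λ q 0)
      (.seq (f.compile Λ 1) (.store (treg 0) (treg 1))))
  | .seq c d, k => .seq (c.compile k) (d.compile k)
  | .ite e f c d, k => .seq (e.compile Λ 0) (.seq (f.compile Λ 1)
      (.ifLt (treg 0) (treg 1) (c.compile k) (d.compile k)))
  | .loop x e c, k => .seq (e.compile Λ 0) (.seq (.add (breg k) (treg 0) 1)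
      (.seq (.const (creg k) 0) (.whileLt (creg k) (breg k) (.seq (.add (vreg x) (creg k) 1)
        (.seq (c.compile (k + 1)) (.seq (.const (treg 0) 1) (.add (creg k) (creg k) (treg 0))))))))

/-- A factor per tick that depends on the program text alone. Both branches of a conditional are
charged, so that a single number serves for all stores. -/
def Cmd.cost : Cmd A → ℕ
  | .skip => 1
  | .set _ e => e.cost Λ + 1
  | .put _ e f => e.cost Λ + (Λ.sh + 4) + f.cost Λ + 1
  | .seq c d => c.cost + d.cost
  | .ite e f c d => e.cost Λ + f.cost Λ + 1 + c.cost + d.cost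
  | .loop _ e c => e.cost Λ + 8 + c.cost

/-- The machine state `s` represents the store `σ`, with arrays based at `B`. -/
structure Rep (B : ℕ) (σ : Store A) (s : State) : Prop where
  v : ∀ x, s.reg (vreg x) = σ.v x
  one : s.reg 1 = 0
  base : s.reg Λ.b = B
  a : ∀ q i, s.mem (B + 2 ^ Λ.sh * i + Λ.off q) = σ.a q i

theorem vreg_injective : Function.Injective vreg := by
  intro x y h
  unfold vreg at h
  have : x.ctorIdx = y.ctorIdx := by lia
  cases x <;> cases y <;> first | rfl | (exfalso; revert this; decide)

omit [DecidableEq A] in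
theorem Rep.of_temps {B : ℕ} {σ : Store A} {s s' : State} (h : Rep Λ B σ s) (hm : s'.mem = s.mem)
    (hr : ∀ r, (∀ d, r ≠ treg d) → s'.reg r = s.reg r) : Rep Λ B σ s' := by
  have hb := Λ.hb
  refine ⟨fun x => ?_, ?_, ?_, fun q i => ?_⟩
  · rw [hr _ (fun d => by unfold vreg treg; lia), h.v]
  · rw [hr _ (fun d => by unfold treg; lia), h.one]
  · rw [hr _ (fun d => by unfold treg; lia), h.base]
  · rw [hm, h.a]

theorem State.setReg_reg (s : State) (r k r' : ℕ) :
    (s.setReg r k).reg r' = if r' = r then k else s.reg r' := by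
  simp [State.setReg, Function.update_apply]

@[simp] theorem State.setReg_mem (s : State) (r k : ℕ) : (s.setReg r k).mem = s.mem := rfl

theorem exec_dbl (r k : ℕ) (hr : r ≠ 1) (s : State) (h1 : s.reg 1 = 0) :
    Exec (dblProg r k) s (s.setReg r (2 ^ k * s.reg r)) (k + 1) := by
  induction k generalizing s with
  | zero =>
    have := Exec.add r r 1 s
    simpa [dblProg, h1] using this
  | succ k ih =>
    have h2 := ih (s.setReg r (s.reg r + s.reg r)) (by simp [State.setReg_reg, Ne.symm hr, h1])
    have := Exec.seq (Exec.add r r r s) h2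
    have hs : (s.setReg r (s.reg r + s.reg r)).setReg r
        (2 ^ k * (s.setReg r (s.reg r + s.reg r)).reg r) = s.setReg r (2 ^ (k + 1) * s.reg r) := by
      simp only [State.setReg, Function.update_self, Function.update_idem]
      congr 2; ring
    rw [hs, add_comm 1] at this
    exact this

omit [DecidableEq A] in
theorem exec_addr (q : A) (d : ℕ) (s : State) (h1 : s.reg 1 = 0) :
    ∃ s', Exec (addrProg Λ q d) s s' (Λ.sh + 4) ∧ s'.mem = s.mem ∧
      s'.reg (treg d) = s.reg Λ.b + 2 ^ Λ.sh * s.reg (treg d) + Λ.off q ∧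
      ∀ r, (∀ d' ≥ d, r ≠ treg d') → s'.reg r = s.reg r := by
  have hb := Λ.hb
  have e1 := exec_dbl (treg d) Λ.sh (by unfold treg; lia) s h1
  have e2 := Exec.seq e1 (Exec.seq (Exec.const (treg (d + 1)) (Λ.off q) _)
    (Exec.seq (Exec.add (treg d) (treg d) (treg (d + 1)) _) (Exec.add (treg d) (treg d) Λ.b _)))
  have n1 : treg d ≠ treg (d + 1) := by unfold treg; lia
  have n2 : Λ.b ≠ treg d := by unfold treg; lia
  have n3 : Λ.b ≠ treg (d + 1) := by unfold treg; lia
  refine ⟨_, e2, rfl, ?_, ?_⟩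
  · simp [State.setReg_reg, n1, n2, n3]; ring
  · intro r hr
    simp [State.setReg_reg, hr d le_rfl, hr (d + 1) (by lia)]

-- Temporaries behave as a stack: evaluation at position `d` touches only positions from `d` on, so
-- the first operand survives the evaluation of the second.
omit [DecidableEq A] in
theorem Exp.exec_compile (e : Exp A) (d B : ℕ) (σ : Store A) (s : State) (hs : Rep Λ B σ s) :
    ∃ s', Exec (e.compile Λ d) s s' (e.cost Λ) ∧ s'.mem = s.mem ∧ s'.reg (treg d) = e.eval σ ∧
      ∀ r, (∀ d' ≥ d, r ≠ treg d') → s'.reg r = s.reg r := by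
  induction e generalizing d s with
  | lit c =>
    exact ⟨_, Exec.const _ _ _, rfl, by simp [State.setReg_reg, Exp.eval],
      fun r hr => by simp [State.setReg_reg, hr d le_rfl]⟩
  | var x =>
    exact ⟨_, Exec.add _ _ _ _, rfl, by simp [State.setReg_reg, Exp.eval, hs.v, hs.one],
      fun r hr => by simp [State.setReg_reg, hr d le_rfl]⟩
  | add e f he hf =>
    obtain ⟨s₁, x₁, m₁, v₁, r₁⟩ := he d s hs
    obtain ⟨s₂, x₂, m₂, v₂, r₂⟩ := hf (d + 1) s₁ (hs.of_temps Λ m₁ fun r hr => r₁ r fun d' _ => hr d')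
    refine ⟨_, Exec.seq x₁ (Exec.seq x₂ (Exec.add _ _ _ _)), m₂.trans m₁, ?_, fun r hr => ?_⟩
    · simp only [State.setReg_reg, if_true, Exp.eval]
      rw [r₂ (treg d) (fun d' hd => by unfold treg; lia), v₁, v₂]
    · rw [State.setReg_reg, if_neg (hr d le_rfl), r₂ r (fun d' hd => hr d' (by lia)), r₁ r hr]
  | sub e f he hf =>
    obtain ⟨s₁, x₁, m₁, v₁, r₁⟩ := he d s hs
    obtain ⟨s₂, x₂, m₂, v₂, r₂⟩ := hf (d + 1) s₁ (hs.of_temps Λ m₁ fun r hr => r₁ r fun d' _ => hr d')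
    refine ⟨_, Exec.seq x₁ (Exec.seq x₂ (Exec.sub _ _ _ _)), m₂.trans m₁, ?_, fun r hr => ?_⟩
    · simp only [State.setReg_reg, if_true, Exp.eval]
      rw [r₂ (treg d) (fun d' hd => by unfold treg; lia), v₁, v₂]
    · rw [State.setReg_reg, if_neg (hr d le_rfl), r₂ r (fun d' hd => hr d' (by lia)), r₁ r hr]
  | get q e he =>
    obtain ⟨s₁, x₁, m₁, v₁, r₁⟩ := he d s hs
    have h₁ := hs.of_temps Λ m₁ fun r hr => r₁ r fun d' _ => hr d'
    obtain ⟨s₂, x₂, m₂, v₂, r₂⟩ := exec_addr Λ q d s₁ h₁.one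
    refine ⟨_, Exec.seq x₁ (Exec.seq x₂ (Exec.load _ _ _)), m₂.trans m₁, ?_, fun r hr => ?_⟩
    · simp only [State.setReg_reg, if_true, Exp.eval]
      rw [v₂, m₂, v₁, h₁.base, h₁.a]
    · rw [State.setReg_reg, if_neg (hr d le_rfl), r₂ r hr, r₁ r hr]

/-- `s'` agrees with `s` on the loop registers below depth `k`. -/
def LoopRegs (k : ℕ) (s s' : State) : Prop :=
  ∀ d < k, s'.reg (creg d) = s.reg (creg d) ∧ s'.reg (breg d) = s.reg (breg d)

theorem LoopRegs.trans {k : ℕ} {s₁ s₂ s₃ : State} (h : LoopRegs k s₁ s₂) (h' : LoopRegs k s₂ s₃) :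
    LoopRegs k s₁ s₃ :=
  fun d hd => ⟨(h' d hd).1.trans (h d hd).1, (h' d hd).2.trans (h d hd).2⟩

theorem LoopRegs.of_temps {k : ℕ} {s s' : State}
    (hr : ∀ r, (∀ d, r ≠ treg d) → s'.reg r = s.reg r) : LoopRegs k s s' :=
  fun d _ => ⟨hr _ fun d => by unfold creg treg; lia, hr _ fun d => by unfold breg treg; lia⟩

omit [DecidableEq A] in
theorem Rep.setV {B : ℕ} {σ : Store A} {s : State} (h : Rep Λ B σ s) (x : Var) (k : ℕ) :
    Rep Λ B (σ.setV x k) (s.setReg (vreg x) k) := by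
  have hb := Λ.hb
  refine ⟨fun y => ?_, ?_, ?_, h.a⟩
  · simp [State.setReg_reg, Store.setV_v, vreg_injective.eq_iff, h.v]
  · rw [State.setReg_reg, if_neg (by unfold vreg; lia), h.one]
  · rw [State.setReg_reg, if_neg (by unfold vreg; lia), h.base]

-- Offsets are smaller than the stride `2 ^ Λ.sh`, so quotient and remainder recover index and array
-- from an address: the interleaved arrays do not collide.
omit [DecidableEq A] in
theorem Layout.addr_inj {B i j : ℕ} {q r : A}
    (h : B + 2 ^ Λ.sh * i + Λ.off q = B + 2 ^ Λ.sh * j + Λ.off r) : q = r ∧ i = j := by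
  have hq := Λ.off_lt q
  have hr := Λ.off_lt r
  have h' : 2 ^ Λ.sh * i + Λ.off q = 2 ^ Λ.sh * j + Λ.off r := by lia
  have h1 : i = j := by
    have := congrArg (· / 2 ^ Λ.sh) h'
    simpa [Nat.mul_add_div (Nat.two_pow_pos _), Nat.div_eq_of_lt hq, Nat.div_eq_of_lt hr] using this
  subst h1
  exact ⟨Λ.off_inj (by lia), rfl⟩

theorem Rep.setA {B : ℕ} {σ : Store A} {s : State} (h : Rep Λ B σ s) (q : A) (i k : ℕ) :
    Rep Λ B (σ.setA q i k) (s.setMem (B + 2 ^ Λ.sh * i + Λ.off q) k) := by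
  refine ⟨h.v, h.one, h.base, fun r j => ?_⟩
  simp only [State.setMem, Function.update_apply, Store.setA_a]
  by_cases hq : r = q
  · subst hq
    by_cases hj : j = i
    · subst hj; simp
    · have : ¬ (B + 2 ^ Λ.sh * j + Λ.off r = B + 2 ^ Λ.sh * i + Λ.off r) :=
        fun e => hj (Λ.addr_inj e).2
      rw [if_neg this, if_pos rfl, Function.update_of_ne hj, h.a]
  · have : ¬ (B + 2 ^ Λ.sh * j + Λ.off r = B + 2 ^ Λ.sh * i + Λ.off q) :=
      fun e => hq (Λ.addr_inj e).1
    rw [if_neg this, if_neg hq, h.a]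

/-- Compiled code simulates the command with a slowdown by the constant `c.cost Λ`. The clause on
`LoopRegs` protects the counters of enclosing loops: a loop at depth `k` compiles its body at depth
`k + 1`. -/
theorem Cmd.exec_compile (c : Cmd A) (k B : ℕ) (σ : Store A) (s : State) (hs : Rep Λ B σ s) :
    ∃ s' t, Exec (c.compile Λ k) s s' t ∧ t ≤ c.cost Λ * c.ticks σ ∧ Rep Λ B (c.run σ) s' ∧
      LoopRegs k s s' := by
  have hb := Λ.hb
  induction c generalizing k σ s with
  | skip =>
    have hr : ∀ r, (∀ d, r ≠ treg d) → (s.setReg (treg 0) 0).reg r = s.reg r :=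
      fun r hr => by simp [State.setReg_reg, hr]
    exact ⟨_, _, Exec.const _ _ _, by simp [Cmd.cost, Cmd.ticks], hs.of_temps Λ rfl hr, .of_temps hr⟩
  | set x e =>
    obtain ⟨s₁, x₁, m₁, v₁, r₁⟩ := e.exec_compile Λ 0 B σ s hs
    have h₁ := hs.of_temps Λ m₁ fun r hr => r₁ r fun d' _ => hr d'
    refine ⟨_, _, Exec.seq x₁ (Exec.add _ _ _ _), by simp [Cmd.cost, Cmd.ticks], ?_, ?_⟩
    · rw [v₁, h₁.one]; exact h₁.setV Λ x _
    · refine (LoopRegs.of_temps fun r hr => r₁ r fun d' _ => hr d').trans fun d _ => ⟨?_, ?_⟩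
      · rw [State.setReg_reg, if_neg (by unfold creg vreg; lia)]
      · rw [State.setReg_reg, if_neg (by unfold breg vreg; lia)]
  | put q e f =>
    obtain ⟨s₁, x₁, m₁, v₁, r₁⟩ := e.exec_compile Λ 0 B σ s hs
    have h₁ := hs.of_temps Λ m₁ fun r hr => r₁ r fun d' _ => hr d'
    obtain ⟨s₂, x₂, m₂, v₂, r₂⟩ := exec_addr Λ q 0 s₁ h₁.one
    have h₂ := h₁.of_temps Λ m₂ fun r hr => r₂ r fun d' _ => hr d'
    obtain ⟨s₃, x₃, m₃, v₃, r₃⟩ := f.exec_compile Λ 1 B σ s₂ h₂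
    have h₃ := h₂.of_temps Λ m₃ fun r hr => r₃ r fun d' _ => hr d'
    refine ⟨_, _, Exec.seq x₁ (Exec.seq x₂ (Exec.seq x₃ (Exec.store _ _ _))),
      by simp [Cmd.cost, Cmd.ticks]; lia, ?_, ?_⟩
    · rw [v₃, r₃ (treg 0) (fun d' hd => by unfold treg; lia), v₂, v₁, h₁.base]
      exact h₃.setA Λ q _ _
    · refine .of_temps fun r hr => ?_
      change s₃.reg r = _
      rw [r₃ r (fun d' _ => hr d'), r₂ r (fun d' _ => hr d'), r₁ r (fun d' _ => hr d')]
  | seq c d hc hd =>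
    obtain ⟨s₁, t₁, x₁, l₁, p₁, r₁⟩ := hc k σ s hs
    obtain ⟨s₂, t₂, x₂, l₂, p₂, r₂⟩ := hd k _ s₁ p₁
    refine ⟨_, _, Exec.seq x₁ x₂, ?_, p₂, r₁.trans r₂⟩
    simp only [Cmd.cost, Cmd.ticks]
    nlinarith [Nat.zero_le (c.cost Λ * d.ticks (c.run σ)), Nat.zero_le (d.cost Λ * c.ticks σ)]
  | ite e f c d hc hd =>
    obtain ⟨s₁, x₁, m₁, v₁, r₁⟩ := e.exec_compile Λ 0 B σ s hs
    have h₁ := hs.of_temps Λ m₁ fun r hr => r₁ r fun d' _ => hr d'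
    obtain ⟨s₂, x₂, m₂, v₂, r₂⟩ := f.exec_compile Λ 1 B σ s₁ h₁
    have h₂ := h₁.of_temps Λ m₂ fun r hr => r₂ r fun d' _ => hr d'
    have hl : LoopRegs k s s₂ := .of_temps fun r hr => by
      rw [r₂ r (fun d' _ => hr d'), r₁ r (fun d' _ => hr d')]
    have hv : s₂.reg (treg 0) = e.eval σ := by
      rw [r₂ (treg 0) (fun d' hd => by unfold treg; lia), v₁]
    by_cases hlt : e.eval σ < f.eval σ
    · obtain ⟨s₃, t₃, x₃, l₃, p₃, r₃⟩ := hc k σ s₂ h₂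
      refine ⟨_, _, Exec.seq x₁ (Exec.seq x₂ (Exec.ifTrue (by rwa [hv, v₂]) x₃)), ?_,
        by simpa [Cmd.run, hlt] using p₃, hl.trans r₃⟩
      simp only [Cmd.cost, Cmd.ticks, hlt, if_true]
      nlinarith [Nat.zero_le ((e.cost Λ + f.cost Λ + 1 + d.cost Λ) * c.ticks σ)]
    · obtain ⟨s₃, t₃, x₃, l₃, p₃, r₃⟩ := hd k σ s₂ h₂
      refine ⟨_, _, Exec.seq x₁ (Exec.seq x₂ (Exec.ifFalse (by rwa [hv, v₂]) x₃)), ?_,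
        by simpa [Cmd.run, hlt] using p₃, hl.trans r₃⟩
      simp only [Cmd.cost, Cmd.ticks, hlt, if_false]
      nlinarith [Nat.zero_le ((e.cost Λ + f.cost Λ + 1 + c.cost Λ) * d.ticks σ)]
  | loop x e c hc =>
    obtain ⟨s₁, x₁, m₁, v₁, r₁⟩ := e.exec_compile Λ 0 B σ s hs
    have h₁ := hs.of_temps Λ m₁ fun r hr => r₁ r fun d' _ => hr d'
    set b := e.eval σ with hbdef
    set W : Prog := .whileLt (creg k) (breg k) (.seq (.add (vreg x) (creg k) 1)
        (.seq (c.compile Λ (k + 1)) (.seq (.const (treg 0) 1) (.add (creg k) (creg k) (treg 0)))))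
      with hW
    -- Induction on the number `j` of remaining rounds. The 4 counts the machine steps of a round
    -- outside the body: the test, the copy of the counter, loading 1 and the increment. They are
    -- paid by the extra tick of each round.
    have key : ∀ j i, i + j = b → ∀ s₀ : State, Rep Λ B (iterStore x c.run σ i) s₀ →
        s₀.reg (creg k) = i → s₀.reg (breg k) = b →
        ∃ s' t, Exec W s₀ s' t ∧
          t ≤ 1 + (4 + c.cost Λ) * ∑ i ∈ Finset.Ico i b,
            (c.ticks ((iterStore x c.run σ i).setV x i) + 1) ∧
          Rep Λ B (iterStore x c.run σ b) s' ∧ LoopRegs k s₀ s' := by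
      intro j
      induction j with
      | zero =>
        intro i hi s₀ hs₀ hc₀ hb₀
        have : i = b := by lia
        subst this
        exact ⟨s₀, 1, Exec.whileFalse (by lia), by simp, hs₀, fun d _ => ⟨rfl, rfl⟩⟩
      | succ j ih =>
        intro i hi s₀ hs₀ hc₀ hb₀
        have y₁ := Exec.add (vreg x) (creg k) 1 s₀
        have g₁ := hs₀.setV Λ x i
        rw [hc₀, hs₀.one, add_zero] at y₁
        obtain ⟨s₂, t₂, y₂, l₂, g₂, w₂⟩ := hc (k + 1) _ _ g₁
        obtain ⟨wc, wb⟩ := w₂ k (by lia)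
        rw [State.setReg_reg, if_neg (by unfold creg vreg; lia), hc₀] at wc
        rw [State.setReg_reg, if_neg (by unfold breg vreg; lia), hb₀] at wb
        have y₃ := Exec.const (treg 0) 1 s₂
        have y₄ := Exec.add (creg k) (creg k) (treg 0) (s₂.setReg (treg 0) 1)
        have nct : creg k ≠ treg 0 := by unfold creg treg; lia
        have nbc : breg k ≠ creg k := by unfold breg creg; lia
        have nbt : breg k ≠ treg 0 := by unfold breg treg; lia
        simp only [State.setReg_reg, if_true, if_neg nct, wc] at y₄
        obtain ⟨s₅, t₅, y₅, l₅, g₅, w₅⟩ := ih (i + 1) (by lia)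
          ((s₂.setReg (treg 0) 1).setReg (creg k) (i + 1))
          ⟨fun z => by
              rw [State.setReg_reg, if_neg (by unfold creg vreg; lia), State.setReg_reg,
                if_neg (by unfold treg vreg; lia)]
              exact g₂.v z,
            by
              rw [State.setReg_reg, if_neg (by unfold creg; lia), State.setReg_reg,
                if_neg (by unfold treg; lia)]
              exact g₂.one,
            by
              rw [State.setReg_reg, if_neg (by unfold creg; lia), State.setReg_reg,
                if_neg (by unfold treg; lia)]
              exact g₂.base,
            g₂.a⟩
          (by simp [State.setReg_reg]) (by simp [State.setReg_reg, nbc, nbt, wb])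
        refine ⟨s₅, _, Exec.whileTrue (by lia) (Exec.seq y₁ (Exec.seq y₂ (Exec.seq y₃ y₄))) y₅, ?_,
          g₅, fun d hd => ?_⟩
        · rw [Finset.sum_eq_sum_Ico_succ_bot (by lia : i < b), Nat.mul_add]
          nlinarith [Nat.zero_le (4 * c.ticks ((iterStore x c.run σ i).setV x i))]
        · obtain ⟨a₁, a₂⟩ := w₅ d hd
          obtain ⟨b₁, b₂⟩ := w₂ d (by lia)
          have n1 : creg d ≠ creg k := by unfold creg; lia
          have n2 : creg d ≠ treg 0 := by unfold creg treg; lia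
          have n3 : breg d ≠ creg k := by unfold breg creg; lia
          have n4 : breg d ≠ treg 0 := by unfold breg treg; lia
          have n5 : creg d ≠ vreg x := by unfold creg vreg; lia
          have n6 : breg d ≠ vreg x := by unfold breg vreg; lia
          simp only [State.setReg_reg, n1, n2, n3, n4, n5, n6, if_false] at a₁ a₂ b₁ b₂
          exact ⟨a₁.trans b₁, a₂.trans b₂⟩
    have z₁ := Exec.add (breg k) (treg 0) 1 s₁
    rw [v₁, h₁.one, add_zero] at z₁
    have z₂ := Exec.const (creg k) 0 (s₁.setReg (breg k) b)
    have nbc : breg k ≠ creg k := by unfold breg creg; lia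
    obtain ⟨s₃, t₃, z₃, l₃, g₃, w₃⟩ := key b 0 (by lia)
      ((s₁.setReg (breg k) b).setReg (creg k) 0)
      ⟨fun z => by
          rw [State.setReg_reg, if_neg (by unfold creg vreg; lia), State.setReg_reg,
            if_neg (by unfold breg vreg; lia)]
          exact h₁.v z,
        by
          rw [State.setReg_reg, if_neg (by unfold creg; lia), State.setReg_reg,
            if_neg (by unfold breg; lia)]
          exact h₁.one,
        by
          rw [State.setReg_reg, if_neg (by unfold creg; lia), State.setReg_reg,
            if_neg (by unfold breg; lia)]
          exact h₁.base,
        h₁.a⟩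
      (by simp [State.setReg_reg]) (by simp [State.setReg_reg, nbc])
    refine ⟨s₃, _, Exec.seq x₁ (Exec.seq z₁ (Exec.seq z₂ z₃)), ?_, g₃, fun d hd => ?_⟩
    · simp only [Cmd.cost, Cmd.ticks, ← hbdef, Finset.range_eq_Ico]
      nlinarith [Nat.zero_le ((e.cost Λ + 4) * ∑ i ∈ Finset.Ico 0 b,
            (c.ticks ((iterStore x c.run σ i).setV x i) + 1))]
    · obtain ⟨a₁, a₂⟩ := w₃ d hd
      have n1 : creg d ≠ creg k := by unfold creg; lia
      have n2 : creg d ≠ breg k := by unfold creg breg; lia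
      have n3 : breg d ≠ creg k := by unfold breg creg; lia
      have n4 : breg d ≠ breg k := by unfold breg; lia
      simp only [State.setReg_reg, n1, n2, n3, n4, if_false] at a₁ a₂
      have hcr : creg d = 4 * d + 5 := rfl
      have hbr : breg d = 4 * d + 6 := rfl
      exact ⟨a₁.trans (r₁ _ fun d' _ => by unfold creg treg; lia),
        a₂.trans (r₁ _ fun d' _ => by unfold breg treg; lia)⟩

end Compile

open SimpleGraph

/-! ### Edge functionals modulo two -/

section Parity

variable {V : Type*} {G : SimpleGraph V}

/-- The sum of `φ` over the edges of a walk. -/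
def walkSum (φ : Sym2 V → ZMod 2) {x y : V} (p : G.Walk x y) : ZMod 2 :=
  (p.edges.map φ).sum

@[simp] theorem walkSum_nil (φ : Sym2 V → ZMod 2) {x : V} :
    walkSum φ (Walk.nil : G.Walk x x) = 0 := by simp [walkSum]

@[simp] theorem walkSum_cons (φ : Sym2 V → ZMod 2) {x y z : V} (h : G.Adj x y) (p : G.Walk y z) :
    walkSum φ (Walk.cons h p) = φ s(x, y) + walkSum φ p := by simp [walkSum]

@[simp] theorem walkSum_append (φ : Sym2 V → ZMod 2) {x y z : V} (p : G.Walk x y)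
    (q : G.Walk y z) : walkSum φ (p.append q) = walkSum φ p + walkSum φ q := by simp [walkSum]

@[simp] theorem walkSum_reverse (φ : Sym2 V → ZMod 2) {x y : V} (p : G.Walk x y) :
    walkSum φ p.reverse = walkSum φ p := by simp [walkSum]

theorem exists_loop_of_not_isPath {x y : V} (p : G.Walk x y) (hp : ¬ p.IsPath) :
    ∃ (w : V) (p₁ : G.Walk x w) (c : G.Walk w w) (p₂ : G.Walk w y),
      0 < c.length ∧ p = p₁.append (c.append p₂) := by
  classical
  induction p with
  | nil => exact absurd Walk.IsPath.nil hp
  | @cons u v w h q ih =>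
    by_cases hq : q.IsPath
    · have hu : u ∈ q.support := by
        by_contra hu
        exact hp ((Walk.cons_isPath_iff h q).2 ⟨hq, hu⟩)
      refine ⟨u, Walk.nil, Walk.cons h (q.takeUntil u hu), q.dropUntil u hu, by simp, ?_⟩
      simp
    · obtain ⟨w, p₁, c, p₂, hc, rfl⟩ := ih hq
      exact ⟨w, Walk.cons h p₁, c, p₂, hc, rfl⟩

/-- Geodesic cycles generate the cycle space modulo two. Strong induction on the length: a closed
walk that is not a geodesic cycle either backtracks along one edge or is, modulo two, a sum of two
strictly shorter closed walks. -/
theorem walkSum_closed_eq_zero (hG : G.Connected) (φ : Sym2 V → ZMod 2)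
    (hφ : ∀ (v : V) (c : G.Walk v v), IsGeodesicCycle G c → walkSum φ c = 0) (v : V)
    (c : G.Walk v v) : walkSum φ c = 0 := by
  classical
  obtain ⟨N, hN⟩ : ∃ N, c.length = N := ⟨_, rfl⟩
  induction N using Nat.strong_induction_on generalizing v c with
  | _ N ih =>
  cases c with
  | nil => simp
  | @cons _ u _ h p =>
    by_cases hp : p.IsPath
    swap
    · obtain ⟨w, p₁, c, p₂, hc, rfl⟩ := exists_loop_of_not_isPath p hp
      have h1 := ih _ (by simp at hN ⊢; lia) v (Walk.cons h (p₁.append p₂)) rfl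
      have h2 := ih _ (by simp at hN ⊢; lia) w c rfl
      simp only [walkSum_cons, walkSum_append] at h1 ⊢
      rw [h2, zero_add, h1]
    -- If the closing edge already lies on the path `p`, then `p` consists of this edge alone and
    -- the walk goes there and back.
    by_cases he : s(v, u) ∈ p.edges
    · cases p with
      | nil => simp at he
      | @cons _ w _ h' q =>
        rw [Walk.cons_isPath_iff] at hp
        rw [Walk.edges_cons, List.mem_cons] at he
        rcases he with he | he
        · have hw : w = v := by
            rw [Sym2.eq_swap, Sym2.eq_iff] at he
            rcases he with ⟨_, h2⟩ | ⟨h1, h2⟩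
            · exact h2.symm
            · exact h1.symm.trans h2.symm
          subst hw
          have : q = Walk.nil := (Walk.isPath_iff_nil.1 hp.1).eq_nil
          subst this
          simp [Sym2.eq_swap (a := u), CharTwo.add_self_eq_zero]
        · exact absurd (Walk.snd_mem_support_of_mem_edges _ he) hp.2
    set c := Walk.cons h p with hc
    have hcyc : c.IsCycle := (Walk.cons_isCycle_iff p h).2 ⟨hp, he⟩
    by_cases hgeo : IsGeodesicCycle G c
    · exact hφ v c hgeo
    have : ∃ x ∈ c.support, ∃ y ∈ c.support,
        ∀ p : G.Walk x y, p.length = G.dist x y → ∃ e ∈ p.edges, e ∉ c.edges := by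
      by_contra! hcon
      exact hgeo ⟨hcyc, hcon⟩
    obtain ⟨x, hx, y, hy, hxy⟩ := this
    have hy' : y ∈ (c.rotate x hx).support := (c.mem_support_rotate_iff x hx).2 hy
    set a := (c.rotate x hx).takeUntil y hy' with ha
    set b := (c.rotate x hx).dropUntil y hy' with hb
    have hab : a.append b = c.rotate x hx := Walk.take_spec _ hy'
    have hedges : ∀ e, e ∈ (a.append b).edges → e ∈ c.edges := fun e he => by
      rw [hab] at he; exact (c.rotate_edges x hx).mem_iff.1 he
    have hlen : a.length + b.length = N := by
      rw [← Walk.length_append, hab, Walk.length_rotate, hN]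
    have hsum : walkSum φ c = walkSum φ a + walkSum φ b := by
      rw [← walkSum_append, hab]
      exact ((c.rotate_edges x hx).perm.map φ).sum_eq.symm
    have ha' : a.length ≠ G.dist x y := fun e => by
      obtain ⟨e, he, he'⟩ := hxy a e
      exact he' (hedges e (by simp [he]))
    have hb' : b.length ≠ G.dist x y := fun e => by
      obtain ⟨e, he, he'⟩ := hxy b.reverse (by simpa using e)
      exact he' (hedges e (by simp at he; simp [he]))
    have ha2 := dist_le a
    have hb2 := dist_le b.reverse
    rw [Walk.length_reverse] at hb2
    -- Both arcs `a` and `b` are strictly longer than the distance. Hence replacing either one by a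
    -- geodesic `Q` gives a shorter closed walk, and the two copies of `Q` cancel.
    obtain ⟨Q, hQ⟩ := hG.exists_walk_length_eq_dist x y
    have h1 := ih _ (by simp; lia) x (a.append Q.reverse) rfl
    have h2 := ih _ (by simp; lia) x (Q.append b) rfl
    simp only [walkSum_append, walkSum_reverse] at h1 h2
    have h3 := CharTwo.add_self_eq_zero (walkSum φ Q)
    rw [hsum]
    linear_combination h1 + h2 - h3

/-- Vanishing on geodesic cycles implies vanishing on closed walks, so sums along walks from a root
are independent of the walk. -/
theorem exists_potential (hG : G.Connected) (φ : Sym2 V → ZMod 2)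
    (hφ : ∀ (v : V) (c : G.Walk v v), IsGeodesicCycle G c → walkSum φ c = 0) :
    ∃ f : V → ZMod 2, ∀ (x y : V) (p : G.Walk x y), walkSum φ p = f x + f y := by
  obtain ⟨r⟩ := hG.nonempty
  refine ⟨fun x => walkSum φ (hG.preconnected r x).some, fun x y p => ?_⟩
  beta_reduce
  have h := walkSum_closed_eq_zero hG φ hφ r
    (((hG.preconnected r x).some.append p).append (hG.preconnected r y).some.reverse)
  simp only [walkSum_append, walkSum_reverse] at h
  generalize walkSum φ (hG.preconnected r x).some = a at *
  generalize walkSum φ (hG.preconnected r y).some = b at *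
  have h1 := CharTwo.add_self_eq_zero a
  have h2 := CharTwo.add_self_eq_zero b
  linear_combination h - h1 - h2

theorem walkSum_of_coboundary (φ : Sym2 V → ZMod 2) (h : V → ZMod 2) {x y : V} (p : G.Walk x y)
    (hp : ∀ a b, s(a, b) ∈ p.edges → φ s(a, b) = h a + h b) : walkSum φ p = h x + h y := by
  induction p with
  | nil => simp [CharTwo.add_self_eq_zero]
  | @cons u v w hadj q ih =>
    rw [walkSum_cons, hp u v (by simp), ih fun a b hab => hp a b (by simp [hab])]
    have := CharTwo.add_self_eq_zero (h v)
    linear_combination this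

end Parity

/-! ### Splitting the bags into classes of nearby vertices -/

/-- The bags of `D`, split into the classes of the equivalence relation generated in each bag
by `G.dist x y ≤ l`. -/
structure Classes {V ι : Type*} {G : SimpleGraph V} (D : TreeDecomposition G ι) (l : ℕ)
    (κ : Type*) where
  node : κ → ι
  cls : κ → Finset V
  subset : ∀ M, cls M ⊆ D.bag (node M)
  nonempty : ∀ M, (cls M).Nonempty
  cover : ∀ t, ∀ x ∈ D.bag t, ∃ M, node M = t ∧ x ∈ cls M
  unique : ∀ M M' x, node M = node M' → x ∈ cls M → x ∈ cls M' → M = M'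
  closed : ∀ M, ∀ x ∈ cls M, ∀ y ∈ D.bag (node M), G.dist x y ≤ l → y ∈ cls M
  chain : ∀ M, ∀ x ∈ cls M, ∀ y ∈ cls M,
    Relation.ReflTransGen (fun a b => a ∈ cls M ∧ b ∈ cls M ∧ G.dist a b ≤ l) x y

namespace Classes

variable {V ι κ : Type*} {G : SimpleGraph V} {D : TreeDecomposition G ι} {l : ℕ}
  (K : Classes D l κ)

/-- Two classes are adjacent if their nodes are and they intersect. -/
def tree : SimpleGraph κ where
  Adj M M' := D.tree.Adj (K.node M) (K.node M') ∧ ∃ x, x ∈ K.cls M ∧ x ∈ K.cls M'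
  symm := ⟨fun _ _ h => ⟨h.1.symm, h.2.imp fun _ hx => hx.symm⟩⟩
  loopless := ⟨fun _ h => h.1.ne rfl⟩

end Classes

/-! ### The two sides of an edge of the decomposition tree -/

section Side

variable {V ι : Type*} {G : SimpleGraph V} (D : TreeDecomposition G ι)

/-- The nodes on the side of `t` of the tree edge `t t'`. -/
def TreeDecomposition.Side (t t' s : ι) : Prop :=
  (D.tree.deleteEdges {s(t, t')}).Reachable t s

theorem TreeDecomposition.side_self (t t' : ι) : D.Side t t' t := Reachable.refl _

theorem TreeDecomposition.not_side {t t' : ι} (h : D.tree.Adj t t') : ¬ D.Side t t' t' :=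
  isBridge_iff.1 (isAcyclic_iff_forall_adj_isBridge.1 D.isTree.isAcyclic h)

theorem TreeDecomposition.side_of_adj {t t' s s' : ι} (h : D.tree.Adj s s')
    (hne : s(s, s') ≠ s(t, t')) (hs : D.Side t t' s) : D.Side t t' s' := by
  refine Reachable.trans hs (Adj.reachable ?_)
  simp [deleteEdges_adj, h, hne]

/-- The tree path between nodes on different sides uses the edge from `t` to `t'`, and a vertex in
both end bags lies in every bag along that path. -/
theorem TreeDecomposition.mem_of_sides {t t' s s' : ι} (hs : D.Side t t' s)
    (hs' : ¬ D.Side t t' s') {x : V} (hx : x ∈ D.bag s) (hx' : x ∈ D.bag s') :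
    x ∈ D.bag t ∧ x ∈ D.bag t' := by
  obtain ⟨p, hp⟩ := (D.isTree.existsUnique_path s s').exists
  have he : s(t, t') ∈ p.edges := by
    by_contra he
    exact hs' (Reachable.trans hs (reachable_deleteEdges_iff_exists_walk.2 ⟨p, he⟩))
  exact ⟨D.path_mem s s' p hp t (p.fst_mem_support_of_mem_edges he) x hx hx',
    D.path_mem s s' p hp t' (p.snd_mem_support_of_mem_edges he) x hx hx'⟩

end Side

/-! ### The classes form a tree -/

namespace Classes

variable {V ι κ : Type*} {G : SimpleGraph V} {D : TreeDecomposition G ι} {l : ℕ}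
  (K : Classes D l κ)

/-- The path of `D` between the two nodes lifts to classes: every bag on it contains `S`, and as `S`
has diameter at most `l`, closedness places all of `S` in a single class of each node. Singletons
serve for vertices, two-element sets for close pairs. -/
theorem reachable_of_mem (M M' : κ) (S : Set V) (hS : S.Nonempty)
    (hdist : ∀ x ∈ S, ∀ y ∈ S, G.dist x y ≤ l)
    (h : ∀ x ∈ S, x ∈ K.cls M) (h' : ∀ x ∈ S, x ∈ K.cls M') :
    ∃ p : K.tree.Walk M M', ∀ N ∈ p.support, ∀ x ∈ S, x ∈ K.cls N := by
  obtain ⟨x₀, hx₀⟩ := hS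
  obtain ⟨p, hp⟩ := (D.isTree.existsUnique_path (K.node M) (K.node M')).exists
  have hall : ∀ s ∈ p.support, ∀ x ∈ S, x ∈ D.bag s := fun s hs x hx =>
    D.path_mem _ _ p hp s hs x (K.subset _ (h x hx)) (K.subset _ (h' x hx))
  clear hp
  suffices ∀ (s s' : ι) (p : D.tree.Walk s s'), (∀ r ∈ p.support, ∀ x ∈ S, x ∈ D.bag r) →
      ∀ M M', K.node M = s → K.node M' = s' → (∀ x ∈ S, x ∈ K.cls M) → (∀ x ∈ S, x ∈ K.cls M') →
      ∃ p : K.tree.Walk M M', ∀ N ∈ p.support, ∀ x ∈ S, x ∈ K.cls N from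
    this _ _ p hall M M' rfl rfl h h'
  intro s s' p
  induction p with
  | nil =>
    intro _ M M' e e' h h'
    have : M = M' := K.unique M M' x₀ (e.trans e'.symm) (h x₀ hx₀) (h' x₀ hx₀)
    subst this
    exact ⟨Walk.nil, fun N hN => by simp at hN; subst hN; exact h⟩
  | @cons s r s' hadj q ih =>
    intro hall M M' e e' h h'
    have hr : ∀ x ∈ S, x ∈ D.bag r := hall r (by simp)
    obtain ⟨N, hN, hxN⟩ := K.cover r x₀ (hr x₀ hx₀)
    have hSN : ∀ x ∈ S, x ∈ K.cls N := fun x hx =>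
      K.closed N x₀ hxN x (hN ▸ hr x hx) (hdist x₀ hx₀ x hx)
    obtain ⟨p, hp⟩ := ih (fun r hr => hall r (by simp [hr])) N M' hN e' hSN h'
    have hadj' : K.tree.Adj M N := ⟨by rw [e, hN]; exact hadj, x₀, h x₀ hx₀, hxN⟩
    refine ⟨Walk.cons hadj' p, fun N' hN' => ?_⟩
    rw [Walk.support_cons, List.mem_cons] at hN'
    rcases hN' with rfl | hN'
    · exact h
    · exact hp N' hN'

theorem exists_mem_mem_of_adj (hl : 1 ≤ l) {x y : V} (h : G.Adj x y) :
    ∃ M, x ∈ K.cls M ∧ y ∈ K.cls M := by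
  obtain ⟨t, hx, hy⟩ := D.edge_mem x y h
  obtain ⟨M, rfl, hM⟩ := K.cover t x hx
  exact ⟨M, hM, K.closed M x hM y hy (by rw [dist_eq_one_iff_adj.2 h]; exact hl)⟩

/-- A walk of `G` is followed edge by edge: the ends of an edge are at distance 1, hence share a
class because `1 ≤ l`, and classes with a common vertex are already known to be joined. -/
theorem tree_connected (hG : G.Connected) (hl : 1 ≤ l) : K.tree.Connected := by
  have hv : ∀ x M M', x ∈ K.cls M → x ∈ K.cls M' → K.tree.Reachable M M' := by
    intro x M M' h h'
    obtain ⟨p, -⟩ := K.reachable_of_mem M M' {x} ⟨x, rfl⟩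
      (by rintro _ rfl _ rfl; simp) (by rintro _ rfl; exact h) (by rintro _ rfl; exact h')
    exact ⟨p⟩
  have hw : ∀ (x y : V) (p : G.Walk x y) M M', x ∈ K.cls M → y ∈ K.cls M' →
      K.tree.Reachable M M' := by
    intro x y p
    induction p with
    | nil => exact fun M M' h h' => hv _ M M' h h'
    | cons hadj q ih =>
      intro M M' h h'
      obtain ⟨N, h1, h2⟩ := K.exists_mem_mem_of_adj hl hadj
      exact (hv _ _ _ h h1).trans (ih N M' h2 h')
  rw [connected_iff]
  constructor
  · intro M M'
    obtain ⟨x, hx⟩ := K.nonempty M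
    obtain ⟨y, hy⟩ := K.nonempty M'
    exact hw x y (hG.preconnected x y).some M M' hx hy
  · obtain ⟨x⟩ := hG.nonempty
    obtain ⟨t, ht⟩ := D.vertex_mem x
    exact ⟨(K.cover t x ht).choose⟩

-- Each edge from `N` to `N'` is a bridge: a function `g` on the classes with values in `ZMod 2` is
-- built that is constant across all other edges but differs at `N` and `N'`. It comes from the
-- potential of an edge functional `φ` that vanishes on every geodesic cycle because such a cycle
-- has length at most `l`.
open Classical in
theorem tree_isAcyclic (hG : G.Connected)
    (hcyc : ∀ (v : V) (c : G.Walk v v), IsGeodesicCycle G c → c.length ≤ l) :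
    K.tree.IsAcyclic := by
  rw [isAcyclic_iff_forall_adj_isBridge]
  intro N N' hNN'
  rw [isBridge_iff_forall_walk_mem_edges]
  intro p
  by_contra hp
  obtain ⟨hadj, v₀, hv₀, hv₀'⟩ := hNN'
  set t := K.node N with ht
  set t' := K.node N' with ht'
  let ψ : V → ZMod 2 := fun v => if v ∈ K.cls N ∧ v ∈ K.cls N' then 1 else 0
  let A : Set V := {x | ∃ s, D.Side t t' s ∧ x ∈ D.bag s}
  let B : Set V := {x | ∃ s, ¬ D.Side t t' s ∧ x ∈ D.bag s}
  have hAB : ∀ x, x ∈ A → x ∈ B → x ∈ D.bag t ∧ x ∈ D.bag t' :=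
    fun x ⟨s, hs, hx⟩ ⟨s', hs', hx'⟩ => D.mem_of_sides hs hs' hx hx'
  -- The overlap of `A` and `B` lies in the bags of both `t` and `t'`, and classes are closed under
  -- distance at most `l`; so membership in `N ∩ N'` cannot change between nearby vertices of the
  -- overlap.
  have hψ : ∀ x y, x ∈ A → x ∈ B → y ∈ A → y ∈ B → G.dist x y ≤ l → ψ x = ψ y := by
    intro x y hx hx' hy hy' hd
    obtain ⟨h1, h2⟩ := hAB x hx hx'
    obtain ⟨h3, h4⟩ := hAB y hy hy'
    have hd' : G.dist y x ≤ l := by rwa [dist_comm]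
    have : (x ∈ K.cls N ∧ x ∈ K.cls N') ↔ (y ∈ K.cls N ∧ y ∈ K.cls N') :=
      ⟨fun h => ⟨K.closed N x h.1 y h3 hd, K.closed N' x h.2 y h4 hd⟩,
        fun h => ⟨K.closed N y h.1 x h1 hd', K.closed N' y h.2 x h2 hd'⟩⟩
    simp only [ψ, this]
  -- The coboundary of `ψ`, restricted to edges with both ends in `A`. It need not be a coboundary
  -- by itself: this truncation is what makes it detect cycles through the tree edge.
  let φ : Sym2 V → ZMod 2 := Sym2.lift ⟨fun u v => if u ∈ A ∧ v ∈ A then ψ u + ψ v else 0,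
    fun u v => by simp only [and_comm, add_comm]⟩
  have hφ : ∀ u v, φ s(u, v) = if u ∈ A ∧ v ∈ A then ψ u + ψ v else 0 := fun u v => rfl
  -- On a walk of diameter at most `l`, `ψ` takes a single value `c` on the overlap of `A` and `B`.
  -- Extending `ψ` by `c` outside `A` gives `h` with coboundary `φ` along the walk: an edge not
  -- inside `A` lies in a bag on the far side, so both its ends have value `c`.
  have hwalk : ∀ (x y : V) (Q : G.Walk x y),
      (∀ a ∈ Q.support, ∀ b ∈ Q.support, G.dist a b ≤ l) →
      ∃ (c : ZMod 2) (h : V → ZMod 2), (∀ v ∈ A, h v = ψ v) ∧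
        (∀ v ∈ Q.support, v ∈ B → h v = c) ∧ walkSum φ Q = h x + h y := by
    intro x y Q hQ
    obtain ⟨c, hc⟩ : ∃ c, ∀ v ∈ Q.support, v ∈ A → v ∈ B → ψ v = c := by
      by_cases hex : ∃ w ∈ Q.support, w ∈ A ∧ w ∈ B
      · obtain ⟨w, hw, hwA, hwB⟩ := hex
        exact ⟨ψ w, fun v hv hA hB => hψ v w hA hB hwA hwB (hQ v hv w hw)⟩
      · exact ⟨0, fun v hv hA hB => absurd ⟨v, hv, hA, hB⟩ hex⟩
    let h : V → ZMod 2 := fun v => if v ∈ A then ψ v else c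
    have hB : ∀ v ∈ Q.support, v ∈ B → h v = c := by
      intro v hv hvB
      by_cases hA : v ∈ A
      · simp only [h, hA, if_true]; exact hc v hv hA hvB
      · simp only [h, hA, if_false]
    have hA : ∀ v ∈ A, h v = ψ v := fun v hv => by simp only [h, hv, if_true]
    refine ⟨c, h, hA, hB, walkSum_of_coboundary φ h Q fun a b hab => ?_⟩
    rw [hφ]
    by_cases hab' : a ∈ A ∧ b ∈ A
    · rw [if_pos hab', hA a hab'.1, hA b hab'.2]
    · rw [if_neg hab']
      obtain ⟨s, has, hbs⟩ := D.edge_mem a b (Q.adj_of_mem_edges hab)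
      have hs : ¬ D.Side t t' s := fun hs => hab' ⟨⟨s, hs, has⟩, ⟨s, hs, hbs⟩⟩
      rw [hB a (Q.fst_mem_support_of_mem_edges hab) ⟨s, hs, has⟩,
        hB b (Q.snd_mem_support_of_mem_edges hab) ⟨s, hs, hbs⟩, CharTwo.add_self_eq_zero]
  have hsub : ∀ (x y : V) (Q : G.Walk x y), Q.length ≤ l →
      ∀ a ∈ Q.support, ∀ b ∈ Q.support, G.dist a b ≤ l := by
    intro x y Q hQ
    have aux : ∀ a (ha : a ∈ Q.support), ∀ b ∈ (Q.dropUntil a ha).support, G.dist a b ≤ l := by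
      intro a ha b hb
      have h1 := dist_le ((Q.dropUntil a ha).takeUntil b hb)
      have h2 := Walk.length_takeUntil_le_length (Q.dropUntil a ha) hb
      have h3 := Walk.length_dropUntil_le_length Q ha
      lia
    intro a ha b hb
    by_cases h : b ∈ (Q.dropUntil a ha).support
    · exact aux a ha b h
    · have hb' : b ∈ (Q.takeUntil a ha).support := by
        rw [← Walk.take_spec Q ha, Walk.mem_support_append_iff] at hb
        exact hb.resolve_right h
      have h1 := dist_le ((Q.takeUntil a ha).dropUntil b hb')
      have h2 := Walk.length_dropUntil_le_length (Q.takeUntil a ha) hb'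
      have h3 := Walk.length_takeUntil_le_length Q ha
      rw [dist_comm]
      lia
  obtain ⟨f, hf⟩ := exists_potential hG φ (fun v c hc => by
    obtain ⟨_, h, -, -, hs⟩ := hwalk v v c (hsub v v c (hcyc v c hc))
    rw [hs, CharTwo.add_self_eq_zero])
  -- Along a geodesic between nearby vertices, the sum of `φ` is the change of `f` and also the
  -- change of `h`. On the near side `h` is `ψ`, on the far side it is constant; with this
  -- correction `w M` is constant on each class.
  let w : κ → V → ZMod 2 := fun M v => if D.Side t t' (K.node M) then f v + ψ v else f v
  have hconst : ∀ M, ∀ x ∈ K.cls M, ∀ y ∈ K.cls M, w M x = w M y := by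
    intro M x hx y hy
    have hch := K.chain M x hx y hy
    clear hx hy
    induction hch with
    | refl => rfl
    | @tail y z _ hyz ih =>
      obtain ⟨hy, hz, hd⟩ := hyz
      refine ih.trans ?_
      obtain ⟨Q, hQ⟩ := hG.exists_walk_length_eq_dist y z
      obtain ⟨c, h, hA, hB, hs⟩ := hwalk y z Q (hsub y z Q (by lia))
      rw [hf] at hs
      have e1 := CharTwo.add_self_eq_zero (f z)
      by_cases hM : D.Side t t' (K.node M)
      · simp only [w, if_pos hM]
        rw [hA y ⟨_, hM, K.subset M hy⟩, hA z ⟨_, hM, K.subset M hz⟩] at hs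
        have e2 := CharTwo.add_self_eq_zero (ψ y)
        linear_combination hs - e1 + e2
      · simp only [w, if_neg hM]
        rw [hB y (by simp) ⟨_, hM, K.subset M hy⟩, hB z (by simp) ⟨_, hM, K.subset M hz⟩,
          CharTwo.add_self_eq_zero] at hs
        linear_combination hs - e1
  let g : κ → ZMod 2 := fun M => w M (K.nonempty M).choose
  have hg : ∀ M, ∀ x ∈ K.cls M, g M = w M x := fun M x hx =>
    hconst M _ (K.nonempty M).choose_spec x hx
  have hst : D.Side t t' t := D.side_self t t'
  have hst' : ¬ D.Side t t' t' := D.not_side hadj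
  -- Only edges over the one from `t` to `t'` can change the value, and the change is `ψ x` for a
  -- common vertex `x`. By uniqueness of classes it is 1 only for `N` and `N'` themselves.
  have hcross : ∀ M M' x, x ∈ K.cls M → x ∈ K.cls M' → K.node M = t → K.node M' = t' →
      s(M, M') ≠ s(N, N') → g M = g M' := by
    intro M M' x hx hx' h1 h2 hne
    rw [hg M x hx, hg M' x hx']
    simp only [w, h1, h2, if_pos hst, if_neg hst']
    have : ψ x = 0 := by
      simp only [ψ]
      rw [if_neg]
      rintro ⟨hxN, hxN'⟩
      exact hne (by rw [K.unique M N x (h1.trans ht) hx hxN, K.unique M' N' x (h2.trans ht') hx' hxN'])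
    rw [this, add_zero]
  have hedge : ∀ M M', K.tree.Adj M M' → s(M, M') ≠ s(N, N') → g M = g M' := by
    intro M M' hMM' hne
    obtain ⟨hMadj, x, hx, hx'⟩ := hMM'
    by_cases he : s(K.node M, K.node M') = s(t, t')
    · rw [Sym2.eq_iff] at he
      rcases he with ⟨h1, h2⟩ | ⟨h1, h2⟩
      · exact hcross M M' x hx hx' h1 h2 hne
      · exact (hcross M' M x hx' hx h2 h1 (by rwa [Sym2.eq_swap])).symm
    · have hiff : D.Side t t' (K.node M) ↔ D.Side t t' (K.node M') :=
        ⟨D.side_of_adj hMadj he, D.side_of_adj hMadj.symm (by rwa [Sym2.eq_swap])⟩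
      rw [hg M x hx, hg M' x hx']
      simp only [w, hiff]
  have hpath : ∀ (M M' : κ) (p : K.tree.Walk M M'), s(N, N') ∉ p.edges → g M = g M' := by
    intro M M' p
    induction p with
    | nil => exact fun _ => rfl
    | cons h q ih =>
      intro hp
      rw [Walk.edges_cons, List.mem_cons, not_or] at hp
      exact (hedge _ _ h (Ne.symm hp.1)).trans (ih hp.2)
  have hfin := hpath N N' p hp
  rw [hg N v₀ hv₀, hg N' v₀ hv₀'] at hfin
  have h1 : ψ v₀ = 1 := by simp only [ψ]; rw [if_pos ⟨hv₀, hv₀'⟩]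
  simp only [w, ← ht, ← ht', if_pos hst, if_neg hst', h1] at hfin
  simp at hfin

theorem tree_isTree (hG : G.Connected) (hl : 1 ≤ l)
    (hcyc : ∀ (v : V) (c : G.Walk v v), IsGeodesicCycle G c → c.length ≤ l) : K.tree.IsTree :=
  ⟨K.tree_connected hG hl, K.tree_isAcyclic hG hcyc⟩

end Classes

/-! ### Joining the classes by shortest paths -/

/-- The interior vertices of the path from `x` to `y` obtained by splitting pairs at `mid`. -/
inductive Inner {V : Type*} (G : SimpleGraph V) (mid : V → V → V) : V → V → V → Prop where
  | mid {x y : V} : 1 < G.dist x y → Inner G mid x y (mid x y)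
  | left {x y v : V} : 1 < G.dist x y → Inner G mid x (mid x y) v → Inner G mid x y v
  | right {x y v : V} : 1 < G.dist x y → Inner G mid (mid x y) y v → Inner G mid x y v

/-- `mid` splits every pair of distant vertices of a bag inside some bag. -/
def IsMid {V ι : Type*} {G : SimpleGraph V} (D : TreeDecomposition G ι) (mid : V → V → V) : Prop :=
  ∀ t x y, x ∈ D.bag t → y ∈ D.bag t → 1 < G.dist x y →
    ∃ s, x ∈ D.bag s ∧ y ∈ D.bag s ∧ mid x y ∈ D.bag s ∧ mid x y ≠ x ∧ mid x y ≠ y ∧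
      G.dist x (mid x y) + G.dist (mid x y) y = G.dist x y

section Inner

variable {V ι : Type*} {G : SimpleGraph V} {D : TreeDecomposition G ι} {mid : V → V → V}

theorem IsMid.lt (hG : G.Connected) (hm : IsMid D mid) {t : ι} {x y : V} (hx : x ∈ D.bag t)
    (hy : y ∈ D.bag t) (h : 1 < G.dist x y) :
    ∃ s, x ∈ D.bag s ∧ y ∈ D.bag s ∧ mid x y ∈ D.bag s ∧
      0 < G.dist x (mid x y) ∧ 0 < G.dist (mid x y) y ∧
      G.dist x (mid x y) + G.dist (mid x y) y = G.dist x y := by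
  obtain ⟨s, h1, h2, h3, h4, h5, h6⟩ := hm t x y hx hy h
  exact ⟨s, h1, h2, h3, hG.pos_dist_of_ne h4.symm, hG.pos_dist_of_ne h5, h6⟩

theorem Inner.one_lt_dist {x y v : V} (h : Inner G mid x y v) : 1 < G.dist x y := by
  cases h <;> assumption

/-- If the midpoint splits the distance into positive parts `a` and `b`, then it and the two
interiors contribute at most `1 + (a - 1) + (b - 1)`, one less than the distance. -/
theorem exists_finset_inner (hG : G.Connected) (hm : IsMid D mid) {t : ι} {x y : V}
    (hx : x ∈ D.bag t) (hy : y ∈ D.bag t) :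
    ∃ F : Finset V, F.card ≤ G.dist x y - 1 ∧ ∀ v, Inner G mid x y v → v ∈ F := by
  classical
  obtain ⟨d, hd⟩ : ∃ d, G.dist x y = d := ⟨_, rfl⟩
  induction d using Nat.strong_induction_on generalizing t x y with
  | _ d ih =>
  by_cases h1 : 1 < G.dist x y
  · obtain ⟨s, hxs, hys, hms, ha, hb, hab⟩ := hm.lt hG hx hy h1
    obtain ⟨F₁, c₁, f₁⟩ := ih _ (by lia) hxs hms rfl
    obtain ⟨F₂, c₂, f₂⟩ := ih _ (by lia) hms hys rfl
    refine ⟨insert (mid x y) (F₁ ∪ F₂), ?_, ?_⟩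
    · have e1 := Finset.card_insert_le (mid x y) (F₁ ∪ F₂)
      have e2 := Finset.card_union_le F₁ F₂
      lia
    · intro v hv
      cases hv with
      | mid => simp
      | left _ h => simp [f₁ v h]
      | right _ h => simp [f₂ v h]
  · exact ⟨∅, by simp, fun v hv => absurd hv.one_lt_dist h1⟩

/-- The splitting stops at pairs at distance 0 or 1, that is, at equal or adjacent vertices, so the
pieces link up within `S`. -/
theorem reachable_inner (hG : G.Connected) (hm : IsMid D mid) {t : ι} {x y : V}
    (hx : x ∈ D.bag t) (hy : y ∈ D.bag t) (S : Set V) (hxS : x ∈ S) (hyS : y ∈ S)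
    (hS : ∀ v, Inner G mid x y v → v ∈ S) :
    (G.induce S).Reachable ⟨x, hxS⟩ ⟨y, hyS⟩ ∧
      ∀ v (hv : Inner G mid x y v), (G.induce S).Reachable ⟨x, hxS⟩ ⟨v, hS v hv⟩ := by
  obtain ⟨d, hd⟩ : ∃ d, G.dist x y = d := ⟨_, rfl⟩
  induction d using Nat.strong_induction_on generalizing t x y with
  | _ d ih =>
  by_cases h1 : 1 < G.dist x y
  · obtain ⟨s, hxs, hys, hms, ha, hb, hab⟩ := hm.lt hG hx hy h1
    have hmS : mid x y ∈ S := hS _ (.mid h1)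
    obtain ⟨r₁, q₁⟩ := ih _ (by lia) hxs hms hxS hmS (fun v hv => hS v (.left h1 hv)) rfl
    obtain ⟨r₂, q₂⟩ := ih _ (by lia) hms hys hmS hyS (fun v hv => hS v (.right h1 hv)) rfl
    refine ⟨r₁.trans r₂, fun v hv => ?_⟩
    cases hv with
    | mid => exact r₁
    | left _ h => exact q₁ v h
    | right _ h => exact r₁.trans (q₂ v h)
  · refine ⟨?_, fun v hv => absurd hv.one_lt_dist h1⟩
    have : G.dist x y = 0 ∨ G.dist x y = 1 := by lia
    rcases this with h | h
    · have : x = y := hG.dist_eq_zero_iff.1 h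
      subst this
      exact Reachable.refl _
    · exact Adj.reachable (by simpa using dist_eq_one_iff_adj.1 h)

end Inner

namespace Classes

variable {V ι κ : Type*} {G : SimpleGraph V} {D : TreeDecomposition G ι} {l : ℕ}
  (K : Classes D l κ) (mid : V → V → V)

/-- Membership in the enlarged class. -/
def InBag (M : κ) (v : V) : Prop :=
  v ∈ K.cls M ∨ ∃ x ∈ K.cls M, ∃ y ∈ K.cls M, G.dist x y ≤ l ∧ Inner G mid x y v

variable {mid}

/-- Any interior vertex `v` of a chosen path can be tracked down to a class that contains it as an
original element. This is what connects the occurrences of `v` in the enlarged bags, and it works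
because `mid` depends on the pair and not on the class. -/
theorem exists_walk_inBag (hG : G.Connected) (hm : IsMid D mid) {x y v : V}
    (hv : Inner G mid x y v) {M : κ} (hx : x ∈ K.cls M) (hy : y ∈ K.cls M)
    (hd : G.dist x y ≤ l) :
    ∃ (M' : κ) (p : K.tree.Walk M M'), v ∈ K.cls M' ∧ ∀ N ∈ p.support, K.InBag mid N v := by
  -- One descent step: move to the node whose bag also contains the midpoint, along classes that all
  -- contain `x` and `y`, so that `v` stays in the enlarged bags. On arrival the half of the pair
  -- responsible for `v` lies in a single class, and the induction continues there.
  have key : ∀ (x y : V) (M : κ), 1 < G.dist x y → Inner G mid x y v → x ∈ K.cls M →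
      y ∈ K.cls M → G.dist x y ≤ l →
      ∃ (M' : κ) (p : K.tree.Walk M M'), x ∈ K.cls M' ∧ y ∈ K.cls M' ∧ mid x y ∈ K.cls M' ∧
        G.dist x (mid x y) ≤ l ∧ G.dist (mid x y) y ≤ l ∧ ∀ N ∈ p.support, K.InBag mid N v := by
    intro x y M h1 hv hx hy hd
    obtain ⟨s, hxs, hys, hms, ha, hb, hab⟩ := hm.lt hG (K.subset M hx) (K.subset M hy) h1
    obtain ⟨M', rfl, hM'⟩ := K.cover s x hxs
    have hy' := K.closed M' x hM' y hys hd
    have hm' := K.closed M' x hM' _ hms (by lia)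
    obtain ⟨p, hp⟩ := K.reachable_of_mem M M' {x, y} ⟨x, by simp⟩
      (by rintro a (rfl | rfl) b (rfl | rfl) <;> simp [hd, G.dist_comm ▸ hd])
      (by rintro a (rfl | rfl) <;> assumption) (by rintro a (rfl | rfl) <;> assumption)
    exact ⟨M', p, hM', hy', hm', by lia, by lia, fun N hN => Or.inr
      ⟨x, hp N hN x (by simp), y, hp N hN y (by simp), hd, hv⟩⟩
  induction hv generalizing M with
  | mid h =>
    obtain ⟨M', p, -, -, h1, -, -, h2⟩ := key _ _ M h (.mid h) hx hy hd
    exact ⟨M', p, h1, h2⟩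
  | left h hv ih =>
    obtain ⟨M', p, h1, h2, h3, h4, h5, h6⟩ := key _ _ M h (.left h hv) hx hy hd
    obtain ⟨M'', p', g1, g2⟩ := ih h1 h3 h4 key
    exact ⟨M'', p.append p', g1, fun N hN =>
      ((Walk.mem_support_append_iff _ _).1 hN).elim (h6 N) (g2 N)⟩
  | right h hv ih =>
    obtain ⟨M', p, h1, h2, h3, h4, h5, h6⟩ := key _ _ M h (.right h hv) hx hy hd
    obtain ⟨M'', p', g1, g2⟩ := ih h3 h2 h5 key
    exact ⟨M'', p.append p', g1, fun N hN =>
      ((Walk.mem_support_append_iff _ _).1 hN).elim (h6 N) (g2 N)⟩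

/-- Both ends are led to classes containing `v` itself, and these are joined by lifting a path of
`D`. -/
theorem exists_walk_of_inBag (hG : G.Connected) (hm : IsMid D mid) {M M' : κ} {v : V}
    (h : K.InBag mid M v) (h' : K.InBag mid M' v) :
    ∃ p : K.tree.Walk M M', ∀ N ∈ p.support, K.InBag mid N v := by
  have aux : ∀ M, K.InBag mid M v →
      ∃ (M' : κ) (p : K.tree.Walk M M'), v ∈ K.cls M' ∧ ∀ N ∈ p.support, K.InBag mid N v := by
    rintro M (h | ⟨x, hx, y, hy, hd, hv⟩)
    · exact ⟨M, Walk.nil, h, fun N hN => by simp at hN; subst hN; exact Or.inl h⟩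
    · exact K.exists_walk_inBag hG hm hv hx hy hd
  obtain ⟨N, p, hN, hp⟩ := aux M h
  obtain ⟨N', p', hN', hp'⟩ := aux M' h'
  obtain ⟨q, hq⟩ := K.reachable_of_mem N N' {v} ⟨v, rfl⟩
      (by rintro _ rfl _ rfl; simp) (by rintro _ rfl; exact hN) (by rintro _ rfl; exact hN')
  refine ⟨(p.append q).append p'.reverse, fun R hR => ?_⟩
  simp only [Walk.mem_support_append_iff, Walk.support_reverse, List.mem_reverse] at hR
  rcases hR with (hR | hR) | hR
  · exact hp R hR
  · exact Or.inl (hq R hR v rfl)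
  · exact hp' R hR

/-- The tree decomposition into enlarged classes. -/
def decomposition (hG : G.Connected) (hl : 1 ≤ l)
    (hcyc : ∀ (v : V) (c : G.Walk v v), IsGeodesicCycle G c → c.length ≤ l) (hm : IsMid D mid)
    (bag : κ → Finset V) (hbag : ∀ M v, v ∈ bag M ↔ K.InBag mid M v) : TreeDecomposition G κ where
  tree := K.tree
  isTree := K.tree_isTree hG hl hcyc
  bag := bag
  vertex_mem x := by
    obtain ⟨t, ht⟩ := D.vertex_mem x
    obtain ⟨M, -, hM⟩ := K.cover t x ht
    exact ⟨M, (hbag M x).2 (Or.inl hM)⟩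
  edge_mem x y h := by
    obtain ⟨M, h1, h2⟩ := K.exists_mem_mem_of_adj hl h
    exact ⟨M, (hbag M x).2 (Or.inl h1), (hbag M y).2 (Or.inl h2)⟩
  path_mem M M' p hp N hN x hx hx' := by
    classical
    rw [hbag] at hx hx' ⊢
    obtain ⟨q, hq⟩ := K.exists_walk_of_inBag hG hm hx hx'
    have : p = q.bypass := congrArg Subtype.val
      (((K.tree_isAcyclic hG hcyc).subsingleton_path M M').elim ⟨p, hp⟩ ⟨q.bypass, q.bypass_isPath⟩)
    rw [this] at hN
    exact hq N (q.support_bypass_subset_support hN)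

theorem induce_inBag_connected (hG : G.Connected) (hm : IsMid D mid) (M : κ) (S : Set V)
    (hS : ∀ v, v ∈ S ↔ K.InBag mid M v) : (G.induce S).Connected := by
  have hcls : ∀ x ∈ K.cls M, x ∈ S := fun x hx => (hS x).2 (Or.inl hx)
  have hpair : ∀ x (hx : x ∈ K.cls M) y (hy : y ∈ K.cls M), G.dist x y ≤ l →
      (G.induce S).Reachable ⟨x, hcls x hx⟩ ⟨y, hcls y hy⟩ ∧
      ∀ v (_ : Inner G mid x y v) (hvS : v ∈ S),
        (G.induce S).Reachable ⟨x, hcls x hx⟩ ⟨v, hvS⟩ := by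
    intro x hx y hy hd
    obtain ⟨h1, h2⟩ := reachable_inner hG hm (K.subset M hx) (K.subset M hy) S (hcls x hx) (hcls y hy)
      (fun v hv => (hS v).2 (Or.inr ⟨x, hx, y, hy, hd, hv⟩))
    exact ⟨h1, fun v hv _ => h2 v hv⟩
  have hchain : ∀ x (hx : x ∈ K.cls M) y (hy : y ∈ K.cls M),
      (G.induce S).Reachable ⟨x, hcls x hx⟩ ⟨y, hcls y hy⟩ := by
    intro x hx y hy
    have hch := K.chain M x hx y hy
    induction hch with
    | refl => exact Reachable.refl _
    | @tail y z _ hyz ih => exact (ih hyz.1).trans (hpair y hyz.1 z hyz.2.1 hyz.2.2).1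
  obtain ⟨r, hr⟩ := K.nonempty M
  have hall : ∀ v (hv : v ∈ S), (G.induce S).Reachable ⟨r, hcls r hr⟩ ⟨v, hv⟩ := by
    intro v hv
    rcases (hS v).1 hv with h | ⟨x, hx, y, hy, hd, hin⟩
    · exact hchain r hr v h
    · exact (hchain r hr x hx).trans ((hpair x hx y hy hd).2 v hin hv)
  rw [connected_iff]
  exact ⟨fun a b => (hall a.1 a.2).symm.trans (hall b.1 b.2), ⟨⟨r, hcls r hr⟩⟩⟩

/-- Only ordered pairs of distinct elements matter, and each adds at most `l - 1` vertices; the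
total `c + (c² - c)(l - 1)` is at most `c² l`. -/
theorem card_le_of_inBag (hG : G.Connected) (hm : IsMid D mid) (M : κ) (S : Finset V)
    (hS : ∀ v ∈ S, K.InBag mid M v) (hl : 1 ≤ l) : S.card ≤ (K.cls M).card ^ 2 * l := by
  classical
  have hF : ∀ z : V × V, ∃ F : Finset V, z ∈ (K.cls M).offDiag → G.dist z.1 z.2 ≤ l →
      F.card ≤ l - 1 ∧ ∀ v, Inner G mid z.1 z.2 v → v ∈ F := by
    intro z
    by_cases hz : z ∈ (K.cls M).offDiag
    · rw [Finset.mem_offDiag] at hz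
      obtain ⟨F, h1, h2⟩ := exists_finset_inner hG hm (K.subset M hz.1) (K.subset M hz.2.1)
      exact ⟨F, fun _ hd => ⟨by lia, h2⟩⟩
    · exact ⟨∅, fun h => absurd h hz⟩
  choose F hF using hF
  set P := (K.cls M).offDiag.filter fun z => G.dist z.1 z.2 ≤ l with hP
  have hsub : S ⊆ K.cls M ∪ P.biUnion F := by
    intro v hv
    rcases hS v hv with h | ⟨x, hx, y, hy, hd, hin⟩
    · exact Finset.mem_union_left _ h
    · have hxy : (x, y) ∈ (K.cls M).offDiag := by
        have hne : x ≠ y := by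
          rintro rfl
          have := hin.one_lt_dist
          simp at this
        simp [hx, hy, hne]
      exact Finset.mem_union_right _ (Finset.mem_biUnion.2
        ⟨(x, y), by simp only [hP, Finset.mem_filter]; exact ⟨hxy, hd⟩, (hF (x, y) hxy hd).2 v hin⟩)
  have h1 : (P.biUnion F).card ≤ P.card * (l - 1) :=
    Finset.card_biUnion_le_card_mul _ _ _ fun z hz => by
      rw [hP, Finset.mem_filter] at hz
      exact (hF z hz.1 hz.2).1
  have h2 : P.card ≤ (K.cls M).card * (K.cls M).card - (K.cls M).card := by
    rw [← Finset.offDiag_card]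
    exact Finset.card_filter_le _ _
  have h3 := (Finset.card_le_card hsub).trans (Finset.card_union_le _ _)
  set c := (K.cls M).card with hc
  have h4 : S.card ≤ c + (c * c - c) * (l - 1) :=
    h3.trans (Nat.add_le_add_left (h1.trans (Nat.mul_le_mul_right _ h2)) _)
  obtain ⟨j, rfl⟩ : ∃ j, l = j + 1 := ⟨l - 1, by lia⟩
  have hcc : c ≤ c * c := Nat.le_mul_self c
  calc S.card ≤ c + (c * c - c) * (j + 1 - 1) := h4
    _ ≤ c * c + (c * c) * j := by
      rw [Nat.add_sub_cancel]
      exact Nat.add_le_add hcc (Nat.mul_le_mul_right _ (Nat.sub_le _ _))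
    _ = c ^ 2 * (j + 1) := by ring

end Classes

/-! ### Exact distances by two sweeps over the tree -/

section Sweep

variable {V ι : Type*} {G : SimpleGraph V} (D : TreeDecomposition G ι)

/-- `o` lists the nodes so that each but the first has a neighbour before it. -/
structure IsSearchOrder (L : ℕ) (o : ℕ → ι) : Prop where
  surj : ∀ t, ∃ i < L, o i = t
  inj : ∀ i < L, ∀ j < L, o i = o j → i = j
  adj : ∀ i < L, 0 < i → ∃ j < i, D.tree.Adj (o i) (o j)

/-- Vertices in the bags of the first `i` nodes. -/
def Early (o : ℕ → ι) (i : ℕ) (x : V) : Prop := ∃ j < i, x ∈ D.bag (o j)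

/-- `d` is an upper bound for the distance of vertices that share a bag. -/
structure IsDistBound (d : V → V → ℕ) : Prop where
  self : ∀ x, d x x = 0
  le : ∀ t, ∀ x ∈ D.bag t, ∀ y ∈ D.bag t, G.dist x y ≤ d x y

/-- `d` satisfies the triangle inequality in the bag of `t`. -/
def TriangleIn (d : V → V → ℕ) (t : ι) : Prop :=
  ∀ x ∈ D.bag t, ∀ y ∈ D.bag t, ∀ z ∈ D.bag t, d x y ≤ d x z + d z y

/-- Sequences of steps inside the first `i` bags, with their total weight. -/
inductive Steps (o : ℕ → ι) (i : ℕ) (d : V → V → ℕ) : V → V → ℕ → Prop where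
  | nil (x : V) : Steps o i d x x 0
  | cons {x y z : V} {w j : ℕ} : j < i → x ∈ D.bag (o j) → y ∈ D.bag (o j) →
      Steps o i d y z w → Steps o i d x z (d x y + w)

/-- Steps inside the first `i` bags realize the distances between vertices of these bags. -/
def StepsExact (o : ℕ → ι) (i : ℕ) (d : V → V → ℕ) : Prop :=
  ∀ x y, Early D o i x → Early D o i y → ∃ w ≤ G.dist x y, Steps D o i d x y w

/-- `d` is exact on the first `i` bags. -/
def ExactBelow (o : ℕ → ι) (i : ℕ) (d : V → V → ℕ) : Prop :=
  ∀ j < i, ∀ x ∈ D.bag (o j), ∀ y ∈ D.bag (o j), d x y ≤ G.dist x y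

variable {D} {L : ℕ} {o : ℕ → ι} {d d' : V → V → ℕ}

/-- `d'` is at most `d` on pairs that share a bag. -/
def LeOnBags (D : TreeDecomposition G ι) (d' d : V → V → ℕ) : Prop :=
  ∀ t, ∀ x ∈ D.bag t, ∀ y ∈ D.bag t, d' x y ≤ d x y

theorem Steps.mono {i w : ℕ} {x y : V} (h : Steps D o i d x y w) (hd : LeOnBags D d' d) :
    ∃ w' ≤ w, Steps D o i d' x y w' := by
  induction h with
  | nil x => exact ⟨0, le_rfl, .nil x⟩
  | cons hj hx hy _ ih =>
    obtain ⟨w', hw', h'⟩ := ih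
    exact ⟨_, Nat.add_le_add (hd _ _ hx _ hy) hw', .cons hj hx hy h'⟩

theorem StepsExact.mono {i : ℕ} (h : StepsExact D o i d) (hd : LeOnBags D d' d) :
    StepsExact D o i d' := by
  intro x y hx hy
  obtain ⟨w, hw, h'⟩ := h x y hx hy
  obtain ⟨w', hw', h''⟩ := h'.mono hd
  exact ⟨w', hw'.trans hw, h''⟩

theorem ExactBelow.mono {i : ℕ} (h : ExactBelow D o i d) (hd : LeOnBags D d' d) :
    ExactBelow D o i d' :=
  fun j hj x hx y hy => (hd _ x hx y hy).trans (h j hj x hx y hy)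

/-- Every node before `o i` reaches the root through earlier nodes, hence avoiding `o i`. So the
tree path from `o i` to an earlier node whose bag contains `x` leaves through `o j`, and `x` lies in
that bag. -/
theorem IsSearchOrder.mem_parent (ho : IsSearchOrder D L o) {i j : ℕ} (hi : i < L) (hj : j < i)
    (hadj : D.tree.Adj (o i) (o j)) {x : V} (hx : x ∈ D.bag (o i)) (hx' : Early D o i x) :
    x ∈ D.bag (o j) := by
  classical
  have hroot : ∀ m < i, ∃ p : D.tree.Walk (o m) (o 0), o i ∉ p.support := by
    intro m
    induction m using Nat.strong_induction_on with
    | _ m ih =>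
    intro hm
    rcases Nat.eq_zero_or_pos m with rfl | hpos
    · refine ⟨Walk.nil, fun h => ?_⟩
      have := ho.inj i hi 0 (by lia) (by simpa using h)
      lia
    · obtain ⟨m', hm', ha⟩ := ho.adj m (by lia) hpos
      obtain ⟨p, hp⟩ := ih m' hm' (by lia)
      refine ⟨Walk.cons ha p, fun h => ?_⟩
      rw [Walk.support_cons, List.mem_cons] at h
      rcases h with h | h
      · have := ho.inj i hi m (by lia) h
        lia
      · exact hp h
  obtain ⟨m, hm, hxm⟩ := hx'
  obtain ⟨p, hp⟩ := hroot j hj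
  obtain ⟨q, hq⟩ := hroot m hm
  have hpq : o i ∉ (p.append q.reverse).bypass.support := fun h => by
    have := Walk.support_bypass_subset_support _ h
    simp only [Walk.mem_support_append_iff, Walk.support_reverse, List.mem_reverse] at this
    exact this.elim hp hq
  exact D.path_mem _ _ (Walk.cons hadj (p.append q.reverse).bypass)
    ((Walk.cons_isPath_iff _ _).2 ⟨Walk.bypass_isPath _, hpq⟩) _ (by simp) x hx hxm

/-- Every edge of a shortest path lies in some bag and costs at most 1. -/
theorem stepsExact_full (hG : G.Connected) (ho : IsSearchOrder D L o)
    (hd : ∀ x y, G.Adj x y → d x y ≤ 1) : StepsExact D o L d := by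
  rintro x y - -
  obtain ⟨p, hp⟩ := hG.exists_walk_length_eq_dist x y
  rw [← hp]
  clear hp
  induction p with
  | nil => exact ⟨0, le_rfl, .nil _⟩
  | @cons u v w h q ih =>
    obtain ⟨n, hn, hs⟩ := ih
    obtain ⟨t, hu, hv⟩ := D.edge_mem u v h
    obtain ⟨i, hi, rfl⟩ := ho.surj t
    refine ⟨_, ?_, .cons hi hu hv hs⟩
    have := hd u v h
    rw [Walk.length_cons]
    lia

/-- Removal of the last bag, in the sweep towards the root. An excursion into bag `i` enters and
leaves through vertices of earlier bags, hence of the parent bag; by the triangle inequality in bag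
`i` it is no shorter than one direct step, which can be made in the parent bag. -/
theorem StepsExact.pred (ho : IsSearchOrder D L o) (hd : IsDistBound D d) {i : ℕ} (hi : i < L)
    (hpos : 0 < i) (h : StepsExact D o (i + 1) d) (ht : TriangleIn D d (o i)) :
    StepsExact D o i d := by
  obtain ⟨j₀, hj₀, hadj⟩ := ho.adj i hi hpos
  -- The second clause handles a sequence that is currently inside bag `i`: it records the vertex
  -- `y` through which the excursion leaves, merging the steps inside the bag into `d x y`.
  have key : ∀ x z w, Steps D o (i + 1) d x z w → Early D o i z →
      (Early D o i x → ∃ w' ≤ w, Steps D o i d x z w') ∧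
      (x ∈ D.bag (o i) → ∃ y ∈ D.bag (o i), Early D o i y ∧
        ∃ w', d x y + w' ≤ w ∧ Steps D o i d y z w') := by
    intro x z w hs hz
    induction hs with
    | nil x =>
      exact ⟨fun _ => ⟨0, le_rfl, .nil x⟩, fun hx => ⟨x, hx, hz, 0, by simp [hd.self], .nil x⟩⟩
    | @cons x y z w j hj hx hy _ ih =>
      obtain ⟨ih₁, ih₂⟩ := ih hz
      have hfirst : Early D o i x → ∃ w' ≤ d x y + w, Steps D o i d x z w' := by
        intro hxe
        by_cases hji : j < i
        · obtain ⟨w', hw', h'⟩ := ih₁ ⟨j, hji, hy⟩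
          exact ⟨_, Nat.add_le_add_left hw' _, .cons hji hx hy h'⟩
        · have : j = i := by lia
          subst this
          obtain ⟨y', hy', hye, w', hw', h'⟩ := ih₂ hy
          have := ht x hx y' hy' y hy
          exact ⟨_, by lia, .cons hj₀ (ho.mem_parent hi hj₀ hadj hx hxe)
            (ho.mem_parent hi hj₀ hadj hy' hye) h'⟩
      refine ⟨hfirst, fun hxi => ?_⟩
      by_cases hji : j < i
      · obtain ⟨w', hw', h'⟩ := hfirst ⟨j, hji, hx⟩
        exact ⟨x, hxi, ⟨j, hji, hx⟩, w', by simpa [hd.self] using hw', h'⟩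
      · have : j = i := by lia
        subst this
        obtain ⟨y', hy', hye, w', hw', h'⟩ := ih₂ hy
        have := ht x hx y' hy' y hy
        exact ⟨y', hy', hye, w', by lia, h'⟩
  intro x y hx hy
  obtain ⟨w, hw, hs⟩ := h x y (hx.imp fun j hj => ⟨by lia, hj.2⟩) (hy.imp fun j hj => ⟨by lia, hj.2⟩)
  obtain ⟨w', hw', hs'⟩ := (key x y w hs hy).1 hx
  exact ⟨w', hw'.trans hw, hs'⟩

/-- Addition of one bag, in the sweep away from the root. A detour through earlier bags between two
vertices of bag `i` has both ends in the parent bag, where `d` is already exact; the triangle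
inequality in bag `i` then bounds `d` by the weight of the whole sequence. -/
theorem ExactBelow.succ (hG : G.Connected) (ho : IsSearchOrder D L o) (hd : IsDistBound D d)
    {i : ℕ} (hi : i < L) (hs : StepsExact D o (i + 1) d) (he : ExactBelow D o i d)
    (ht : TriangleIn D d (o i)) : ExactBelow D o (i + 1) d := by
  -- For a sequence that starts in the earlier bags, the second clause records where it enters bag
  -- `i`; the part before is measured by the true distance, so that exactness in the parent bag can
  -- be applied to it.
  have key : ∀ x z w, Steps D o (i + 1) d x z w → z ∈ D.bag (o i) →
      (x ∈ D.bag (o i) → d x z ≤ w) ∧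
      (Early D o i x → ∃ y ∈ D.bag (o i), Early D o i y ∧ G.dist x y + d y z ≤ w) := by
    intro x z w hs hz
    induction hs with
    | nil x =>
      exact ⟨fun _ => by simp [hd.self], fun hx => ⟨x, hz, hx, by simp [hd.self]⟩⟩
    | @cons x y z w j hj hx hy _ ih =>
      obtain ⟨ih₁, ih₂⟩ := ih hz
      have hfirst : x ∈ D.bag (o i) → d x z ≤ d x y + w := by
        intro hxi
        by_cases hji : j < i
        · obtain ⟨y', hy', hye, hw⟩ := ih₂ ⟨j, hji, hy⟩
          obtain ⟨j₀, hj₀, hadj⟩ := ho.adj i hi (by lia)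
          have h1 := he j₀ hj₀ x (ho.mem_parent hi hj₀ hadj hxi ⟨j, hji, hx⟩) y'
            (ho.mem_parent hi hj₀ hadj hy' hye)
          have h2 := hG.dist_triangle (u := x) (v := y) (w := y')
          have h3 := hd.le _ x hx y hy
          have h4 := ht x hxi z hz y' hy'
          lia
        · have : j = i := by lia
          subst this
          have := ht x hx z hz y hy
          have := ih₁ hy
          lia
      refine ⟨hfirst, fun hxe => ?_⟩
      by_cases hji : j < i
      · obtain ⟨y', hy', hye, hw⟩ := ih₂ ⟨j, hji, hy⟩
        have h2 := hG.dist_triangle (u := x) (v := y) (w := y')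
        have h3 := hd.le _ x hx y hy
        exact ⟨y', hy', hye, by lia⟩
      · have : j = i := by lia
        subst this
        exact ⟨x, hx, hxe, by simpa using hfirst hx⟩
  intro j hj x hx y hy
  by_cases hji : j < i
  · exact he j hji x hx y hy
  · have : j = i := by lia
    subst this
    obtain ⟨w, hw, h⟩ := hs x y ⟨j, hj, hx⟩ ⟨j, hj, hy⟩
    exact ((key x y w h hy).1 hx).trans hw

end Sweep

/-! ### Derived rules for specifications, and amortized loops -/

section SpecRules

variable {A : Type} [DecidableEq A]

theorem Spec.weaken {c : Cmd A} {s : Store A} {Q : Store A → Prop} {T U : ℕ}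
    (h : Spec c s Q T) (hTU : T ≤ U) : Spec c s Q U := ⟨h.post, h.time.trans hTU⟩

theorem Spec.imp {c : Cmd A} {s : Store A} {P Q : Store A → Prop} {T : ℕ}
    (h : Spec c s P T) (hPQ : ∀ s', P s' → Frame c s s' → Q s') : Spec c s Q T :=
  h.mono hPQ le_rfl

theorem Spec.set_seq {s : Store A} {Q : Store A → Prop} {x : Var} {e : Exp A} {d : Cmd A} {T : ℕ}
    (h : Spec d (s.setV x (e.eval s)) Q T) : Spec (.seq (.set x e) d) s Q (T + 1) :=
  ⟨h.post, by have := h.time; simp only [Cmd.ticks, Cmd.run]; lia⟩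

theorem Spec.put_seq {s : Store A} {Q : Store A → Prop} {q : A} {e f : Exp A} {d : Cmd A} {T : ℕ}
    (h : Spec d (s.setA q (e.eval s) (f.eval s)) Q T) : Spec (.seq (.put q e f) d) s Q (T + 1) :=
  ⟨h.post, by have := h.time; simp only [Cmd.ticks, Cmd.run]; lia⟩

/-- A loop whose invariant also bounds the ticks spent so far. -/
theorem Spec.loop_acc {s : Store A} (I : ℕ → ℕ → Store A → Prop) {x : Var} {e : Exp A}
    {c : Cmd A} {b : ℕ} (hb : e.eval s = b) (h0 : I 0 0 s)
    (hstep : ∀ i < b, ∀ w s', I i w s' → Frame (.loop x e c) s s' →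
      ∃ t, Spec c (s'.setV x i) (I (i + 1) (w + t)) t) :
    ∃ W, Spec (.loop x e c) s (I b W) (1 + W + b) := by
  have key : ∀ i ≤ b, ∃ w, I i w (iterStore x c.run s i) ∧
      ∑ j ∈ Finset.range i, (c.ticks ((iterStore x c.run s j).setV x j) + 1) ≤ w + i := by
    intro i
    induction i with
    | zero => exact fun _ => ⟨0, h0, by simp⟩
    | succ i ih =>
      intro hi
      obtain ⟨w, hw, hs⟩ := ih (by lia)
      obtain ⟨t, ht⟩ := hstep i hi w _ hw (frame_iter c.frame s i)
      refine ⟨w + t, ht.post, ?_⟩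
      rw [Finset.sum_range_succ]
      have := ht.time
      lia
  obtain ⟨W, hW, hs⟩ := key b le_rfl
  refine ⟨W, ?_, ?_⟩
  · rw [Cmd.run, hb]; exact hW
  · rw [Cmd.ticks, hb]; lia

end SpecRules

/-! ### The main program -/

instance {A : Type} : Add (Exp A) := ⟨.add⟩
instance {A : Type} : Sub (Exp A) := ⟨.sub⟩
instance {A : Type} (k : ℕ) : OfNat (Exp A) k := ⟨.lit k⟩
instance {A : Type} : Coe Var (Exp A) := ⟨.var⟩

section Eval

variable {A : Type} (s : Store A)

@[simp] theorem eval_add (e f : Exp A) : (e + f).eval s = e.eval s + f.eval s := rfl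
@[simp] theorem eval_sub (e f : Exp A) : (e - f).eval s = e.eval s - f.eval s := rfl
@[simp] theorem eval_zero : (0 : Exp A).eval s = 0 := rfl
@[simp] theorem eval_one : (1 : Exp A).eval s = 1 := rfl
@[simp] theorem eval_two : (2 : Exp A).eval s = 2 := rfl
@[simp] theorem eval_three : (3 : Exp A).eval s = 3 := rfl
@[simp] theorem eval_var (x : Var) : (Exp.var x : Exp A).eval s = s.v x := rfl
@[simp] theorem eval_get (q : A) (e : Exp A) : (Exp.get q e).eval s = s.a q (e.eval s) := rfl

end Eval

infixr:60 " ;; " => Cmd.seq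

/-- The cell of a two-dimensional array. -/
def cell (e f : Exp Arr) : Exp Arr := .get .row e + f

/-- Element `i` of the bag of node `t`. -/
def bagElem (t i : Exp Arr) : Exp Arr := .get .inp (.get .bst t + i)

@[simp] theorem eval_cell (s : Store Arr) (e f : Exp Arr) :
    (cell e f).eval s = s.a .row (e.eval s) + f.eval s := rfl

@[simp] theorem eval_bagElem (s : Store Arr) (t i : Exp Arr) :
    (bagElem t i).eval s = s.a .inp (s.a .bst (t.eval s) + i.eval s) := rfl

/-- `row` tabulates the multiples of the input length `len`, the common stride of all
two-dimensional arrays; a table built by additions replaces multiplication in the address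
computation. -/
def headerCmd : Cmd Arr :=
  .set .l (.get .inp 0) ;; .set .n (.get .inp 1) ;; .set .m (.get .inp 2) ;;
  .set .q (3 + Var.m + Var.m) ;; .set .L (.get .inp Var.q) ;; .set .mt (.get .inp (Var.q + 1)) ;;
  .set .tb (Var.q + 2) ;; .set .q (Var.tb + Var.mt + Var.mt) ;;
  .loop .t Var.L (.put .bsz Var.t (.get .inp Var.q) ;; .put .bst Var.t (Var.q + 1) ;;
    .set .q (Var.q + 1 + .get .inp Var.q)) ;;
  .set .acc 0 ;;
  .loop .i Var.len (.put .row Var.i Var.acc ;; .set .acc (Var.acc + Var.len))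

def pushCmd (u v : Var) : Cmd Arr :=
  .put .nbr (cell u (.get .deg u)) v ;; .put .deg u (.get .deg u + 1)

def adjacencyCmd : Cmd Arr :=
  .loop .e Var.mt (.set .u (.get .inp (Var.tb + Var.e + Var.e)) ;;
    .set .v (.get .inp (Var.tb + Var.e + Var.e + 1)) ;; pushCmd .u .v ;; pushCmd .v .u)

def visitCmd : Cmd Arr :=
  .set .v (.get .nbr (cell Var.u Var.c)) ;;
  .ite (.get .vis Var.v) 1
    (.put .vis Var.v 1 ;; .put .ord Var.tail Var.v ;; .set .tail (Var.tail + 1)) .skip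

/-- Breadth-first search with `ord` as the queue. Exactly `L` nodes are taken out and emptiness is
never tested, since the tree is connected. -/
def searchCmd : Cmd Arr :=
  .put .ord 0 0 ;; .put .vis 0 1 ;; .set .tail 1 ;;
  .loop .h Var.L (.set .u (.get .ord Var.h) ;; .loop .c (.get .deg Var.u) visitCmd)

/-- The value `n` plays the role of infinity, as every distance is smaller. Only pairs that share a
bag are set, since filling the whole matrix could exceed the time bound. -/
def initDistCmd : Cmd Arr :=
  .loop .t Var.L (.loop .i (.get .bsz Var.t) (.set .x (bagElem Var.t Var.i) ;;
    .loop .j (.get .bsz Var.t) (.set .y (bagElem Var.t Var.j) ;;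
      .ite Var.x Var.y (.put .dist (cell Var.x Var.y) Var.n)
        (.ite Var.y Var.x (.put .dist (cell Var.x Var.y) Var.n) .skip)))) ;;
  .loop .e Var.m (.set .x (.get .inp (3 + Var.e + Var.e)) ;;
    .set .y (.get .inp (3 + Var.e + Var.e + 1)) ;;
    .put .dist (cell Var.x Var.y) 1 ;; .put .dist (cell Var.y Var.x) 1)

def relaxCmd : Cmd Arr :=
  .set .y (bagElem Var.t Var.j) ;;
  .ite (.get .dist (cell Var.x Var.z) + .get .dist (cell Var.z Var.y))
    (.get .dist (cell Var.x Var.y))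
    (.put .mid (cell Var.x Var.y) Var.z ;;
      .put .dist (cell Var.x Var.y)
        (.get .dist (cell Var.x Var.z) + .get .dist (cell Var.z Var.y))) .skip

def closeBagCmd : Cmd Arr :=
  .loop .f (.get .bsz Var.t) (.set .z (bagElem Var.t Var.f) ;;
    .loop .i (.get .bsz Var.t) (.set .x (bagElem Var.t Var.i) ;;
      .loop .j (.get .bsz Var.t) relaxCmd))

def sweepCmd : Cmd Arr :=
  .loop .h Var.L (.set .t (.get .ord (Var.L - 1 - Var.h)) ;; closeBagCmd) ;;
  .loop .h Var.L (.set .t (.get .ord Var.h) ;; closeBagCmd)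

def joinCmd : Cmd Arr :=
  .set .y (bagElem Var.t Var.j) ;;
  .ite (.get .comp (cell Var.t Var.y)) 1
    (.ite Var.l (.get .dist (cell Var.u Var.y)) .skip
      (.put .comp (cell Var.t Var.y) Var.nc ;; .put .que Var.tail Var.y ;;
        .set .tail (Var.tail + 1))) .skip

/-- One round of the search that is idle when the queue is empty. It is repeated as often as the bag
has elements, which replaces an unbounded loop. -/
def growCmd : Cmd Arr :=
  .ite Var.hd Var.tail
    (.set .u (.get .que Var.hd) ;; .set .hd (Var.hd + 1) ;; .loop .j (.get .bsz Var.t) joinCmd)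
    .skip

/-- The search queue is never reset: `que` ends up as the concatenation of all classes and `cst`
holds their starting positions, with one final entry for the end. In `comp` the class number is
shifted by one, so that 0 means unassigned. -/
def classesCmd : Cmd Arr :=
  .set .nc 0 ;; .set .tail 0 ;;
  .loop .t Var.L (.loop .i (.get .bsz Var.t) (.set .x (bagElem Var.t Var.i) ;;
    .ite (.get .comp (cell Var.t Var.x)) 1
      (.put .cst Var.nc Var.tail ;; .set .nc (Var.nc + 1) ;;
        .put .comp (cell Var.t Var.x) Var.nc ;; .put .que Var.tail Var.x ;; .set .hd Var.tail ;;
        .set .tail (Var.tail + 1) ;; .loop .f (.get .bsz Var.t) growCmd) .skip)) ;;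
  .put .cst Var.nc Var.tail

/-- Two classes may share many vertices; `emat` ensures that their edge is written only once. -/
def linkCmd : Cmd Arr :=
  .set .x (bagElem Var.u Var.i) ;;
  .set .y (.get .comp (cell Var.u Var.x)) ;; .set .z (.get .comp (cell Var.v Var.x)) ;;
  .ite 0 Var.z
    (.ite (.get .emat (cell Var.y Var.z)) 1
      (.put .emat (cell Var.y Var.z) 1 ;; .put .out Var.op (Var.y - 1) ;;
        .put .out (Var.op + 1) (Var.z - 1) ;; .set .op (Var.op + 2) ;; .set .ne (Var.ne + 1))
      .skip) .skip

def treeOutCmd : Cmd Arr :=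
  .put .out 0 Var.nc ;; .set .op 2 ;; .set .ne 0 ;;
  .loop .e Var.mt (.set .u (.get .inp (Var.tb + Var.e + Var.e)) ;;
    .set .v (.get .inp (Var.tb + Var.e + Var.e + 1)) ;; .loop .i (.get .bsz Var.u) linkCmd) ;;
  .put .out 1 Var.ne

/-- The stamp `c + 1` identifies the current bag, so the marks need not be cleared between bags. -/
def emitCmd (z : Var) : Cmd Arr :=
  .put .stamp z (Var.c + 1) ;; .put .out Var.op z ;; .set .op (Var.op + 1)

def splitCmd : Cmd Arr :=
  .ite 0 Var.sp
    (.set .sp (Var.sp - 1) ;; .set .u (.get .sta Var.sp) ;; .set .v (.get .stb Var.sp) ;;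
      .ite 1 (.get .dist (cell Var.u Var.v))
        (.set .z (.get .mid (cell Var.u Var.v)) ;;
          .ite (.get .stamp Var.z) (Var.c + 1) (emitCmd .z) .skip ;;
          .put .sta Var.sp Var.u ;; .put .stb Var.sp Var.z ;;
          .put .sta (Var.sp + 1) Var.z ;; .put .stb (Var.sp + 1) Var.v ;; .set .sp (Var.sp + 2))
        .skip) .skip

/-- Splitting a pair at distance `d ≥ 1` produces a binary tree with at most `d` leaves, hence at
most `2d - 1` nodes; `2l` rounds empty the stack. -/
def expandCmd : Cmd Arr :=
  .put .sta 0 Var.x ;; .put .stb 0 Var.y ;; .set .sp 1 ;; .loop .f (Var.l + Var.l) splitCmd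

def bagOutCmd : Cmd Arr :=
  .set .lo (.get .cst Var.c) ;; .set .hi (.get .cst (Var.c + 1)) ;; .set .p Var.op ;;
  .set .op (Var.op + 1) ;;
  .loop .i (Var.hi - Var.lo) (.set .x (.get .que (Var.lo + Var.i)) ;; emitCmd .x) ;;
  .loop .i (Var.hi - Var.lo) (.set .x (.get .que (Var.lo + Var.i)) ;;
    .loop .j (Var.hi - Var.lo) (.set .y (.get .que (Var.lo + Var.j)) ;;
      .ite Var.l (.get .dist (cell Var.x Var.y)) .skip expandCmd)) ;;
  .put .out Var.p (Var.op - Var.p - 1)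

def bagsOutCmd : Cmd Arr := .loop .c Var.nc bagOutCmd

def mainCmd : Cmd Arr :=
  headerCmd ;; adjacencyCmd ;; searchCmd ;; initDistCmd ;; sweepCmd ;; classesCmd ;; treeOutCmd ;;
  bagsOutCmd

/-! ### Facts about the input that hold throughout -/

/-- The input has been read: parameters, lists and the table of multiples of the stride `S`. -/
structure Base {n L : ℕ} (l S : ℕ) (es : List (Fin n × Fin n)) (ts : List (Fin L × Fin L))
    (bs : Fin L → List (Fin n)) (s : Store Arr) : Prop where
  vl : s.v .l = l
  vn : s.v .n = n
  vm : s.v .m = es.length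
  vL : s.v .L = L
  vmt : s.v .mt = ts.length
  edge : ∀ i (h : i < es.length),
    s.a .inp (3 + i + i) = (es[i].1 : ℕ) ∧ s.a .inp (3 + i + i + 1) = (es[i].2 : ℕ)
  tedge : ∀ i (h : i < ts.length), s.a .inp (s.v .tb + i + i) = (ts[i].1 : ℕ) ∧
    s.a .inp (s.v .tb + i + i + 1) = (ts[i].2 : ℕ)
  bsz : ∀ t : Fin L, s.a .bsz t = (bs t).length
  bag : ∀ (t : Fin L) (i : ℕ) (h : i < (bs t).length),
    s.a .inp (s.a .bst t + i) = ((bs t)[i] : ℕ)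
  row : ∀ i < S, s.a .row i = i * S
  n_le : n ≤ S
  L_le : L ≤ S
  mt_lt : ts.length + ts.length < S
  tot_lt : ∑ t, (bs t).length < S

/-- A Boolean test, so that `Base` is carried through whole commands by `rfl`. -/
def Cmd.keepsBase (c : Cmd Arr) : Bool :=
  [Var.l, .n, .m, .L, .mt, .tb].all (fun x => !c.writesV x) &&
    [Arr.inp, .bsz, .bst, .row].all (fun q => !c.writesA q)

theorem Base.of_frame {n L l S : ℕ} {es : List (Fin n × Fin n)} {ts : List (Fin L × Fin L)}
    {bs : Fin L → List (Fin n)} {s s' : Store Arr} (h : Base l S es ts bs s) {c : Cmd Arr}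
    (hf : Frame c s s') (hc : c.keepsBase = true) : Base l S es ts bs s' := by
  simp only [Cmd.keepsBase, List.all_cons, List.all_nil, Bool.and_true, Bool.and_eq_true,
    Bool.not_eq_true'] at hc
  obtain ⟨⟨h1, h2, h3, h4, h5, h6⟩, h7, h8, h9, h10⟩ := hc
  have e1 := hf.a _ h7
  have e2 := hf.a _ h8
  have e3 := hf.a _ h9
  have e4 := hf.a _ h10
  have e5 := hf.v _ h6
  exact
    { vl := (hf.v _ h1).trans h.vl
      vn := (hf.v _ h2).trans h.vn
      vm := (hf.v _ h3).trans h.vm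
      vL := (hf.v _ h4).trans h.vL
      vmt := (hf.v _ h5).trans h.vmt
      edge := by rw [e1]; exact h.edge
      tedge := by rw [e1, e5]; exact h.tedge
      bsz := by rw [e2]; exact h.bsz
      bag := by rw [e1, e3]; exact h.bag
      row := by rw [e4]; exact h.row
      n_le := h.n_le
      L_le := h.L_le
      mt_lt := h.mt_lt
      tot_lt := h.tot_lt }

theorem Base.setV {n L l S : ℕ} {es : List (Fin n × Fin n)} {ts : List (Fin L × Fin L)}
    {bs : Fin L → List (Fin n)} {s : Store Arr} (h : Base l S es ts bs s) (x : Var) (k : ℕ)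
    (hx : (Cmd.set x (0 : Exp Arr)).keepsBase = true) : Base l S es ts bs (s.setV x k) := by
  refine h.of_frame (c := .set x 0) ⟨fun y hy => ?_, fun _ _ => rfl⟩ hx
  simp only [Cmd.writesV, beq_eq_false_iff_ne] at hy
  simp [Store.setV_v, Ne.symm hy]

theorem Base.setA {n L l S : ℕ} {es : List (Fin n × Fin n)} {ts : List (Fin L × Fin L)}
    {bs : Fin L → List (Fin n)} {s : Store Arr} (h : Base l S es ts bs s) (q : Arr) (i k : ℕ)
    (hq : (Cmd.put q (0 : Exp Arr) 0).keepsBase = true) : Base l S es ts bs (s.setA q i k) := by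
  refine h.of_frame (c := .put q 0 0) ⟨fun _ _ => rfl, fun r hr => ?_⟩ hq
  simp only [Cmd.writesA, beq_eq_false_iff_ne] at hr
  simp [Store.setA_a, Ne.symm hr]

theorem stride_inj {S i j i' j' : ℕ} (hj : j < S) (hj' : j' < S) :
    i * S + j = i' * S + j' ↔ i = i' ∧ j = j' := by
  constructor
  · intro h
    have h1 : i = i' := by
      have hS : 0 < S := by lia
      have := congrArg (· / S) h
      simpa [Nat.add_div_of_dvd_right (Nat.dvd_mul_left S _), Nat.mul_div_cancel _ hS,
        Nat.div_eq_of_lt hj, Nat.div_eq_of_lt hj'] using this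
    subst h1
    exact ⟨rfl, by lia⟩
  · rintro ⟨rfl, rfl⟩; rfl

theorem update_stride {S : ℕ} (a : ℕ → ℕ) {i j i' j' k : ℕ} (hj : j < S) (hj' : j' < S) :
    Function.update a (i * S + j) k (i' * S + j') =
      if i' = i ∧ j' = j then k else a (i' * S + j') := by
  simp only [Function.update_apply, stride_inj hj' hj]

/-! ### Adjacency lists of the tree and a search order -/

section Search

variable {n L l S : ℕ} {es : List (Fin n × Fin n)} {ts : List (Fin L × Fin L)}
  {bs : Fin L → List (Fin n)}

/-- The arrays `deg` and `nbr` hold the lists `nb`. -/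
def HoldsLists (S : ℕ) (nb : Fin L → List (Fin L)) (deg nbr : ℕ → ℕ) : Prop :=
  ∀ u : Fin L, deg u = (nb u).length ∧
    ∀ c (h : c < (nb u).length), nbr (u * S + c) = ((nb u)[c] : ℕ)

theorem HoldsLists.push {nb : Fin L → List (Fin L)} {deg nbr : ℕ → ℕ}
    (h : HoldsLists S nb deg nbr) (hlt : ∀ u, (nb u).length < S) (u v : Fin L) :
    HoldsLists S (Function.update nb u (nb u ++ [v])) (Function.update deg u (deg u + 1))
      (Function.update nbr (u * S + deg u) v) := by
  intro w
  have hu := h u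
  by_cases hw : w = u
  · subst hw
    refine ⟨by simp [hu.1], fun c hc => ?_⟩
    simp only [Function.update_self, List.length_append, List.length_singleton] at hc
    rw [update_stride _ (by rw [hu.1]; exact hlt w) (by have := hlt w; omega), hu.1]
    by_cases hc' : c = (nb w).length
    · subst hc'; simp
    · have hc2 : c < (nb w).length := by omega
      simp [hc', List.getElem_append_left hc2, hu.2 c hc2]
  · have hw' : (w : ℕ) ≠ u := fun e => hw (Fin.ext e)
    simp only [Function.update_of_ne hw, Function.update_of_ne hw']
    refine ⟨(h w).1, fun c hc => ?_⟩
    rw [update_stride _ (by rw [hu.1]; exact hlt u) (by have := hlt w; omega), if_neg (by tauto)]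
    exact (h w).2 c hc

theorem pushCmd_spec {s : Store Arr} (hB : Base l S es ts bs s) {nb : Fin L → List (Fin L)}
    (h : HoldsLists S nb (s.a .deg) (s.a .nbr)) (hlt : ∀ u, (nb u).length < S) {x y : Var}
    {u v : Fin L} (hx : s.v x = u) (hy : s.v y = v) :
    Spec (pushCmd x y) s (fun s' => HoldsLists S (Function.update nb u (nb u ++ [v]))
      (s'.a .deg) (s'.a .nbr)) 2 := by
  refine ⟨?_, le_rfl⟩
  have := h.push hlt u v
  have hrow := hB.row u (by have := hB.L_le; have := u.2; omega)
  simpa [pushCmd, Cmd.run, Store.setA_a, hx, hy, hrow] using this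

theorem sum_length_update (nb : Fin L → List (Fin L)) (u v : Fin L) :
    ∑ w, (Function.update nb u (nb u ++ [v]) w).length = ∑ w, (nb w).length + 1 := by
  have : ∀ w, (Function.update nb u (nb u ++ [v]) w).length =
      (nb w).length + if w = u then 1 else 0 := by
    intro w
    by_cases hw : w = u
    · subst hw; simp
    · simp [hw]
  simp [this, Finset.sum_add_distrib]

theorem length_le_sum {β : Type*} (nb : Fin L → List β) (u : Fin L) :
    (nb u).length ≤ ∑ w, (nb w).length :=
  Finset.single_le_sum (f := fun w => (nb w).length) (fun _ _ => Nat.zero_le _) (Finset.mem_univ u)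

theorem mem_update_append (nb : Fin L → List (Fin L)) (u v a b : Fin L) :
    b ∈ Function.update nb u (nb u ++ [v]) a ↔ b ∈ nb a ∨ (a = u ∧ b = v) := by
  by_cases h : a = u
  · subst h; simp
  · simp [h]

/-- The degrees add up to twice the number of tree edges, which is below the stride; therefore no
list runs into the row of the next node. -/
theorem adjacencyCmd_spec {s : Store Arr} (hB : Base l S es ts bs s)
    (hdeg : s.a .deg = fun _ => 0) :
    Spec adjacencyCmd s (fun s' => ∃ nb : Fin L → List (Fin L),
      HoldsLists S nb (s'.a .deg) (s'.a .nbr) ∧ ∑ u, (nb u).length = ts.length + ts.length ∧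
      ∀ u v, v ∈ nb u ↔ s(u, v) ∈ ts.map fun e => s(e.1, e.2)) (1 + ts.length * 7) := by
  have := Spec.loop (c := .set .u (.get .inp (Var.tb + Var.e + Var.e)) ;;
    .set .v (.get .inp (Var.tb + Var.e + Var.e + 1)) ;; pushCmd .u .v ;; pushCmd .v .u)
    (x := .e) (e := Var.mt) (s := s) (T := 6) (b := ts.length)
    (fun e s' => ∃ nb : Fin L → List (Fin L),
      HoldsLists S nb (s'.a .deg) (s'.a .nbr) ∧ ∑ u, (nb u).length = e + e ∧
      ∀ u v, v ∈ nb u ↔ s(u, v) ∈ (ts.take e).map fun e => s(e.1, e.2))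
    hB.vmt ⟨fun _ => [], fun u => ⟨by simp [hdeg], by simp⟩, by simp, by simp⟩ ?_
  · rw [List.take_length] at this; exact this
  rintro e he s₁ ⟨nb, h1, h2, h3⟩ hf
  have hB₁ := hB.of_frame hf rfl
  have hB₂ := hB₁.setV .e e rfl
  obtain ⟨te1, te2⟩ := hB₁.tedge e he
  apply Spec.weaken
  · apply Spec.set_seq
    apply Spec.set_seq
    set s₂ : Store Arr := Store.setV _ _ _ with hs₂
    have hB₃ : Base l S es ts bs s₂ := (hB₂.setV .u _ rfl).setV .v _ rfl
    have hu : s₂.v .u = ts[e].1 := by simp [hs₂, Store.setV_v, te1]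
    have hv : s₂.v .v = ts[e].2 := by simp [hs₂, Store.setV_v, te2]
    have hlen := hB.mt_lt
    refine Spec.seq (T := 2) (U := 2) (pushCmd_spec hB₃ h1 ?_ hu hv) ?_
    · intro u; have := length_le_sum nb u; omega
    intro s₃ h4 hf₃
    refine (pushCmd_spec (hB₃.of_frame hf₃ rfl) h4 ?_ ((hf₃.v .v rfl).trans hv)
      ((hf₃.v .u rfl).trans hu)).imp ?_
    · intro u
      have := length_le_sum (Function.update nb ts[e].1 (nb ts[e].1 ++ [ts[e].2])) u
      rw [sum_length_update] at this
      omega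
    intro s₄ h5 _
    refine ⟨_, h5, ?_, ?_⟩
    · rw [sum_length_update, sum_length_update]; omega
    · intro u v
      rw [mem_update_append, mem_update_append, h3, List.take_add_one, List.getElem?_eq_getElem he]
      simp only [Option.toList_some, List.map_append, List.map_cons, List.map_nil,
        List.mem_append, List.mem_singleton, Sym2.eq_iff]
      tauto
  · norm_num

/-- The search has reached exactly the nodes of `o`, in this order. -/
structure Reached (D : SimpleGraph (Fin L)) (o : List (Fin L)) (s : Store Arr) : Prop where
  tail : s.v .tail = o.length
  ord : ∀ i (h : i < o.length), s.a .ord i = (o[i] : ℕ)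
  vis : ∀ u : Fin L, s.a .vis u < 1 ↔ u ∉ o
  nodup : o.Nodup
  pos : 0 < o.length
  adj : ∀ i (h : i < o.length), 0 < i → ∃ j, ∃ hj : j < i, D.Adj o[i] o[j]

theorem visitCmd_spec {T : SimpleGraph (Fin L)} {s : Store Arr} (hB : Base l S es ts bs s)
    {o : List (Fin L)} (ho : Reached T o s) {u v : Fin L} {c h : ℕ} (hh : h < o.length)
    (hou : o[h] = u) (hadj : T.Adj u v)
    (hu : s.v .u = u) (hc : s.v .c = c) (hv : s.a .nbr (u * S + c) = v) :
    Spec visitCmd s (fun s' => ∃ o', o <+: o' ∧ Reached T o' s' ∧ v ∈ o') 5 := by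
  have hrow := hB.row u (by have := hB.L_le; have := u.2; omega)
  apply Spec.weaken
  · apply Spec.set_seq
    set s₁ : Store Arr := Store.setV _ _ _ with hs₁
    have hv₁ : s₁.v .v = v := by simp [hs₁, Store.setV_v, hu, hc, hrow, hv]
    have ho₁ : Reached T o s₁ :=
      ⟨by simp [hs₁, Store.setV_v, ho.tail], ho.ord, ho.vis, ho.nodup, ho.pos, ho.adj⟩
    refine Spec.ite (T := 3) ?_ ?_
    · intro hlt
      have hlt' : s₁.a .vis v < 1 := by simpa [hv₁] using hlt
      have hvo := (ho₁.vis v).1 hlt'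
      refine ⟨⟨o ++ [v], List.prefix_append _ _, ?_, by simp⟩, le_rfl⟩
      refine ⟨?_, ?_, ?_, ?_, by simp, ?_⟩
      · simp [Cmd.run, Store.setV_v, ho₁.tail]
      · intro i hi
        simp only [List.length_append, List.length_singleton] at hi
        by_cases hi' : i = o.length
        · subst hi'
          simp [Cmd.run, Store.setA_a, hv₁, ho₁.tail]
        · have hi2 : i < o.length := by omega
          simp [Cmd.run, Store.setA_a, ho₁.tail, hi', List.getElem_append_left hi2, ho₁.ord i hi2]
      · intro w
        have := ho₁.vis w
        by_cases hw : w = v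
        · subst hw; simp [Cmd.run, Store.setA_a, hv₁]
        · have hw' : (w : ℕ) ≠ v := fun e => hw (Fin.ext e)
          simp [Cmd.run, Store.setA_a, hv₁, hw, hw'] at this ⊢
          exact this
      · rw [List.nodup_append]
        refine ⟨ho.nodup, by simp, ?_⟩
        rintro a ha b hb rfl
        rw [List.mem_singleton] at hb
        exact hvo (hb ▸ ha)
      · intro i hi hpos
        simp only [List.length_append, List.length_singleton] at hi
        by_cases hi' : i = o.length
        · subst hi'
          refine ⟨h, hh, ?_⟩
          simpa [List.getElem_append_left hh, hou] using hadj.symm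
        · have hi2 : i < o.length := by omega
          obtain ⟨j, hj, ha⟩ := ho.adj i hi2 hpos
          refine ⟨j, hj, ?_⟩
          simpa [List.getElem_append_left hi2, List.getElem_append_left (hj.trans hi2)] using ha
    · intro hlt
      have hlt' : ¬ s₁.a .vis v < 1 := by simpa [hv₁] using hlt
      have hvo : v ∈ o := by by_contra hvo; exact hlt' ((ho₁.vis v).2 hvo)
      exact (Spec.skip ⟨o, List.prefix_rfl, ho₁, hvo⟩).weaken (by norm_num)
  · norm_num

theorem searchCmd_spec {G : SimpleGraph (Fin n)} {D : TreeDecomposition G (Fin L)} {s : Store Arr}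
    (hB : Base l S es ts bs s) (hts : IsEdgeList D.tree ts) {nb : Fin L → List (Fin L)}
    (hnb : HoldsLists S nb (s.a .deg) (s.a .nbr))
    (hsum : ∑ u, (nb u).length = ts.length + ts.length)
    (hmem : ∀ u v, v ∈ nb u ↔ s(u, v) ∈ ts.map fun e => s(e.1, e.2))
    (hvis : s.a .vis = fun _ => 0) :
    Spec searchCmd s (fun s' => ∃ o : ℕ → Fin L, IsSearchOrder D L o ∧
      ∀ i < L, s'.a .ord i = o i) (4 + 3 * L + 12 * ts.length) := by
  have hLpos : 0 < L := by
    obtain ⟨t⟩ := D.isTree.connected.nonempty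
    exact t.pos
  set r : Fin L := ⟨0, hLpos⟩ with hr
  have hadj : ∀ u v, v ∈ nb u ↔ D.tree.Adj u v := fun u v => by rw [hmem, hts.2]
  apply Spec.weaken
  · apply Spec.put_seq
    apply Spec.put_seq
    apply Spec.set_seq
    set s₁ : Store Arr := Store.setV _ _ _ with hs₁
    have hB₁ : Base l S es ts bs s₁ := ((hB.setA .ord _ _ rfl).setA .vis _ _ rfl).setV .tail _ rfl
    have hnb₁ : HoldsLists S nb (s₁.a .deg) (s₁.a .nbr) := by
      simpa [hs₁, Store.setA_a] using hnb
    have h0 : Reached D.tree [r] s₁ := by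
      refine ⟨by simp [hs₁, Store.setV_v], ?_, ?_, by simp, by simp, ?_⟩
      · intro i hi
        have : i = 0 := by simpa using hi
        subst this
        simp [hs₁, Store.setA_a, hr]
      · intro u
        by_cases hu : (u : ℕ) = 0
        · have : u = r := Fin.ext hu
          simp [hs₁, Store.setA_a, this, hr]
        · have : u ≠ r := fun e => hu (by rw [e])
          simp [hs₁, Store.setA_a, hvis, this, hu]
      · intro i hi hpos
        have : i = 0 := by simpa using hi
        omega
    -- Amortization: `w` charges each processed node its degree, and processed nodes are distinct,
    -- so the total is linear in nodes and edges of the tree.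
    have hloop := Spec.loop_acc (c := .set .u (.get .ord Var.h) ;; .loop .c (.get .deg Var.u) visitCmd)
      (x := .h) (e := Var.L) (s := s₁) (b := L)
      (fun h w s' => ∃ o : List (Fin L), Reached D.tree o s' ∧
        (∀ i (hi : i < o.length), i < h → ∀ v, D.tree.Adj o[i] v → v ∈ o) ∧ h ≤ o.length ∧
        w ≤ ((o.take h).map fun u => 2 + 6 * (nb u).length).sum)
      hB₁.vL ⟨[r], h0, by omega, by simp, by simp⟩ ?_
    · obtain ⟨W, hW⟩ := hloop
      refine (hW.weaken (U := 1 + (2 * L + 6 * (ts.length + ts.length)) + L) ?_).imp ?_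
      · obtain ⟨o, h1, h2, h3, h4⟩ := hW.post
        rw [← hsum]
        have hle : o.length ≤ L := by simpa using h1.nodup.length_le_card
        rw [List.take_of_length_le hle] at h4
        have h5 : (o.map fun u => 2 + 6 * (nb u).length).sum ≤
            ∑ u, (2 + 6 * (nb u).length) := by
          rw [← List.sum_toFinset _ h1.nodup]
          exact Finset.sum_le_sum_of_subset (Finset.subset_univ _)
        rw [Finset.sum_add_distrib, ← Finset.mul_sum] at h5
        simp only [Finset.sum_const, Finset.card_univ, Fintype.card_fin, smul_eq_mul] at h5
        omega
      rintro s' ⟨o, h1, h2, h3, h4⟩ -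
      have hle : o.length ≤ L := by simpa using h1.nodup.length_le_card
      have hlen : o.length = L := by omega
      have hall : ∀ u, u ∈ o := by
        have : o.toFinset = Finset.univ :=
          Finset.eq_univ_of_card _ (by rw [List.toFinset_card_of_nodup h1.nodup, hlen]; simp)
        intro u
        rw [← List.mem_toFinset, this]
        exact Finset.mem_univ u
      have hget : ∀ i (hi : i < o.length), o.getD i r = o[i] := fun i hi => by
        simp [List.getD_eq_getElem?_getD, List.getElem?_eq_getElem hi]
      refine ⟨fun i => o.getD i r, ⟨?_, ?_, ?_⟩, ?_⟩
      · intro t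
        obtain ⟨i, hi, rfl⟩ := List.getElem_of_mem (hall t)
        exact ⟨i, hlen ▸ hi, hget i hi⟩
      · intro i hi j hj hij
        rw [hget i (by omega), hget j (by omega)] at hij
        exact (h1.nodup.getElem_inj_iff).1 hij
      · intro i hi hpos
        obtain ⟨j, hj, ha⟩ := h1.adj i (by omega) hpos
        refine ⟨j, hj, ?_⟩
        rwa [hget i (by omega), hget j (by omega)]
      · intro i hi
        rw [h1.ord i (by omega), ← hget i (by omega)]
    · rintro h hh w s₂ ⟨o, h1, h2, h3, h4⟩ hf
      have hB₂ := hB₁.of_frame hf rfl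
      -- The queue cannot run dry early: otherwise the nodes found would be closed under adjacency,
      -- and a connected tree would be exhausted by fewer than `L` nodes.
      have hlt : h < o.length := by
        by_contra hcon
        have heq : o.length = h := by omega
        have hall : ∀ u, u ∈ o := by
          have hstep : ∀ (a b : Fin L) (p : D.tree.Walk a b), a ∈ o → b ∈ o := by
            intro a b p
            induction p with
            | nil => exact id
            | @cons a c b hac q ih =>
              intro ha
              obtain ⟨i, hi, rfl⟩ := List.getElem_of_mem ha
              exact ih (h2 i hi (by omega) c hac)
          intro u
          exact hstep _ _ (D.isTree.connected.preconnected (o[0]'h1.pos) u).some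
            (List.getElem_mem h1.pos)
        have : L ≤ o.length := by
          have := Finset.card_le_card (fun u _ => List.mem_toFinset.2 (hall u) :
            (Finset.univ : Finset (Fin L)) ⊆ o.toFinset)
          rw [List.toFinset_card_of_nodup h1.nodup] at this
          simpa using this
        omega
      set u := o[h] with hu
      refine ⟨1 + (1 + (nb u).length * (5 + 1)), ?_⟩
      apply Spec.weaken
      · apply Spec.set_seq
        set s₃ : Store Arr := Store.setV _ _ _ with hs₃
        have hB₃ : Base l S es ts bs s₃ := (hB₂.setV .h _ rfl).setV .u _ rfl
        have hnb₂ : HoldsLists S nb (s₂.a .deg) (s₂.a .nbr) := by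
          rw [hf.a .deg rfl, hf.a .nbr rfl]; exact hnb₁
        have hu₃ : s₃.v .u = u := by
          simp [hs₃, Store.setV_v, h1.ord h hlt, ← hu]
        have hr₃ : Reached D.tree o s₃ :=
          ⟨by simp [hs₃, Store.setV_v, h1.tail], h1.ord, h1.vis, h1.nodup, h1.pos, h1.adj⟩
        refine (Spec.loop (T := 5) (b := (nb u).length)
          (fun c s' => ∃ o', o <+: o' ∧ Reached D.tree o' s' ∧ ∀ v ∈ (nb u).take c, v ∈ o')
          (by rw [eval_get, eval_var, hu₃]; exact (hnb₂ u).1)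
          ⟨o, List.prefix_rfl, hr₃, by simp⟩ ?_).imp ?_
        · rintro c hc s₄ ⟨o', hpre, hr₄, hin⟩ hf₄
          have hlen := hpre.length_le
          have hr₅ : Reached D.tree o' (s₄.setV .c c) :=
            ⟨by simp [Store.setV_v, hr₄.tail], hr₄.ord, hr₄.vis, hr₄.nodup, hr₄.pos, hr₄.adj⟩
          refine (visitCmd_spec ((hB₃.of_frame hf₄ rfl).setV .c c rfl) hr₅ (u := u)
            (v := (nb u)[c]) (c := c) (h := h)
            (by omega) (by rw [hu]; exact (hpre.getElem hlt).symm) ((hadj u _).1 (List.getElem_mem hc))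
            (by simp [Store.setV_v, hf₄.v .u rfl, hu₃]) (by simp [Store.setV_v])
            (by simp only [Store.setV_a, hf₄.a .nbr rfl]; exact (hnb₂ u).2 c hc)).imp ?_
          rintro s₅ ⟨o'', hpre', hr', hv'⟩ -
          refine ⟨o'', hpre.trans hpre', hr', fun v hv => ?_⟩
          rw [List.take_add_one, List.getElem?_eq_getElem hc] at hv
          simp only [Option.toList_some, List.mem_append, List.mem_singleton] at hv
          rcases hv with hv | rfl
          · exact hpre'.subset (hin v hv)
          · exact hv'
        · rintro s₄ ⟨o', hpre, hr₄, hin⟩ -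
          rw [List.take_length] at hin
          have hlen := hpre.length_le
          refine ⟨o', hr₄, ?_, by omega, ?_⟩
          · intro i hi hih v hv
            have hio : i < o.length := by omega
            rw [← hpre.getElem hio] at hv
            by_cases hieq : i = h
            · subst hieq
              exact hin v ((hadj _ v).2 hv)
            · exact hpre.subset (h2 i hio (by omega) v hv)
          · obtain ⟨tl, rfl⟩ := hpre
            rw [List.take_append_of_le_length (by omega), List.take_add_one,
              List.getElem?_eq_getElem hlt]
            simp only [Option.toList_some, List.map_append, List.sum_append, List.map_cons,
              List.map_nil, List.sum_cons, List.sum_nil]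
            rw [← hu]
            omega
      · omega
  · omega

end Search

/-! ### Distances -/

section Dist

variable {n L l S : ℕ} {es : List (Fin n × Fin n)} {ts : List (Fin L × Fin L)}
  {bs : Fin L → List (Fin n)}

theorem mem_take_succ {α : Type*} {xs : List α} {i : ℕ} (h : i < xs.length) {x : α} :
    x ∈ xs.take (i + 1) ↔ x ∈ xs.take i ∨ x = xs[i] := by
  rw [List.take_add_one, List.getElem?_eq_getElem h]
  simp only [Option.toList_some, List.mem_append, List.mem_singleton]

/-- A loop over the elements of the bag of node `t`. -/
theorem bagLoop_spec {s : Store Arr} (hB : Base l S es ts bs s) {t : Fin L} {tv iv xv : Var}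
    (ht : s.v tv = t) {body : Cmd Arr} {T k : ℕ} (hk : (bs t).length ≤ k)
    (J : ℕ → Store Arr → Prop) (hJ : J 0 s)
    (hkeep : (Cmd.loop iv (.get .bsz tv) (.set xv (bagElem tv iv) ;; body)).keepsBase = true)
    (htv : (Cmd.loop iv (.get .bsz tv) (.set xv (bagElem tv iv) ;; body)).writesV tv = false)
    (hstep : ∀ i (h : i < (bs t).length) s', J i s' →
      Frame (.loop iv (.get .bsz tv) (.set xv (bagElem tv iv) ;; body)) s s' →
      Base l S es ts bs ((s'.setV iv i).setV xv (bs t)[i]) →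
      Spec body ((s'.setV iv i).setV xv (bs t)[i]) (J (i + 1)) T) :
    Spec (.loop iv (.get .bsz tv) (.set xv (bagElem tv iv) ;; body)) s (J (bs t).length)
      (1 + k * (T + 2)) := by
  have h1 : tv ≠ iv := by
    rintro rfl; simp [Cmd.writesV] at htv
  refine (Spec.loop (T := T + 1) J (by rw [eval_get, eval_var, ht]; exact hB.bsz t) hJ ?_).weaken
    (Nat.add_le_add_left (Nat.mul_le_mul_right _ hk) _)
  intro i hi s' hJ' hf
  apply Spec.set_seq
  have hB' := hB.of_frame hf hkeep
  have hx : (bagElem tv iv).eval (s'.setV iv i) = (bs t)[i] := by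
    simp only [eval_bagElem, eval_var, Store.setV_a, Store.setV_v, h1, if_true, if_false]
    rw [hf.v tv htv, ht]
    exact hB'.bag t i hi
  rw [hx]
  refine hstep i hi s' hJ' hf (hB'.of_frame (c := .loop iv (.get .bsz tv)
    (.set xv (bagElem tv iv) ;; body)) ⟨fun y hy => ?_, fun _ _ => rfl⟩ hkeep)
  simp only [Cmd.writesV, Bool.or_eq_false_iff, beq_eq_false_iff_ne] at hy
  simp [Store.setV_v, Ne.symm hy.1, Ne.symm hy.2.1]

/-- The matrix in an array, on vertices. -/
def vmat (n S : ℕ) (a : ℕ → ℕ) (x y : Fin n) : ℕ := a (x * S + y)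

theorem vmat_update (hS : n ≤ S) (a : ℕ → ℕ) (x y x' y' : Fin n) (k : ℕ) :
    vmat n S (Function.update a (x * S + y) k) x' y' =
      if x' = x ∧ y' = y then k else vmat n S a x' y' := by
  unfold vmat
  rw [update_stride _ (by have := y.2; omega) (by have := y'.2; omega)]
  simp only [Fin.ext_iff]

theorem Base.row_fin {s : Store Arr} (hB : Base l S es ts bs s) (x : Fin n) :
    s.a .row x = x * S := hB.row x (by have := hB.n_le; have := x.2; omega)

theorem Base.row_node {s : Store Arr} (hB : Base l S es ts bs s) (t : Fin L) :
    s.a .row t = t * S := hB.row t (by have := hB.L_le; have := t.2; omega)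

/-- Pairs in `R` have been set to `n`. -/
structure DistReset (S : ℕ) (R : Fin n → Fin n → Prop) (a : ℕ → ℕ) : Prop where
  self : ∀ x, vmat n S a x x = 0
  reset : ∀ x y, R x y → x ≠ y → vmat n S a x y = n

theorem DistReset.step {s : Store Arr} (hB : Base l S es ts bs s) {R : Fin n → Fin n → Prop}
    (h : DistReset S R (s.a .dist)) {x y : Fin n} (hx : s.v .x = x) (hy : s.v .y = y)
    {R' : Fin n → Fin n → Prop} (hR : ∀ a b, R' a b → R a b ∨ (a = x ∧ b = y)) :
    Spec (.ite Var.x Var.y (.put .dist (cell Var.x Var.y) Var.n)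
        (.ite Var.y Var.x (.put .dist (cell Var.x Var.y) Var.n) .skip)) s
      (fun s' => DistReset S R' (s'.a .dist)) 3 := by
  have key : x ≠ y → DistReset S R' ((s.setA .dist (s.a .row (s.v .x) + s.v .y) (s.v .n)).a .dist) := by
    intro hne
    have hrow := hB.row_fin x
    have : (s.setA .dist (s.a .row (s.v .x) + s.v .y) (s.v .n)).a .dist =
        Function.update (s.a .dist) (x * S + y) n := by
      simp [Store.setA_a, hx, hy, hrow, hB.vn]
    rw [this]
    refine ⟨fun a => ?_, fun a b hab hab' => ?_⟩
    · rw [vmat_update hB.n_le, if_neg (by rintro ⟨rfl, rfl⟩; exact hne rfl), h.self]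
    · rw [vmat_update hB.n_le]
      split_ifs with h'
      · rfl
      · exact h.reset a b ((hR a b hab).resolve_right h') hab'
  apply Spec.weaken
  · refine Spec.ite (T := 2) (fun hlt => ?_) (fun hlt => ?_)
    · exact (Spec.put (key (by rintro rfl; simp [hx, hy] at hlt))).weaken (by norm_num)
    · refine Spec.ite (T := 1) (fun hlt' => ?_) (fun hlt' => ?_)
      · exact Spec.put (key (by rintro rfl; simp [hx, hy] at hlt'))
      · have hxy : x = y := by
          simp only [eval_var, hx, hy] at hlt hlt'
          exact Fin.ext (by omega)
        refine Spec.skip ⟨h.self, fun a b hab hab' => h.reset a b ((hR a b hab).resolve_right ?_) hab'⟩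
        rintro ⟨rfl, rfl⟩
        exact hab' hxy
  · norm_num

/-- The arrays hold upper bounds of distances, together with intermediate vertices. -/
structure DistOK {G : SimpleGraph (Fin n)} (D : TreeDecomposition G (Fin L)) (S : ℕ)
    (a b : ℕ → ℕ) : Prop extends IsDistBound D (vmat n S a) where
  adj : ∀ x y, G.Adj x y → vmat n S a x y ≤ 1
  wit : ∀ t, ∀ x ∈ D.bag t, ∀ y ∈ D.bag t, 1 < vmat n S a x y → vmat n S a x y < n →
    ∃ r z, x ∈ D.bag r ∧ y ∈ D.bag r ∧ z ∈ D.bag r ∧ vmat n S b x y = z ∧ z ≠ x ∧ z ≠ y ∧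
      vmat n S a x z + vmat n S a z y ≤ vmat n S a x y

theorem dist_lt_card {G : SimpleGraph (Fin n)} (hG : G.Connected) (x y : Fin n) :
    G.dist x y < n := by
  classical
  obtain ⟨p, hp⟩ := hG.exists_walk_length_eq_dist x y
  have h1 := dist_le p.bypass
  have h2 := p.bypass_isPath.length_lt
  simp at h2
  omega

theorem initDistCmd_spec {G : SimpleGraph (Fin n)} {D : TreeDecomposition G (Fin L)}
    (hG : G.Connected) (hes : IsEdgeList G es) (hbs : IsBagList D.bag bs) {k : ℕ}
    (hk : ∀ t, (bs t).length ≤ k) {s : Store Arr}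
    (hB : Base l S es ts bs s) (hd : s.a .dist = fun _ => 0) :
    Spec initDistCmd s (fun s' => DistOK D S (s'.a .dist) (s'.a .mid))
      (2 + L * (2 + k * (3 + k * 5)) + es.length * 5) := by
  have hSn := hB.n_le
  refine (Spec.seq (T := 1 + L * ((1 + k * ((1 + k * (3 + 2)) + 2)) + 1)) (U := 1 + es.length * (4 + 1))
    (P := fun s' => DistReset S (fun x y => ∃ t, x ∈ bs t ∧ y ∈ bs t) (s'.a .dist)) ?_ ?_).weaken ?_
  · refine (Spec.loop (b := L)
      (fun t (s' : Store Arr) => DistReset S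
        (fun x y => ∃ t' : Fin L, t' < t ∧ x ∈ bs t' ∧ y ∈ bs t') (s'.a .dist)) (by exact hB.vL) ⟨by simp [vmat, hd], by simp⟩ ?_).imp ?_
    · intro t ht s₁ h₁ hf₁
      have hB₁ := (hB.of_frame hf₁ rfl).setV .t t rfl
      have key := bagLoop_spec hB₁ (t := ⟨t, ht⟩) (tv := .t) (iv := .i) (xv := .x)
        (by simp [Store.setV_v]) (hk ⟨t, ht⟩) (T := 1 + k * (3 + 2)) (body :=
          .loop .j (.get .bsz Var.t) (.set .y (bagElem Var.t Var.j) ;;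
            .ite Var.x Var.y (.put .dist (cell Var.x Var.y) Var.n)
              (.ite Var.y Var.x (.put .dist (cell Var.x Var.y) Var.n) .skip)))
        (fun i s' => DistReset S (fun x y => (∃ t' : Fin L, t' < t ∧ x ∈ bs t' ∧ y ∈ bs t') ∨
          (x ∈ (bs ⟨t, ht⟩).take i ∧ y ∈ bs ⟨t, ht⟩)) (s'.a .dist))
        ⟨h₁.self, fun x y hxy => h₁.reset x y (by simpa using hxy)⟩ rfl rfl ?_
      · refine key.imp fun s' hs' _ => ⟨hs'.self, fun x y hxy => hs'.reset x y ?_⟩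
        obtain ⟨t', ht', h⟩ := hxy
        rw [List.take_length]
        by_cases he : t' < t
        · exact Or.inl ⟨t', he, h⟩
        · have : t' = ⟨t, ht⟩ := Fin.ext (by simp; omega)
          exact Or.inr (this ▸ h)
      · intro i hi s₂ h₂ hf₂ hB₂
        refine (bagLoop_spec hB₂ (t := ⟨t, ht⟩) (tv := .t) (iv := .j) (xv := .y)
          (by simp [Store.setV_v, hf₂.v .t rfl]) (hk ⟨t, ht⟩) (T := 3)
          (fun j s' => DistReset S (fun x y => ((∃ t' : Fin L, t' < t ∧ x ∈ bs t' ∧ y ∈ bs t') ∨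
            (x ∈ (bs ⟨t, ht⟩).take i ∧ y ∈ bs ⟨t, ht⟩)) ∨
            (x = (bs ⟨t, ht⟩)[i] ∧ y ∈ (bs ⟨t, ht⟩).take j)) (s'.a .dist))
          ⟨h₂.self, fun x y hxy => h₂.reset x y (by simpa using hxy)⟩ rfl rfl ?_).imp ?_
        · intro j hj s₃ h₃ hf₃ hB₃
          refine DistReset.step hB₃ (R := _) h₃ (x := (bs ⟨t, ht⟩)[i]) (y := (bs ⟨t, ht⟩)[j])
            (by simp [Store.setV_v, hf₃.v .x rfl]) (by simp [Store.setV_v]) ?_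
          intro a b hab
          rw [mem_take_succ hj] at hab
          rcases hab with h | ⟨h, h' | h'⟩
          · exact Or.inl (Or.inl h)
          · exact Or.inl (Or.inr ⟨h, h'⟩)
          · exact Or.inr ⟨h, h'⟩
        · intro s₃ h₃ _
          refine ⟨h₃.self, fun x y hxy => h₃.reset x y ?_⟩
          rw [mem_take_succ hi] at hxy
          rw [List.take_length]
          rcases hxy with h | ⟨h | h, h'⟩
          · exact Or.inl (Or.inl h)
          · exact Or.inl (Or.inr ⟨h, h'⟩)
          · exact Or.inr ⟨h, h'⟩
    · exact fun s' hs' _ => ⟨hs'.self, fun x y ⟨t, h⟩ => hs'.reset x y ⟨t, t.2, h⟩⟩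
  · intro s₁ h₁ hf₁
    have hB₁ := hB.of_frame hf₁ rfl
    have hbag : ∀ t x, x ∈ bs t ↔ x ∈ D.bag t := fun t x => (hbs t).2 x
    have hadj : ∀ i (h : i < es.length), G.Adj es[i].1 es[i].2 := fun i h =>
      (hes.2 _ _).2 (List.mem_map.2 ⟨es[i], List.getElem_mem h, rfl⟩)
    refine (Spec.loop (b := es.length) (T := 4)
      (fun e (s' : Store Arr) => (∀ x, vmat n S (s'.a .dist) x x = 0) ∧
        (∀ t x y, x ∈ bs t → y ∈ bs t → x ≠ y → vmat n S (s'.a .dist) x y = n ∨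
          (vmat n S (s'.a .dist) x y = 1 ∧ G.Adj x y)) ∧
        ∀ x y, s(x, y) ∈ (es.take e).map (fun e : Fin n × Fin n => s(e.1, e.2)) → vmat n S (s'.a .dist) x y = 1)
      (by exact hB₁.vm) ⟨h₁.self, fun t x y hx hy hne => Or.inl (h₁.reset x y ⟨t, hx, hy⟩ hne), by simp⟩ ?_).imp ?_
    · rintro e he s₂ ⟨ha, hb, hc⟩ hf₂
      have hB₂ := hB₁.of_frame hf₂ rfl
      obtain ⟨e1, e2⟩ := hB₂.edge e he
      refine ⟨?_, le_rfl⟩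
      set x := es[e].1
      set y := es[e].2
      have hne : x ≠ y := (hadj e he).ne
      have hdist : ((Cmd.set .x (.get .inp (3 + Var.e + Var.e)) ;;
          .set .y (.get .inp (3 + Var.e + Var.e + 1)) ;;
          .put .dist (cell Var.x Var.y) 1 ;; .put .dist (cell Var.y Var.x) 1).run
            (s₂.setV .e e)).a .dist =
          Function.update (Function.update (s₂.a .dist) (x * S + y) 1) (y * S + x) 1 := by
        simp [Cmd.run, Store.setV_v, Store.setA_a, e1, e2, hB₂.row_fin]
      simp only [hdist, vmat_update hSn]
      refine ⟨fun a => ?_, fun t a b hat hbt hab => ?_, fun a b hab => ?_⟩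
      · rw [if_neg (by rintro ⟨rfl, h⟩; exact hne h.symm),
          if_neg (by rintro ⟨rfl, h⟩; exact hne h), ha]
      · split_ifs with h1 h2
        · exact Or.inr ⟨rfl, by rw [h1.1, h1.2]; exact (hadj e he).symm⟩
        · exact Or.inr ⟨rfl, by rw [h2.1, h2.2]; exact hadj e he⟩
        · exact hb t a b hat hbt hab
      · split_ifs with h1 h2
        · rfl
        · rfl
        · refine hc a b ?_
          rw [List.map_take, mem_take_succ (by simpa using he)] at hab
          rw [List.map_take]
          refine hab.resolve_right ?_
          rw [List.getElem_map, Sym2.eq_iff]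
          tauto
    · rintro s₂ ⟨ha, hb, hc⟩ _
      rw [List.take_length] at hc
      refine ⟨⟨ha, fun t x hx y hy => ?_⟩, fun x y hxy => ?_, fun t x hx y hy h1 h2 => ?_⟩
      · by_cases hne : x = y
        · subst hne; simp
        · rcases hb t x y ((hbag t x).2 hx) ((hbag t y).2 hy) hne with h | ⟨h, hadj⟩
          · rw [h]; exact (dist_lt_card hG x y).le
          · rw [h, dist_eq_one_iff_adj.2 hadj]
      · rw [hc x y ((hes.2 x y).1 hxy)]
      -- At this point the only values inside bags are 0, 1 and `n`, so no pair asks for a witness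
      -- yet.
      · exfalso
        by_cases hne : x = y
        · subst hne; rw [ha] at h1; omega
        · rcases hb t x y ((hbag t x).2 hx) ((hbag t y).2 hy) hne with h | ⟨h, hadj⟩ <;> omega
  · apply le_of_eq; ring

open Classical in
/-- Relaxation of the pairs in `P` through `z`. -/
noncomputable def relaxed (d : Fin n → Fin n → ℕ) (z : Fin n) (P : Fin n → Fin n → Prop)
    (x y : Fin n) : ℕ := if P x y then min (d x y) (d x z + d z y) else d x y

theorem relaxed_congr {d : Fin n → Fin n → ℕ} {z x y : Fin n} {P Q : Fin n → Fin n → Prop}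
    (h : P x y ↔ Q x y) : relaxed d z P x y = relaxed d z Q x y := by
  unfold relaxed
  by_cases hP : P x y
  · rw [if_pos hP, if_pos (h.1 hP)]
  · rw [if_neg hP, if_neg (mt h.2 hP)]

/-- A write happens only on strict improvement, and the diagonal is zero; this forces `z` to differ
from `x` and `y`. Older witnesses stay valid: the two summands can only decrease, while the entry
they bound changes only when its witness is rewritten. -/
theorem relaxStep_spec {G : SimpleGraph (Fin n)} {D : TreeDecomposition G (Fin L)}
    (hG : G.Connected) {s : Store Arr} (hB : Base l S es ts bs s)
    (h : DistOK D S (s.a .dist) (s.a .mid)) {t : Fin L} {x y z : Fin n} (hxt : x ∈ D.bag t)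
    (hyt : y ∈ D.bag t) (hzt : z ∈ D.bag t) (hx : s.v .x = x) (hy : s.v .y = y) (hz : s.v .z = z) :
    Spec (.ite (.get .dist (cell Var.x Var.z) + .get .dist (cell Var.z Var.y))
        (.get .dist (cell Var.x Var.y))
        (.put .mid (cell Var.x Var.y) Var.z ;;
          .put .dist (cell Var.x Var.y)
            (.get .dist (cell Var.x Var.z) + .get .dist (cell Var.z Var.y))) .skip) s
      (fun s' => DistOK D S (s'.a .dist) (s'.a .mid) ∧
        ∀ a b, vmat n S (s'.a .dist) a b = if a = x ∧ b = y then
          min (vmat n S (s.a .dist) x y) (vmat n S (s.a .dist) x z + vmat n S (s.a .dist) z y)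
          else vmat n S (s.a .dist) a b) 3 := by
  have hSn := hB.n_le
  set d := vmat n S (s.a .dist) with hd
  have hcell : ∀ (a b : Fin n), s.a .dist (a * S + b) = d a b := fun a b => rfl
  apply Spec.weaken
  · refine Spec.ite (T := 2) (fun hlt => ?_) (fun hlt => ?_)
    · simp only [eval_add, eval_get, eval_cell, eval_var, hx, hy, hz, hB.row_fin, hcell] at hlt
      have hzx : z ≠ x := by
        rintro rfl
        have := h.self z
        rw [← hd] at this
        omega
      have hzy : z ≠ y := by
        rintro rfl
        have := h.self z
        rw [← hd] at this
        omega
      refine ⟨?_, le_rfl⟩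
      have e1 : ((Cmd.put .mid (cell Var.x Var.y) Var.z ;;
          .put .dist (cell Var.x Var.y)
            (.get .dist (cell Var.x Var.z) + .get .dist (cell Var.z Var.y))).run s).a .dist =
          Function.update (s.a .dist) (x * S + y) (d x z + d z y) := by
        simp [Cmd.run, Store.setA_a, hx, hy, hz, hB.row_fin, hcell]
      have e2 : ((Cmd.put .mid (cell Var.x Var.y) Var.z ;;
          .put .dist (cell Var.x Var.y)
            (.get .dist (cell Var.x Var.z) + .get .dist (cell Var.z Var.y))).run s).a .mid =
          Function.update (s.a .mid) (x * S + y) z := by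
        simp [Cmd.run, Store.setA_a, hx, hy, hz, hB.row_fin]
      rw [e1, e2]
      set d' := vmat n S (Function.update (s.a .dist) (x * S + y) (d x z + d z y)) with hd'
      have hval : ∀ a b, d' a b = if a = x ∧ b = y then d x z + d z y else d a b := fun a b => by
        rw [hd', vmat_update hSn]
      have hle : ∀ a b, d' a b ≤ d a b := by
        intro a b
        rw [hval]
        split_ifs with hab
        · rw [hab.1, hab.2]; exact hlt.le
        · exact le_rfl
      refine ⟨⟨⟨fun a => ?_, fun r a ha b hb => ?_⟩, fun a b hab => ?_, fun r a ha b hb h1 h2 => ?_⟩,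
        fun a b => ?_⟩
      · have := hle a a
        have h0 := h.self a
        rw [← hd] at h0
        change d' a a = 0
        omega
      · change _ ≤ d' a b
        rw [hval]
        split_ifs with hab
        · have t1 := hG.dist_triangle (u := a) (v := z) (w := b)
          have t2 := h.le t x hxt z hzt
          have t3 := h.le t z hzt y hyt
          rw [hab.1, hab.2] at *
          rw [← hd] at t2 t3
          omega
        · exact h.le r a ha b hb
      · exact (hle a b).trans (h.adj a b hab)
      · change 1 < d' a b at h1
        change d' a b < n at h2
        by_cases hab : a = x ∧ b = y
        · obtain ⟨rfl, rfl⟩ := hab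
          refine ⟨t, z, hxt, hyt, hzt, ?_, hzx, hzy, ?_⟩
          · rw [vmat_update hSn]; simp
          · change d' a z + d' z b ≤ d' a b
            have := hle a z
            have := hle z b
            rw [hval a b]
            simp only [and_self, if_true]
            omega
        · have hab' : d' a b = d a b := by rw [hval, if_neg hab]
          rw [hab'] at h1 h2
          obtain ⟨r', w, c1, c2, c3, c4, c5, c6, c7⟩ := h.wit r a ha b hb h1 h2
          refine ⟨r', w, c1, c2, c3, ?_, c5, c6, ?_⟩
          · rw [vmat_update hSn, if_neg hab, c4]
          · change d' a w + d' w b ≤ d' a b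
            have := hle a w
            have := hle w b
            rw [← hd] at c7
            omega
      · rw [hval, min_eq_right hlt.le]
    · simp only [eval_add, eval_get, eval_cell, eval_var, hx, hy, hz, hB.row_fin, hcell] at hlt
      refine (Spec.skip ⟨h, fun a b => ?_⟩).weaken (by norm_num)
      rw [← hd]
      split_ifs with hab
      · rw [min_eq_left (by omega), hab.1, hab.2]
      · rfl
  · norm_num

/-- Relaxing in place equals relaxing all pairs at once, because the zero diagonal leaves the row
and the column of `z` unchanged during the round of `z`. -/
theorem relaxed_step {d d₀ d' : Fin n → Fin n → ℕ} {z x y : Fin n} {P Q : Fin n → Fin n → Prop}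
    (hz : d₀ z z = 0) (hd : ∀ a b, d a b = relaxed d₀ z P a b)
    (hd' : ∀ a b, d' a b = if a = x ∧ b = y then min (d x y) (d x z + d z y) else d a b)
    (hQ : ∀ a b, Q a b ↔ P a b ∨ (a = x ∧ b = y)) (a b : Fin n) : d' a b = relaxed d₀ z Q a b := by
  have h1 : ∀ a, d a z = d₀ a z := fun a => by
    rw [hd, relaxed]; split_ifs <;> simp [hz]
  have h2 : ∀ a, d z a = d₀ z a := fun a => by
    rw [hd, relaxed]; split_ifs <;> simp [hz]
  rw [hd']
  by_cases hab : a = x ∧ b = y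
  · rw [if_pos hab, relaxed, if_pos ((hQ a b).2 (Or.inr hab)), h1, h2, hd, relaxed, hab.1, hab.2]
    split_ifs
    · rw [min_assoc, min_self]
    · rfl
  · rw [if_neg hab, hd]
    exact relaxed_congr (by rw [hQ]; tauto)

/-- Floyd–Warshall on one bag. After the round of `z`, the triangle inequality holds through `z` and
through every vertex of the bag processed before. -/
theorem closeBagCmd_spec {G : SimpleGraph (Fin n)} {D : TreeDecomposition G (Fin L)}
    (hG : G.Connected) (hbs : IsBagList D.bag bs) {k : ℕ} (hk : ∀ t, (bs t).length ≤ k)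
    {s : Store Arr} (hB : Base l S es ts bs s) (h : DistOK D S (s.a .dist) (s.a .mid))
    {t : Fin L} (ht : s.v .t = t) :
    Spec closeBagCmd s (fun s' => DistOK D S (s'.a .dist) (s'.a .mid) ∧
      (∀ a b, vmat n S (s'.a .dist) a b ≤ vmat n S (s.a .dist) a b) ∧
      TriangleIn D (vmat n S (s'.a .dist)) t) (1 + k * (3 + k * (3 + k * 5))) := by
  have hbag : ∀ x, x ∈ bs t ↔ x ∈ D.bag t := fun x => (hbs t).2 x
  refine ((bagLoop_spec hB ht (iv := .f) (xv := .z) (hk t) (T := 1 + k * ((1 + k * (3 + 2)) + 2))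
    (fun f s' => DistOK D S (s'.a .dist) (s'.a .mid) ∧
      (∀ a b, vmat n S (s'.a .dist) a b ≤ vmat n S (s.a .dist) a b) ∧
      ∀ z ∈ (bs t).take f, ∀ x ∈ bs t, ∀ y ∈ bs t, vmat n S (s'.a .dist) x y ≤
        vmat n S (s'.a .dist) x z + vmat n S (s'.a .dist) z y)
    ⟨h, fun _ _ => le_rfl, by simp⟩ rfl rfl ?_).imp ?_).weaken (by apply le_of_eq; ring)
  · rintro f hf s₁ ⟨h₁, hle₁, htri₁⟩ hf₁ hB₁
    set z := (bs t)[f] with hz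
    have hzt : z ∈ bs t := List.getElem_mem hf
    set d := vmat n S (s₁.a .dist) with hd
    have hzz : d z z = 0 := h₁.self z
    refine (bagLoop_spec hB₁ (t := t) (tv := .t) (iv := .i) (xv := .x)
      (by simp [Store.setV_v, hf₁.v .t rfl, ht]) (hk t) (T := 1 + k * (3 + 2))
      (fun i s' => DistOK D S (s'.a .dist) (s'.a .mid) ∧
        ∀ a b, vmat n S (s'.a .dist) a b =
          relaxed d z (fun x y => x ∈ (bs t).take i ∧ y ∈ bs t) a b)
      ⟨h₁, fun a b => by simp [relaxed]; rfl⟩ rfl rfl ?_).imp ?_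
    · rintro i hi s₂ ⟨h₂, hr₂⟩ hf₂ hB₂
      set x := (bs t)[i] with hx
      refine (bagLoop_spec hB₂ (t := t) (tv := .t) (iv := .j) (xv := .y)
        (by simp [Store.setV_v, hf₂.v .t rfl, hf₁.v .t rfl, ht]) (hk t) (T := 3)
        (fun j s' => DistOK D S (s'.a .dist) (s'.a .mid) ∧
          ∀ a b, vmat n S (s'.a .dist) a b =
            relaxed d z (fun x' y => (x' ∈ (bs t).take i ∧ y ∈ bs t) ∨
              (x' = x ∧ y ∈ (bs t).take j)) a b)
        ⟨h₂, fun a b => by simp only [Store.setV_a]; rw [hr₂]; simp [relaxed]⟩ rfl rfl ?_).imp ?_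
      · rintro j hj s₃ ⟨h₃, hr₃⟩ hf₃ hB₃
        set y := (bs t)[j] with hy
        refine (relaxStep_spec hG hB₃ (t := t) (x := x) (y := y) (z := z) h₃
          ((hbag x).1 (List.getElem_mem hi)) ((hbag y).1 (List.getElem_mem hj)) ((hbag z).1 hzt)
          (by simp [Store.setV_v, hf₃.v .x rfl]) (by simp [Store.setV_v])
          (by simp [Store.setV_v, hf₃.v .z rfl, hf₂.v .z rfl])).imp ?_
        rintro s₄ ⟨h₄, hv₄⟩ -
        refine ⟨h₄, relaxed_step hzz hr₃ hv₄ ?_⟩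
        intro a b
        rw [mem_take_succ hj]
        tauto
      · rintro s₃ ⟨h₃, hr₃⟩ -
        refine ⟨h₃, fun a b => ?_⟩
        rw [hr₃, List.take_length]
        exact relaxed_congr (by rw [mem_take_succ hi]; tauto)
    · rintro s₂ ⟨h₂, hr₂⟩ -
      rw [List.take_length] at hr₂
      have hle : ∀ a b, vmat n S (s₂.a .dist) a b ≤ d a b := by
        intro a b
        rw [hr₂, relaxed]
        split_ifs
        · exact min_le_left _ _
        · exact le_rfl
      refine ⟨h₂, fun a b => (hle a b).trans (hle₁ a b), fun w hw x hx y hy => ?_⟩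
      have hwt : w ∈ bs t := by
        rw [mem_take_succ hf] at hw
        rcases hw with hw | rfl
        · exact List.mem_of_mem_take hw
        · exact hzt
      have hval : ∀ a ∈ bs t, ∀ b ∈ bs t, vmat n S (s₂.a .dist) a b = min (d a b) (d a z + d z b) :=
        fun a ha b hb => by rw [hr₂, relaxed, if_pos ⟨ha, hb⟩]
      rw [hval x hx y hy, hval x hx w hwt, hval w hwt y hy]
      rw [mem_take_succ hf] at hw
      rcases hw with hw | rfl
      · have t1 := htri₁ w hw x hx y hy
        have t2 := htri₁ w hw z hzt y hy
        have t3 := htri₁ w hw x hx z hzt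
        omega
      · rw [← hz, hzz]
        omega
  · rintro s₁ ⟨h₁, hle₁, htri₁⟩ -
    rw [List.take_length] at htri₁
    exact ⟨h₁, hle₁, fun x hx y hy z hz =>
      htri₁ z ((hbag z).2 hz) x ((hbag x).2 hx) y ((hbag y).2 hy)⟩

/-- The first loop peels off bags from the end of the search order by `StepsExact.pred`, the second
adds them back by `ExactBelow.succ`. Later relaxations do no harm, since both properties persist
when entries decrease. -/
theorem sweepCmd_spec {G : SimpleGraph (Fin n)} {D : TreeDecomposition G (Fin L)}
    (hG : G.Connected) (hbs : IsBagList D.bag bs) {k : ℕ} (hk : ∀ t, (bs t).length ≤ k)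
    {s : Store Arr} (hB : Base l S es ts bs s) (h : DistOK D S (s.a .dist) (s.a .mid))
    {o : ℕ → Fin L} (ho : IsSearchOrder D L o) (hord : ∀ i < L, s.a .ord i = o i) :
    Spec sweepCmd s (fun s' =>
      (∀ t, ∀ x ∈ D.bag t, ∀ y ∈ D.bag t, vmat n S (s'.a .dist) x y = G.dist x y) ∧
      ∃ mid : Fin n → Fin n → Fin n, IsMid D mid ∧
        ∀ t, ∀ x ∈ D.bag t, ∀ y ∈ D.bag t, 1 < G.dist x y →
          vmat n S (s'.a .mid) x y = mid x y)
      (2 + 2 * (L * (3 + k * (3 + k * (3 + k * 5))))) := by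
  have body : ∀ (s₁ : Store Arr) (e : Exp Arr) (t : Fin L), Base l S es ts bs s₁ →
      DistOK D S (s₁.a .dist) (s₁.a .mid) → e.eval s₁ = t →
      Spec (.set .t e ;; closeBagCmd) s₁ (fun s' => DistOK D S (s'.a .dist) (s'.a .mid) ∧
        (∀ a b, vmat n S (s'.a .dist) a b ≤ vmat n S (s₁.a .dist) a b) ∧
        TriangleIn D (vmat n S (s'.a .dist)) t) (2 + k * (3 + k * (3 + k * 5))) := by
    intro s₁ e t hB₁ h₁ he
    refine (Spec.set_seq (closeBagCmd_spec hG hbs hk (hB₁.setV .t _ rfl) h₁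
      (by simp [Store.setV_v, he]))).weaken (by omega)
  refine (Spec.seq (T := 1 + L * ((2 + k * (3 + k * (3 + k * 5))) + 1))
    (U := 1 + L * ((2 + k * (3 + k * (3 + k * 5))) + 1))
    (P := fun s' => DistOK D S (s'.a .dist) (s'.a .mid) ∧
      ∀ i, 1 ≤ i → i ≤ L → StepsExact D o i (vmat n S (s'.a .dist))) ?_ ?_).weaken
    (by apply le_of_eq; ring)
  · refine (Spec.loop (b := L) (fun h (s' : Store Arr) => DistOK D S (s'.a .dist) (s'.a .mid) ∧
      ∀ i, 1 ≤ i → i ≤ L → L ≤ h + i → StepsExact D o i (vmat n S (s'.a .dist)))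
      (by exact hB.vL)
      ⟨h, fun i h1 h2 h3 => ?_⟩ ?_).imp ?_
    · have : i = L := by omega
      subst this
      exact stepsExact_full hG ho h.adj
    · rintro j hj s₁ ⟨h₁, hs₁⟩ hf₁
      have hB₁ := hB.of_frame hf₁ rfl
      refine (body (s₁.setV .h j) _ (o (L - 1 - j)) (hB₁.setV .h j rfl) h₁ ?_).imp ?_
      · simp only [eval_get, eval_sub, eval_var, eval_one, Store.setV_v, Store.setV_a, reduceCtorEq,
          if_false, if_true, hB₁.vL]
        rw [hf₁.a .ord rfl]
        exact hord _ (by omega)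
      · rintro s₂ ⟨h₂, hle, htri⟩ -
        have hLe : LeOnBags D (vmat n S (s₂.a .dist)) (vmat n S (s₁.a .dist)) :=
          fun _ x _ y _ => hle x y
        refine ⟨h₂, fun i h1 h2 h3 => ?_⟩
        by_cases hi : L ≤ j + i
        · exact (hs₁ i h1 h2 hi).mono hLe
        · have hi' : i = L - 1 - j := by omega
          rw [← hi'] at htri
          exact ((hs₁ (i + 1) (by omega) (by omega) (by omega)).mono hLe).pred ho
            h₂.toIsDistBound (by omega) (by omega) htri
    · exact fun s' hs' _ => ⟨hs'.1, fun i h1 h2 => hs'.2 i h1 h2 (by omega)⟩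
  · rintro s₁ ⟨h₁, hs₁⟩ hf₁
    have hB₁ := hB.of_frame hf₁ rfl
    refine (Spec.loop (b := L) (fun h (s' : Store Arr) => DistOK D S (s'.a .dist) (s'.a .mid) ∧
      (∀ i, 1 ≤ i → i ≤ L → StepsExact D o i (vmat n S (s'.a .dist))) ∧
      ExactBelow D o h (vmat n S (s'.a .dist))) (by exact hB₁.vL) ⟨h₁, hs₁, by intro j hj; omega⟩ ?_).imp ?_
    · rintro j hj s₂ ⟨h₂, hs₂, he₂⟩ hf₂
      have hB₂ := hB₁.of_frame hf₂ rfl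
      refine (body (s₂.setV .h j) _ (o j) (hB₂.setV .h j rfl) h₂ ?_).imp ?_
      · simp only [eval_get, eval_var, Store.setV_v, Store.setV_a, if_true]
        rw [hf₂.a .ord rfl, hf₁.a .ord rfl]
        exact hord _ hj
      · rintro s₃ ⟨h₃, hle, htri⟩ -
        have hLe : LeOnBags D (vmat n S (s₃.a .dist)) (vmat n S (s₂.a .dist)) :=
          fun _ x _ y _ => hle x y
        refine ⟨h₃, fun i h1 h2 => (hs₂ i h1 h2).mono hLe, ?_⟩
        exact ExactBelow.succ hG ho h₃.toIsDistBound hj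
          ((hs₂ (j + 1) (by omega) (by omega)).mono hLe) (he₂.mono hLe) htri
    · rintro s₂ ⟨h₂, -, he₂⟩ -
      have hex : ∀ t, ∀ x ∈ D.bag t, ∀ y ∈ D.bag t, vmat n S (s₂.a .dist) x y = G.dist x y := by
        intro t x hx y hy
        obtain ⟨i, hi, rfl⟩ := ho.surj t
        exact le_antisymm (he₂ i hi x hx y hy) (h₂.le _ x hx y hy)
      refine ⟨hex, ?_⟩
      -- True distances are below `n`, so the witness clause applies to every pair at distance above
      -- 1; as all entries involved are exact by now, its inequality becomes an equality and the
      -- witness lies on a geodesic.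
      have hmid : ∀ x y, ∃ z : Fin n, ∀ t, x ∈ D.bag t → y ∈ D.bag t → 1 < G.dist x y →
          vmat n S (s₂.a .mid) x y = z ∧ ∃ r, x ∈ D.bag r ∧ y ∈ D.bag r ∧ z ∈ D.bag r ∧ z ≠ x ∧
            z ≠ y ∧ G.dist x z + G.dist z y = G.dist x y := by
        intro x y
        by_cases hxy : (∃ t, x ∈ D.bag t ∧ y ∈ D.bag t) ∧ 1 < G.dist x y
        · obtain ⟨⟨t, hx, hy⟩, h1⟩ := hxy
          have hlt := dist_lt_card hG x y
          rw [← hex t x hx y hy] at h1 hlt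
          obtain ⟨r, z, c1, c2, c3, c4, c5, c6, c7⟩ := h₂.wit t x hx y hy h1 hlt
          rw [hex t x hx y hy, hex r x c1 z c3, hex r z c3 y c2] at c7
          exact ⟨z, fun _ _ _ _ => ⟨c4, r, c1, c2, c3, c5, c6,
            le_antisymm c7 hG.dist_triangle⟩⟩
        · exact ⟨x, fun t hx hy h1 => absurd ⟨⟨t, hx, hy⟩, h1⟩ hxy⟩
      choose mid hmid using hmid
      exact ⟨mid, fun t x y hx hy h1 => (hmid x y t hx hy h1).2,
        fun t x hx y hy h1 => (hmid x y t hx hy h1).1⟩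

end Dist

/-! ### Classes -/

section ClassesCmd

variable {n L l S : ℕ} {es : List (Fin n × Fin n)} {ts : List (Fin L × Fin L)}
  {bs : Fin L → List (Fin n)}

/-- The position of class `c` in the concatenation of the classes. -/
def start (lst : ℕ → List (Fin n)) (c : ℕ) : ℕ := ∑ j ∈ Finset.range c, (lst j).length

theorem start_succ (lst : ℕ → List (Fin n)) (c : ℕ) :
    start lst (c + 1) = start lst c + (lst c).length := Finset.sum_range_succ _ _

theorem start_mono (lst : ℕ → List (Fin n)) : Monotone (start lst) :=
  monotone_nat_of_le_succ fun c => by rw [start_succ]; omega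

theorem start_update (lst : ℕ → List (Fin n)) (xs : List (Fin n)) {c c' : ℕ} (h : c' ≤ c) :
    start (Function.update lst c xs) c' = start lst c' :=
  Finset.sum_congr rfl fun j hj => by
    rw [Function.update_of_ne (by have := Finset.mem_range.1 hj; omega)]

/-- The arrays hold the classes `lst c` of the nodes `nd c`, for `c < m`. -/
structure Held (S m : ℕ) (nd : ℕ → Fin L) (lst : ℕ → List (Fin n)) (tail : ℕ)
    (cst que comp : ℕ → ℕ) : Prop where
  tail_eq : tail = start lst m
  cst_eq : ∀ c < m, cst c = start lst c
  que_eq : ∀ c < m, ∀ i (h : i < (lst c).length), que (start lst c + i) = ((lst c)[i] : ℕ)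
  comp_mem : ∀ c < m, ∀ x ∈ lst c, comp (nd c * S + x) = c + 1
  comp_zero : ∀ (t : Fin L) (x : Fin n), comp (t * S + x) = 0 ∨ ∃ c < m, nd c = t ∧ x ∈ lst c
  nodup : ∀ c < m, (lst c).Nodup

theorem Held.unique {m tail : ℕ} {nd : ℕ → Fin L} {lst : ℕ → List (Fin n)} {cst que comp : ℕ → ℕ}
    (h : Held S m nd lst tail cst que comp) {c c' : ℕ} (hc : c < m) (hc' : c' < m)
    (hnd : nd c = nd c') {x : Fin n} (hx : x ∈ lst c) (hx' : x ∈ lst c') : c = c' := by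
  have h1 := h.comp_mem c hc x hx
  have h2 := h.comp_mem c' hc' x hx'
  rw [hnd] at h1
  omega

theorem Held.open {m tail : ℕ} {nd : ℕ → Fin L} {lst : ℕ → List (Fin n)} {cst que comp : ℕ → ℕ}
    (h : Held S m nd lst tail cst que comp) (t : Fin L) :
    Held S (m + 1) (Function.update nd m t) (Function.update lst m []) tail
      (Function.update cst m tail) que comp := by
  have hlt : ∀ {c}, c < m + 1 → c ≠ m → c < m := fun h1 h2 => by omega
  refine ⟨?_, fun c hc => ?_, fun c hc i hi => ?_, fun c hc x hx => ?_, fun t' x => ?_,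
    fun c hc => ?_⟩
  · rw [start_succ, start_update _ _ le_rfl, h.tail_eq]; simp
  · rw [start_update _ _ (by omega)]
    by_cases hcm : c = m
    · subst hcm; simp [h.tail_eq]
    · rw [Function.update_of_ne hcm, h.cst_eq c (hlt hc hcm)]
  · rw [start_update _ _ (by omega)]
    by_cases hcm : c = m
    · subst hcm; simp at hi
    · simp only [Function.update_of_ne hcm] at hi ⊢
      exact h.que_eq c (hlt hc hcm) i hi
  · by_cases hcm : c = m
    · subst hcm; simp at hx
    · simp only [Function.update_of_ne hcm] at hx ⊢
      exact h.comp_mem c (hlt hc hcm) x hx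
  · refine (h.comp_zero t' x).imp_right ?_
    rintro ⟨c, hc, h1, h2⟩
    exact ⟨c, by omega, by rwa [Function.update_of_ne (by omega)],
      by rwa [Function.update_of_ne (by omega)]⟩
  · by_cases hcm : c = m
    · subst hcm; simp
    · simp only [Function.update_of_ne hcm]
      exact h.nodup c (hlt hc hcm)

theorem Held.push {c tail : ℕ} {nd : ℕ → Fin L} {lst : ℕ → List (Fin n)} {xs : List (Fin n)}
    {cst que comp : ℕ → ℕ} (hS : n ≤ S)
    (h : Held S (c + 1) nd (Function.update lst c xs) tail cst que comp) {y : Fin n}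
    (hy : comp (nd c * S + y) = 0) :
    Held S (c + 1) nd (Function.update lst c (xs ++ [y])) (tail + 1) cst
      (Function.update que tail y) (Function.update comp (nd c * S + y) (c + 1)) := by
  have hlt : ∀ {c'}, c' < c + 1 → c' ≠ c → c' < c := fun h1 h2 => by omega
  have hS' : ∀ x : Fin n, (x : ℕ) < S := fun x => by have := x.2; omega
  have htail : tail = start lst c + xs.length := by
    rw [h.tail_eq, start_succ, start_update _ _ le_rfl, Function.update_self]
  have hnot : ∀ c' < c + 1, nd c' = nd c → y ∉ Function.update lst c xs c' := by
    intro c' hc' hnd hmem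
    have := h.comp_mem c' hc' y hmem
    rw [hnd] at this
    omega
  have hold : ∀ c' < c + 1, ∀ x ∈ Function.update lst c xs c', ¬ (nd c' = nd c ∧ x = y) := by
    rintro c' hc' x hx ⟨h1, rfl⟩
    exact hnot c' hc' h1 hx
  have hcomp : ∀ (t : Fin L) (x : Fin n),
      Function.update comp (nd c * S + y) (c + 1) (t * S + x) =
        if t = nd c ∧ x = y then c + 1 else comp (t * S + x) := by
    intro t x
    rw [update_stride _ (hS' y) (hS' x)]
    simp only [Fin.ext_iff]
  refine ⟨?_, fun c' hc' => ?_, fun c' hc' i hi => ?_, fun c' hc' x hx => ?_, fun t' x => ?_,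
    fun c' hc' => ?_⟩
  · rw [start_succ, start_update _ _ le_rfl, htail]; simp; omega
  · rw [h.cst_eq c' hc', start_update _ _ (by omega), start_update _ _ (by omega)]
  · have hq := h.que_eq c' hc' i
    rw [start_update _ _ (by omega)] at hq ⊢
    by_cases hcm : c' = c
    · subst hcm
      simp only [Function.update_self, List.length_append, List.length_singleton] at hi hq ⊢
      by_cases hi' : i = xs.length
      · subst hi'; simp [htail]
      · have hi2 : i < xs.length := by omega
        rw [Function.update_of_ne (by omega), hq hi2, List.getElem_append_left hi2]
    · simp only [Function.update_of_ne hcm] at hi hq ⊢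
      rw [Function.update_of_ne, hq hi]
      have := start_mono lst (show c' + 1 ≤ c by have := hlt hc' hcm; omega)
      rw [start_succ] at this
      omega
  · rw [hcomp]
    by_cases hcm : c' = c
    · subst hcm
      rw [Function.update_self, List.mem_append, List.mem_singleton] at hx
      rcases hx with hx | rfl
      · have hx' : x ∈ Function.update lst c' xs c' := by rwa [Function.update_self]
        rw [if_neg (hold c' hc' x hx'), h.comp_mem c' hc' x hx']
      · simp
    · have hx' : x ∈ Function.update lst c xs c' := by
        rwa [Function.update_of_ne hcm] at hx ⊢
      rw [if_neg (hold c' hc' x hx'), h.comp_mem c' hc' x hx']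
  · rw [hcomp]
    split_ifs with hty
    · exact Or.inr ⟨c, by omega, hty.1.symm, by simp [hty.2]⟩
    · refine (h.comp_zero t' x).imp_right ?_
      rintro ⟨c', hc', h1, h2⟩
      refine ⟨c', hc', h1, ?_⟩
      by_cases hcm : c' = c
      · subst hcm
        rw [Function.update_self] at h2 ⊢
        exact List.mem_append_left _ h2
      · rwa [Function.update_of_ne hcm] at h2 ⊢
  · have hnd := h.nodup c' hc'
    by_cases hcm : c' = c
    · subst hcm
      have hy' := hnot c' hc' rfl
      rw [Function.update_self] at hnd hy' ⊢
      rw [List.nodup_append]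
      refine ⟨hnd, by simp, ?_⟩
      rintro a ha b hb rfl
      exact hy' (List.mem_singleton.1 hb ▸ ha)
    · rwa [Function.update_of_ne hcm] at hnd ⊢

/-- Any two elements of `xs` are joined by a sequence in `xs` with jumps of length at most `l`. -/
def Chained (G : SimpleGraph (Fin n)) (l : ℕ) (xs : List (Fin n)) : Prop :=
  ∀ x ∈ xs, ∀ y ∈ xs, Relation.ReflTransGen (fun a b => a ∈ xs ∧ b ∈ xs ∧ G.dist a b ≤ l) x y

theorem Chained.append {G : SimpleGraph (Fin n)} {xs : List (Fin n)} (h : Chained G l xs)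
    {u y : Fin n} (hu : u ∈ xs) (huy : G.dist u y ≤ l) : Chained G l (xs ++ [y]) := by
  have hmono : ∀ a ∈ xs, ∀ b ∈ xs, Relation.ReflTransGen
      (fun a b => a ∈ xs ++ [y] ∧ b ∈ xs ++ [y] ∧ G.dist a b ≤ l) a b := fun a ha b hb =>
    Relation.ReflTransGen.mono (fun _ _ hab =>
      ⟨List.mem_append_left _ hab.1, List.mem_append_left _ hab.2.1, hab.2.2⟩) _ _ (h a ha b hb)
  have hu' : u ∈ xs ++ [y] := List.mem_append_left _ hu
  have hy' : y ∈ xs ++ [y] := by simp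
  intro a ha b hb
  rw [List.mem_append, List.mem_singleton] at ha hb
  rcases ha with ha | rfl <;> rcases hb with hb | rfl
  · exact hmono a ha b hb
  · exact (hmono a ha u hu).tail ⟨hu', hy', huy⟩
  · exact (hmono u hu b hb).head ⟨hy', hu', by rwa [SimpleGraph.dist_comm]⟩
  · exact .refl

/-- `xs` lists a class of node `t`. -/
structure IsClass {G : SimpleGraph (Fin n)} (D : TreeDecomposition G (Fin L)) (l : ℕ) (t : Fin L)
    (xs : List (Fin n)) : Prop where
  nonempty : xs ≠ []
  subset : ∀ x ∈ xs, x ∈ D.bag t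
  closed : ∀ x ∈ xs, ∀ y ∈ D.bag t, G.dist x y ≤ l → y ∈ xs
  chain : Chained G l xs

/-- Class `c`, with the elements `xs` found so far, is being built; the first `p` elements of `xs`
have been processed. -/
structure Growing {G : SimpleGraph (Fin n)} (D : TreeDecomposition G (Fin L)) (l S c : ℕ)
    (nd : ℕ → Fin L) (lst : ℕ → List (Fin n)) (xs : List (Fin n)) (p : ℕ) (s : Store Arr) :
    Prop where
  vnc : s.v .nc = c + 1
  held : Held S (c + 1) nd (Function.update lst c xs) (s.v .tail) (s.a .cst) (s.a .que) (s.a .comp)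
  good : ∀ c' < c, IsClass D l (nd c') (lst c')
  subset : ∀ x ∈ xs, x ∈ D.bag (nd c)
  chain : Chained G l xs
  le : p ≤ xs.length
  closed : ∀ i (h : i < xs.length), i < p → ∀ y ∈ D.bag (nd c), G.dist xs[i] y ≤ l → y ∈ xs

theorem Growing.of_frame {G : SimpleGraph (Fin n)} {D : TreeDecomposition G (Fin L)} {c : ℕ}
    {nd : ℕ → Fin L} {lst : ℕ → List (Fin n)} {xs : List (Fin n)} {p : ℕ} {s s' : Store Arr}
    (h : Growing D l S c nd lst xs p s) (h1 : s'.v .nc = s.v .nc) (h2 : s'.v .tail = s.v .tail)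
    (h3 : s'.a = s.a) : Growing D l S c nd lst xs p s' :=
  ⟨h1.trans h.vnc, by rw [h2, h3]; exact h.held, h.good, h.subset, h.chain, h.le, h.closed⟩

/-- The delicate case is a vertex `y` near `u` that is already assigned. It cannot belong to an
earlier class of the same node, since that class is closed and would contain `u` as well, so it is
in the current class. -/
theorem joinStep_spec {G : SimpleGraph (Fin n)} {D : TreeDecomposition G (Fin L)} {s : Store Arr}
    (hB : Base l S es ts bs s) {c p : ℕ} {nd : ℕ → Fin L} {lst : ℕ → List (Fin n)}
    {xs : List (Fin n)} (h : Growing D l S c nd lst xs p s)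
    (hdist : ∀ t, ∀ x ∈ D.bag t, ∀ y ∈ D.bag t, vmat n S (s.a .dist) x y = G.dist x y)
    {u y : Fin n} (hu : u ∈ xs) (hy : y ∈ D.bag (nd c)) (hvu : s.v .u = u) (hvy : s.v .y = y)
    (hvt : s.v .t = nd c) :
    Spec (.ite (.get .comp (cell Var.t Var.y)) 1
      (.ite Var.l (.get .dist (cell Var.u Var.y)) .skip
        (.put .comp (cell Var.t Var.y) Var.nc ;; .put .que Var.tail Var.y ;;
          .set .tail (Var.tail + 1))) .skip) s
      (fun s' => ∃ xs', xs <+: xs' ∧ Growing D l S c nd lst xs' p s' ∧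
        (G.dist u y ≤ l → y ∈ xs')) 5 := by
  have hd : s.a .dist (u * S + y) = G.dist u y := hdist _ u (h.subset u hu) y hy
  refine (Spec.ite (T := 4) (fun hlt => ?_) (fun hlt => ?_)).weaken (by norm_num)
  · simp only [eval_get, eval_cell, eval_var, eval_one, hvt, hvy, hB.row_node, Nat.lt_one_iff] at hlt
    refine (Spec.ite (T := 3) (fun hlt' => ?_) (fun hlt' => ?_)).weaken (by norm_num)
    · refine (Spec.skip ⟨xs, List.prefix_rfl, h, fun hle => ?_⟩).weaken (by norm_num)
      simp only [eval_get, eval_cell, eval_var, hvu, hvy, hB.row_fin, hd, hB.vl] at hlt'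
      omega
    · simp only [eval_get, eval_cell, eval_var, hvu, hvy, hB.row_fin, hd, hB.vl] at hlt'
      have hle : G.dist u y ≤ l := by omega
      have hp := h.held.push hB.n_le hlt
      refine ⟨⟨xs ++ [y], List.prefix_append _ _, ⟨?_, ?_, h.good, ?_, h.chain.append hu hle,
        by simpa using Nat.le_succ_of_le h.le, ?_⟩,
        by simp⟩, le_rfl⟩
      · simp [Cmd.run, Store.setV_v, h.vnc]
      · simpa [Cmd.run, Store.setV_v, Store.setA_a, hvt, hvy, hB.row_node, h.vnc] using hp
      · intro x hx
        rw [List.mem_append, List.mem_singleton] at hx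
        rcases hx with hx | rfl
        · exact h.subset x hx
        · exact hy
      · intro i hi hip z hz hle'
        have hi' : i < xs.length := hip.trans_le h.le
        rw [List.getElem_append_left hi'] at hle'
        exact List.mem_append_left _ (h.closed i hi' hip z hz hle')
  · refine (Spec.skip ⟨xs, List.prefix_rfl, h, fun hle => ?_⟩).weaken (by norm_num)
    simp only [eval_get, eval_cell, eval_var, eval_one, hvt, hvy, hB.row_node] at hlt
    rcases h.held.comp_zero (nd c) y with h0 | ⟨c', hc', hnd, hmem⟩
    · omega
    · by_cases hcc : c' = c
      · subst hcc; rwa [Function.update_self] at hmem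
      · rw [Function.update_of_ne hcc] at hmem
        have hc2 : c' < c := by omega
        have hu' : u ∈ lst c' := (h.good c' hc2).closed y hmem u (hnd ▸ h.subset u hu)
          (by rwa [SimpleGraph.dist_comm])
        exact absurd (h.held.unique hc' (by omega) hnd (x := u)
          (by rwa [Function.update_of_ne hcc]) (by rwa [Function.update_self])) hcc

theorem growCmd_spec {G : SimpleGraph (Fin n)} {D : TreeDecomposition G (Fin L)}
    (hbs : IsBagList D.bag bs) {k : ℕ} (hk : ∀ t, (bs t).length ≤ k) {s : Store Arr}
    (hB : Base l S es ts bs s) {c p : ℕ} {nd : ℕ → Fin L} {lst : ℕ → List (Fin n)}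
    {xs : List (Fin n)} (h : Growing D l S c nd lst xs p s)
    (hdist : ∀ t, ∀ x ∈ D.bag t, ∀ y ∈ D.bag t, vmat n S (s.a .dist) x y = G.dist x y)
    (hvt : s.v .t = nd c) (hhd : s.v .hd = start lst c + p) :
    Spec growCmd s (fun s' => ∃ xs' p', xs <+: xs' ∧ Growing D l S c nd lst xs' p' s' ∧
      s'.v .hd = start lst c + p' ∧ (p < p' ∧ p < xs.length ∨ p' = xs'.length)) (4 + k * 7) := by
  have htail : s.v .tail = start lst c + xs.length := by
    rw [h.held.tail_eq, start_succ, start_update _ _ le_rfl, Function.update_self]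
  refine (Spec.ite (T := 3 + k * 7) (fun hlt => ?_) (fun hlt => ?_)).weaken (by omega)
  · simp only [eval_var, hhd, htail] at hlt
    have hp : p < xs.length := by omega
    have hq : s.a .que (start lst c + p) = (xs[p] : ℕ) := by
      have := h.held.que_eq c (by omega) p (by simpa using hp)
      simpa [start_update] using this
    refine (Spec.set_seq (Spec.set_seq (T := 1 + k * (5 + 2)) ?_)).weaken (by omega)
    set s₁ : Store Arr := Store.setV _ _ _ with hs₁
    have hB₁ : Base l S es ts bs s₁ := (hB.setV .u _ rfl).setV .hd _ rfl
    have hu₁ : s₁.v .u = (xs[p] : ℕ) := by simp [hs₁, Store.setV_v, hhd, hq]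
    have hhd₁ : s₁.v .hd = start lst c + (p + 1) := by simp [hs₁, Store.setV_v, hhd, add_assoc]
    have h₁ : Growing D l S c nd lst xs p s₁ :=
      h.of_frame (by simp [hs₁, Store.setV_v]) (by simp [hs₁, Store.setV_v]) rfl
    have hbag : ∀ x, x ∈ bs (nd c) ↔ x ∈ D.bag (nd c) := fun x => (hbs _).2 x
    refine (bagLoop_spec hB₁ (t := nd c) (tv := .t) (iv := .j) (xv := .y)
      (by simp [hs₁, Store.setV_v, hvt]) (hk _) (fun j s' => ∃ xs', xs <+: xs' ∧
        Growing D l S c nd lst xs' p s' ∧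
        ∀ y ∈ (bs (nd c)).take j, G.dist xs[p] y ≤ l → y ∈ xs')
      ⟨xs, List.prefix_rfl, h₁, by simp⟩ rfl rfl ?_).imp ?_
    · rintro j hj s₂ ⟨xs', hpre, h₂, hcl⟩ hf₂ hB₂
      refine (joinStep_spec hB₂ (u := xs[p]) (y := (bs (nd c))[j]) (xs := xs') (c := c) (p := p)
        (nd := nd) (lst := lst)
        (h₂.of_frame (by simp [Store.setV_v]) (by simp [Store.setV_v]) rfl) ?_
        (hpre.subset (List.getElem_mem hp)) ((hbag _).1 (List.getElem_mem hj)) ?_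
        (by simp [Store.setV_v]) ?_).imp ?_
      · simp only [Store.setV_a, hf₂.a .dist rfl]; exact hdist
      · simp [Store.setV_v, hf₂.v .u rfl, hu₁]
      · simp [Store.setV_v, hf₂.v .t rfl, hs₁, hvt]
      · rintro s₃ ⟨xs'', hpre', h₃, hcl'⟩ -
        refine ⟨xs'', hpre.trans hpre', h₃, fun y hy hle => ?_⟩
        rw [mem_take_succ hj] at hy
        rcases hy with hy | rfl
        · exact hpre'.subset (hcl y hy hle)
        · exact hcl' hle
    · rintro s₂ ⟨xs', hpre, h₂, hcl⟩ hf₂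
      rw [List.take_length] at hcl
      refine ⟨xs', p + 1, hpre, ⟨h₂.vnc, h₂.held, h₂.good, h₂.subset, h₂.chain,
        hp.trans_le hpre.length_le, fun i hi hip y hy hle => ?_⟩, ?_, Or.inl ⟨by omega, hp⟩⟩
      · by_cases hi' : i = p
        · subst hi'
          rw [← hpre.getElem hp] at hle
          exact hcl y ((hbag y).2 hy) hle
        · exact h₂.closed i hi (by omega) y hy hle
      · rw [hf₂.v .hd rfl, hhd₁]
  · simp only [eval_var, hhd, htail] at hlt
    refine (Spec.skip ⟨xs, p, List.prefix_rfl, h, hhd, Or.inr ?_⟩).weaken (by omega)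
    have := h.le
    omega

/-- Each round processes one more element or finds the queue empty. The class has no repetitions and
lies in the bag, so the size of the bag is enough rounds. -/
theorem growLoop_spec {G : SimpleGraph (Fin n)} {D : TreeDecomposition G (Fin L)}
    (hbs : IsBagList D.bag bs) {k : ℕ} (hk : ∀ t, (bs t).length ≤ k) {s : Store Arr}
    (hB : Base l S es ts bs s) {c : ℕ} {nd : ℕ → Fin L} {lst : ℕ → List (Fin n)}
    {xs : List (Fin n)} (hxs : xs ≠ []) (h : Growing D l S c nd lst xs 0 s)
    (hdist : ∀ t, ∀ x ∈ D.bag t, ∀ y ∈ D.bag t, vmat n S (s.a .dist) x y = G.dist x y)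
    (hvt : s.v .t = nd c) (hhd : s.v .hd = start lst c) :
    Spec (.loop .f (.get .bsz Var.t) growCmd) s (fun s' => ∃ xs', xs <+: xs' ∧
      s'.v .nc = c + 1 ∧ IsClass D l (nd c) xs' ∧
      Held S (c + 1) nd (Function.update lst c xs') (s'.v .tail) (s'.a .cst) (s'.a .que)
        (s'.a .comp)) (1 + k * (5 + k * 7)) := by
  refine ((Spec.loop (b := (bs (nd c)).length) (T := 4 + k * 7) (fun f (s' : Store Arr) =>
    ∃ xs' p, xs <+: xs' ∧ Growing D l S c nd lst xs' p s' ∧ s'.v .hd = start lst c + p ∧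
      (f ≤ p ∨ p = xs'.length)) ?_ ⟨xs, 0, List.prefix_rfl, h, hhd, Or.inl le_rfl⟩ ?_).imp
        ?_).weaken ?_
  · rw [eval_get, eval_var, hvt]; exact hB.bsz _
  · rintro f hf s₁ ⟨xs₁, p, hpre, h₁, hhd₁, hp⟩ hf₁
    refine (growCmd_spec hbs hk ((hB.of_frame hf₁ rfl).setV .f f rfl) (h₁.of_frame
      (by simp [Store.setV_v]) (by simp [Store.setV_v]) rfl) ?_ ?_ ?_).imp ?_
    · simp only [Store.setV_a, hf₁.a .dist rfl]; exact hdist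
    · simp [Store.setV_v, hf₁.v .t rfl, hvt]
    · simp [Store.setV_v, hhd₁]
    · rintro s₂ ⟨xs₂, p₂, hpre', h₂, hhd₂, hp₂⟩ -
      refine ⟨xs₂, p₂, hpre.trans hpre', h₂, hhd₂, ?_⟩
      have := h₂.le
      have := hpre'.length_le
      omega
  · rintro s₁ ⟨xs₁, p, hpre, h₁, -, hp⟩ -
    have hnd := h₁.held.nodup c (by omega)
    rw [Function.update_self] at hnd
    have hlen : xs₁.length ≤ (bs (nd c)).length := by
      refine (List.subperm_of_subset hnd fun x hx => ((hbs _).2 x).2 (h₁.subset x hx)).length_le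
    have hp' : xs₁.length ≤ p := by omega
    refine ⟨xs₁, hpre, h₁.vnc, ⟨?_, h₁.subset, fun x hx y hy hle => ?_, h₁.chain⟩, h₁.held⟩
    · rintro rfl; exact hxs (List.prefix_nil.1 hpre)
    · obtain ⟨i, hi, rfl⟩ := List.getElem_of_mem hx
      exact h₁.closed i hi (by omega) y hy hle
  · exact Nat.add_le_add_left (Nat.mul_le_mul (hk _) (by omega)) _

/-- The classes `lst c` of the nodes `nd c`, for `c < m`, have been built. -/
structure Built {G : SimpleGraph (Fin n)} (D : TreeDecomposition G (Fin L)) (l S m : ℕ)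
    (nd : ℕ → Fin L) (lst : ℕ → List (Fin n)) (s : Store Arr) : Prop where
  vnc : s.v .nc = m
  held : Held S m nd lst (s.v .tail) (s.a .cst) (s.a .que) (s.a .comp)
  good : ∀ c < m, IsClass D l (nd c) (lst c)

theorem Built.of_frame {G : SimpleGraph (Fin n)} {D : TreeDecomposition G (Fin L)} {m : ℕ}
    {nd : ℕ → Fin L} {lst : ℕ → List (Fin n)} {s s' : Store Arr} (h : Built D l S m nd lst s)
    (h1 : s'.v .nc = s.v .nc) (h2 : s'.v .tail = s.v .tail) (h3 : s'.a = s.a) :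
    Built D l S m nd lst s' :=
  ⟨h1.trans h.vnc, by rw [h2, h3]; exact h.held, h.good⟩

theorem classStep_spec {G : SimpleGraph (Fin n)} {D : TreeDecomposition G (Fin L)}
    (hbs : IsBagList D.bag bs) {k : ℕ} (hk : ∀ t, (bs t).length ≤ k) {s : Store Arr}
    (hB : Base l S es ts bs s) {m : ℕ} {nd : ℕ → Fin L} {lst : ℕ → List (Fin n)}
    (h : Built D l S m nd lst s)
    (hdist : ∀ t, ∀ x ∈ D.bag t, ∀ y ∈ D.bag t, vmat n S (s.a .dist) x y = G.dist x y)
    {t : Fin L} {x : Fin n} (hx : x ∈ D.bag t) (hvt : s.v .t = t) (hvx : s.v .x = x) :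
    Spec (.ite (.get .comp (cell Var.t Var.x)) 1
      (.put .cst Var.nc Var.tail ;; .set .nc (Var.nc + 1) ;;
        .put .comp (cell Var.t Var.x) Var.nc ;; .put .que Var.tail Var.x ;; .set .hd Var.tail ;;
        .set .tail (Var.tail + 1) ;; .loop .f (.get .bsz Var.t) growCmd) .skip) s
      (fun s' => ∃ m' nd' lst', Built D l S m' nd' lst' s' ∧
        (∀ t x, (∃ c < m, nd c = t ∧ x ∈ lst c) → ∃ c < m', nd' c = t ∧ x ∈ lst' c) ∧
        ∃ c < m', nd' c = t ∧ x ∈ lst' c) (8 + k * (5 + k * 7)) := by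
  refine (Spec.ite (T := 7 + k * (5 + k * 7)) (fun hlt => ?_) (fun hlt => ?_)).weaken (by omega)
  · simp only [eval_get, eval_cell, eval_var, eval_one, hvt, hvx, hB.row_node, Nat.lt_one_iff] at hlt
    have ho := h.held.open t
    have hp := ho.push hB.n_le (y := x) (by simpa using hlt)
    simp only [Function.update_self, List.nil_append] at hp
    refine (Spec.put_seq (Spec.set_seq (Spec.put_seq (Spec.put_seq (Spec.set_seq (Spec.set_seq
      (T := 1 + k * (5 + k * 7)) ?_)))))).weaken (by omega)
    set s₁ : Store Arr := Store.setV _ _ _ with hs₁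
    have hB₁ : Base l S es ts bs s₁ := ((((((hB.setA .cst _ _ rfl).setV .nc _ rfl).setA .comp _ _
      rfl).setA .que _ _ rfl).setV .hd _ rfl).setV .tail _ rfl)
    have h₁ : Growing D l S m (Function.update nd m t) lst [x] 0 s₁ := by
      refine ⟨by simp [hs₁, Store.setV_v, h.vnc], ?_, fun c hc => ?_, ?_, ?_, Nat.zero_le _,
        fun _ _ hi => absurd hi (Nat.not_lt_zero _)⟩
      · simpa [hs₁, Store.setV_v, Store.setA_a, hvt, hvx, hB.row_node, h.vnc] using hp
      · rw [Function.update_of_ne (by omega)]; exact h.good c hc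
      · simpa using hx
      · intro a ha b hb
        rw [List.mem_singleton] at ha hb
        subst ha; subst hb
        exact .refl
    refine (growLoop_spec hbs hk hB₁ (by simp) h₁ ?_ (by simp [hs₁, Store.setV_v, hvt]) ?_).imp ?_
    · have : s₁.a .dist = s.a .dist := by simp [hs₁, Store.setA_a]
      rw [this]; exact hdist
    · simp [hs₁, Store.setV_v, h.held.tail_eq]
    · rintro s₂ ⟨xs, hpre, hnc, hcls, hheld⟩ -
      refine ⟨m + 1, _, _, ⟨hnc, hheld, fun c hc => ?_⟩, fun t' x' => ?_, m, by omega, by simp, ?_⟩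
      · by_cases hcm : c = m
        · subst hcm; simpa using hcls
        · rw [Function.update_of_ne hcm, Function.update_of_ne hcm]
          exact h.good c (by omega)
      · rintro ⟨c, hc, h1, h2⟩
        exact ⟨c, by omega, by rwa [Function.update_of_ne (by omega)],
          by rwa [Function.update_of_ne (by omega)]⟩
      · rw [Function.update_self]; exact hpre.subset (by simp)
  · simp only [eval_get, eval_cell, eval_var, eval_one, hvt, hvx, hB.row_node] at hlt
    refine (Spec.skip ⟨m, nd, lst, h, fun _ _ h => h, ?_⟩).weaken (by omega)
    exact (h.held.comp_zero t x).resolve_left (by omega)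

/-- The classes as they stand in the arrays. -/
structure HoldsClasses {G : SimpleGraph (Fin n)} {D : TreeDecomposition G (Fin L)} {m : ℕ}
    (K : Classes D l (Fin m)) (S : ℕ) (lst : Fin m → List (Fin n)) (s : Store Arr) : Prop where
  vnc : s.v .nc = m
  isList : IsBagList K.cls lst
  cst_zero : s.a .cst 0 = 0
  cst_succ : ∀ c : Fin m, s.a .cst (c + 1) = s.a .cst c + (lst c).length
  que_eq : ∀ (c : Fin m) (i : ℕ) (h : i < (lst c).length),
    s.a .que (s.a .cst c + i) = ((lst c)[i] : ℕ)
  comp_eq : ∀ (c : Fin m), ∀ x ∈ K.cls c, s.a .comp (K.node c * S + x) = c + 1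
  comp_zero : ∀ (t : Fin L), ∀ x ∉ D.bag t, s.a .comp (t * S + x) = 0

theorem Built.holdsClasses {G : SimpleGraph (Fin n)} {D : TreeDecomposition G (Fin L)}
    {m : ℕ} {nd : ℕ → Fin L} {lst : ℕ → List (Fin n)} {s : Store Arr}
    (h : Built D l S m nd lst s) (hcov : ∀ t, ∀ x ∈ D.bag t, ∃ c < m, nd c = t ∧ x ∈ lst c) :
    ∃ (K : Classes D l (Fin m)) (lst : Fin m → List (Fin n)),
      HoldsClasses K S lst (s.setA .cst (s.v .nc) (s.v .tail)) := by
  refine ⟨{ node := fun c => nd c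
            cls := fun c => (lst c).toFinset
            subset := fun c x hx => (h.good c c.2).subset x (List.mem_toFinset.1 hx)
            nonempty := fun c => by
              rw [List.toFinset_nonempty_iff]; exact (h.good c c.2).nonempty
            cover := fun t x hx => ?_
            unique := fun c c' x hnd hx hx' => Fin.ext (h.held.unique c.2 c'.2 hnd
              (List.mem_toFinset.1 hx) (List.mem_toFinset.1 hx'))
            closed := fun c x hx y hy hle => List.mem_toFinset.2
              ((h.good c c.2).closed x (List.mem_toFinset.1 hx) y hy hle)
            chain := fun c x hx y hy => by
              have := (h.good c c.2).chain x (List.mem_toFinset.1 hx) y (List.mem_toFinset.1 hy)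
              simpa only [List.mem_toFinset] using this }, fun c => lst c, ?_⟩
  · obtain ⟨c, hc, hnd, hmem⟩ := hcov t x hx
    exact ⟨⟨c, hc⟩, hnd, List.mem_toFinset.2 hmem⟩
  · have hcst : ∀ c ≤ m, (s.setA .cst (s.v .nc) (s.v .tail)).a .cst c = start lst c := by
      intro c hc
      simp only [Store.setA_a, if_true, h.vnc, h.held.tail_eq, Function.update_apply]
      split_ifs with hcm
      · rw [hcm]
      · exact h.held.cst_eq c (by omega)
    refine ⟨h.vnc, fun c => ⟨h.held.nodup c c.2, fun x => by simp⟩, hcst 0 (Nat.zero_le _),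
      fun c => ?_, fun c i hi => ?_, fun c x hx => ?_, fun t x hx => ?_⟩
    · rw [hcst _ c.2, hcst _ c.2.le, start_succ]
    · rw [hcst _ c.2.le]
      exact h.held.que_eq c c.2 i hi
    · exact h.held.comp_mem c c.2 x (List.mem_toFinset.1 hx)
    · refine (h.held.comp_zero t x).resolve_right ?_
      rintro ⟨c, hc, rfl, hmem⟩
      exact hx ((h.good c hc).subset x hmem)

theorem classesCmd_spec {G : SimpleGraph (Fin n)} {D : TreeDecomposition G (Fin L)}
    (hbs : IsBagList D.bag bs) {k : ℕ} (hk : ∀ t, (bs t).length ≤ k) {s : Store Arr}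
    (hB : Base l S es ts bs s) (hcomp : s.a .comp = fun _ => 0) (t₀ : Fin L)
    (hdist : ∀ t, ∀ x ∈ D.bag t, ∀ y ∈ D.bag t, vmat n S (s.a .dist) x y = G.dist x y) :
    Spec classesCmd s (fun s' => ∃ (m : ℕ) (K : Classes D l (Fin m)) (lst : Fin m → List (Fin n)),
      HoldsClasses K S lst s') (4 + L * (2 + k * (10 + k * (5 + k * 7)))) := by
  refine (Spec.set_seq (Spec.set_seq (Spec.seq (T := 1 + L * ((1 + k * ((8 + k * (5 + k * 7)) + 2))
    + 1)) (U := 1) (P := fun s' => ∃ m nd lst, Built D l S m nd lst s' ∧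
      ∀ t, ∀ x ∈ D.bag t, ∃ c < m, nd c = t ∧ x ∈ lst c) ?_ ?_))).weaken ?_
  · set s₀ : Store Arr := Store.setV _ _ _ with hs₀
    have hB₀ : Base l S es ts bs s₀ := (hB.setV .nc _ rfl).setV .tail _ rfl
    refine (Spec.loop (b := L) (fun t (s' : Store Arr) => ∃ m nd lst, Built D l S m nd lst s' ∧
      ∀ t' : Fin L, t' < t → ∀ x ∈ D.bag t', ∃ c < m, nd c = t' ∧ x ∈ lst c) (by exact hB₀.vL)
      ⟨0, fun _ => t₀, fun _ => [], ⟨by simp [hs₀, Store.setV_v], ?_, by simp⟩, by simp⟩ ?_).imp ?_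
    · exact ⟨by simp [hs₀, Store.setV_v, start], by simp, by simp, by simp,
        fun t x => Or.inl (by simp [hs₀, hcomp]), by simp⟩
    · rintro t ht s₁ ⟨m, nd, lst, h₁, hcov⟩ hf₁
      have hB₁ := (hB₀.of_frame hf₁ rfl).setV .t t rfl
      have hbag : ∀ x, x ∈ bs ⟨t, ht⟩ ↔ x ∈ D.bag ⟨t, ht⟩ := fun x => (hbs _).2 x
      refine (bagLoop_spec hB₁ (t := ⟨t, ht⟩) (tv := .t) (iv := .i) (xv := .x)
        (by simp [Store.setV_v]) (hk _) (fun i s' => ∃ m nd lst, Built D l S m nd lst s' ∧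
          (∀ t' : Fin L, t' < t → ∀ x ∈ D.bag t', ∃ c < m, nd c = t' ∧ x ∈ lst c) ∧
          ∀ x ∈ (bs ⟨t, ht⟩).take i, ∃ c < m, nd c = ⟨t, ht⟩ ∧ x ∈ lst c)
        ⟨m, nd, lst, h₁.of_frame (by simp [Store.setV_v]) (by simp [Store.setV_v]) rfl, hcov,
          by simp⟩ rfl rfl ?_).imp ?_
      · rintro i hi s₂ ⟨m, nd, lst, h₂, hcov₂, hcov₂'⟩ hf₂ hB₂
        refine (classStep_spec hbs hk hB₂ (t := ⟨t, ht⟩) (x := (bs ⟨t, ht⟩)[i]) (h₂.of_frame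
          (by simp [Store.setV_v]) (by simp [Store.setV_v]) rfl) ?_
          ((hbag _).1 (List.getElem_mem hi)) ?_ (by simp [Store.setV_v])).imp ?_
        · simp only [Store.setV_a, hf₂.a .dist rfl, hf₁.a .dist rfl]; exact hdist
        · simp [Store.setV_v, hf₂.v .t rfl]
        · rintro s₃ ⟨m', nd', lst', h₃, hmono, hnew⟩ -
          refine ⟨m', nd', lst', h₃, fun t' ht' x hx => hmono _ _ (hcov₂ t' ht' x hx),
            fun x hx => ?_⟩
          rw [mem_take_succ hi] at hx
          rcases hx with hx | rfl
          · exact hmono _ _ (hcov₂' x hx)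
          · exact hnew
      · rintro s₂ ⟨m, nd, lst, h₂, hcov₂, hcov₂'⟩ -
        rw [List.take_length] at hcov₂'
        refine ⟨m, nd, lst, h₂, fun t' ht' x hx => ?_⟩
        by_cases he : (t' : ℕ) = t
        · obtain rfl : t' = ⟨t, ht⟩ := Fin.ext he
          exact hcov₂' x ((hbag x).2 hx)
        · exact hcov₂ t' (by omega) x hx
    · rintro s₁ ⟨m, nd, lst, h₁, hcov⟩ -
      exact ⟨m, nd, lst, h₁, fun t x hx => hcov t t.2 x hx⟩
  · rintro s₁ ⟨m, nd, lst, h₁, hcov⟩ -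
    obtain ⟨K, lst', hK⟩ := h₁.holdsClasses hcov
    exact Spec.put ⟨m, K, lst', hK⟩
  · apply le_of_eq; ring

/-- The classes of one node are disjoint subsets of its bag. This keeps the total size at `L k`,
although there may be as many as `L k` classes. -/
theorem Classes.sum_card_le {G : SimpleGraph (Fin n)} {D : TreeDecomposition G (Fin L)} {m : ℕ}
    (K : Classes D l (Fin m)) : ∑ c, (K.cls c).card ≤ ∑ t, (D.bag t).card := by
  rw [← Finset.card_sigma, ← Finset.card_sigma]
  refine Finset.card_le_card_of_injOn (fun p => ⟨K.node p.1, p.2⟩) ?_ ?_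
  · rintro ⟨c, x⟩ hx
    simp only [Finset.coe_sigma, Set.mem_sigma_iff, Finset.mem_coe, Finset.mem_univ,
      true_and] at hx ⊢
    exact K.subset c hx
  · rintro ⟨c, x⟩ hx ⟨c', x'⟩ hx' heq
    simp only [Finset.coe_sigma, Set.mem_sigma_iff, Finset.mem_coe, Finset.mem_univ,
      true_and] at hx hx'
    simp only [Sigma.mk.injEq, heq_eq_eq] at heq
    obtain ⟨h1, rfl⟩ := heq
    rw [K.unique c c' x h1 hx hx']

theorem Classes.card_le {G : SimpleGraph (Fin n)} {D : TreeDecomposition G (Fin L)} {m : ℕ}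
    (K : Classes D l (Fin m)) : m ≤ ∑ t, (D.bag t).card := by
  refine le_trans ?_ K.sum_card_le
  calc m = ∑ _c : Fin m, 1 := by simp
    _ ≤ _ := Finset.sum_le_sum fun c _ => (K.nonempty c).card_pos

theorem IsBagList.length_eq {m : ℕ} {X : Fin m → Finset (Fin n)} {bs : Fin m → List (Fin n)}
    (h : IsBagList X bs) (t : Fin m) : (bs t).length = (X t).card := by
  rw [← List.toFinset_card_of_nodup (h t).1]
  congr 1
  ext x
  rw [List.mem_toFinset, (h t).2]

end ClassesCmd

/-! ### Writing the tree -/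

/-- The word `w` has been written to the array `out`. -/
structure Written (w : List ℕ) (op : ℕ) (out : ℕ → ℕ) : Prop where
  op_eq : op = w.length
  out_eq : ∀ i (h : i < w.length), out i = w[i]

theorem Written.push {w : List ℕ} {op : ℕ} {out : ℕ → ℕ} (h : Written w op out) (x : ℕ) :
    Written (w ++ [x]) (op + 1) (Function.update out op x) := by
  refine ⟨by simp [h.op_eq], fun i hi => ?_⟩
  simp only [List.length_append, List.length_singleton] at hi
  by_cases hi' : i = w.length
  · subst hi'; simp [h.op_eq]
  · have hi2 : i < w.length := by omega
    rw [List.getElem_append_left hi2, Function.update_of_ne (by rw [h.op_eq]; exact hi'),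
      h.out_eq i hi2]

/-- A cell for a size that is not yet known: its present content is taken as a provisional entry and
overwritten later by `Written.fill`. -/
theorem Written.reserve {w : List ℕ} {op : ℕ} {out : ℕ → ℕ} (h : Written w op out) :
    Written (w ++ [out op]) (op + 1) out := by
  have := h.push (out op)
  rwa [Function.update_eq_self] at this

theorem Written.fill {w w' : List ℕ} {x op : ℕ} {out : ℕ → ℕ} (h : Written (w ++ x :: w') op out)
    (y : ℕ) : Written (w ++ y :: w') op (Function.update out w.length y) := by
  refine ⟨by simpa using h.op_eq, fun i hi => ?_⟩
  have hq := h.out_eq i (by simpa using hi)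
  by_cases hi' : i = w.length
  · subst hi'; simp
  · rw [Function.update_of_ne hi', hq]
    by_cases hi2 : i < w.length
    · rw [List.getElem_append_left hi2, List.getElem_append_left hi2]
    · obtain ⟨j, rfl⟩ : ∃ j, i = w.length + 1 + j := ⟨i - (w.length + 1), by omega⟩
      simp [List.getElem_append_right, add_assoc, add_comm 1 j]

section TreeOut

variable {n L l S m : ℕ} {es : List (Fin n × Fin n)} {ts : List (Fin L × Fin L)}
  {bs : Fin L → List (Fin n)} {G : SimpleGraph (Fin n)} {D : TreeDecomposition G (Fin L)}

/-- The pairs in `R` have been listed in the output. -/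
def Linked (m S r : ℕ) (R : Fin m → Fin m → Prop) (s : Store Arr) : Prop :=
  ∃ T : List (Fin m × Fin m), T.Nodup ∧ (∀ a b, (a, b) ∈ T ↔ R a b) ∧ s.v .ne = T.length ∧
    Written (m :: r :: T.flatMap fun e => [e.1.val, e.2.val]) (s.v .op) (s.a .out) ∧
    ∀ a b : Fin m, s.a .emat ((a + 1) * S + (b + 1)) < 1 ↔ (a, b) ∉ T

theorem linkStep_spec {K : Classes D l (Fin m)} {lst : Fin m → List (Fin n)} {s : Store Arr}
    (hB : Base l S es ts bs s) (hm : m < S) (hK : HoldsClasses K S lst s) {u v : Fin L} {x : Fin n}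
    (hx : x ∈ D.bag u) {r : ℕ} {R R' : Fin m → Fin m → Prop} (h : Linked m S r R s)
    (hvu : s.v .u = u) (hvv : s.v .v = v) (hvx : s.v .x = x)
    (hR : ∀ a b, R' a b ↔ R a b ∨ (K.node a = u ∧ K.node b = v ∧ x ∈ K.cls a ∧ x ∈ K.cls b)) :
    Spec (.set .y (.get .comp (cell Var.u Var.x)) ;; .set .z (.get .comp (cell Var.v Var.x)) ;;
      .ite 0 Var.z
        (.ite (.get .emat (cell Var.y Var.z)) 1
          (.put .emat (cell Var.y Var.z) 1 ;; .put .out Var.op (Var.y - 1) ;;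
            .put .out (Var.op + 1) (Var.z - 1) ;; .set .op (Var.op + 2) ;; .set .ne (Var.ne + 1))
          .skip) .skip) s (Linked m S r R') 9 := by
  obtain ⟨a, ha, hxa⟩ := K.cover u x hx
  have hya := hK.comp_eq a x hxa
  rw [ha] at hya
  refine (Spec.set_seq (Spec.set_seq (T := 7) ?_)).weaken (by norm_num)
  set s₁ : Store Arr := Store.setV _ _ _ with hs₁
  have hB₁ : Base l S es ts bs s₁ := (hB.setV .y _ rfl).setV .z _ rfl
  have hy₁ : s₁.v .y = a + 1 := by
    simp [hs₁, Store.setV_v, hvu, hvx, hB.row_node, hya]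
  have hz₁ : s₁.v .z = s.a .comp (v * S + x) := by
    simp [hs₁, Store.setV_v, hvv, hvx, hB.row_node]
  obtain ⟨T, hT1, hT2, hT3, hT4, hT5⟩ := h
  have hne₁ : s₁.v .ne = T.length := by simpa [hs₁, Store.setV_v] using hT3
  have hW₁ : Written (m :: r :: T.flatMap fun e => [e.1.val, e.2.val]) (s₁.v .op) (s₁.a .out) := by
    simpa [hs₁, Store.setV_v] using hT4
  have hE₁ : ∀ a b : Fin m, s₁.a .emat ((a + 1) * S + (b + 1)) < 1 ↔ (a, b) ∉ T := hT5
  refine (Spec.ite (T := 6) (fun hlt => ?_) (fun hlt => ?_)).weaken (by norm_num)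
  · simp only [eval_zero, eval_var, hz₁] at hlt
    have hxv : x ∈ D.bag v := by
      by_contra hxv
      rw [hK.comp_zero v x hxv] at hlt
      omega
    obtain ⟨b, hb, hxb⟩ := K.cover v x hxv
    have hzb := hK.comp_eq b x hxb
    rw [hb] at hzb
    rw [hzb] at hz₁
    have hR2 : ∀ a' b', R' a' b' ↔ R a' b' ∨ (a' = a ∧ b' = b) := by
      intro a' b'
      rw [hR]
      refine or_congr_right ⟨?_, ?_⟩
      · rintro ⟨h1, h2, h3, h4⟩
        exact ⟨K.unique _ _ x (h1.trans ha.symm) h3 hxa, K.unique _ _ x (h2.trans hb.symm) h4 hxb⟩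
      · rintro ⟨rfl, rfl⟩
        exact ⟨ha, hb, hxa, hxb⟩
    have hrow : s₁.a .row (a + 1) = (a + 1) * S := hB₁.row _ (by have := a.2; omega)
    have hlt' : ∀ c : Fin m, (c : ℕ) + 1 < S := fun c => by have := c.2; omega
    refine (Spec.ite (T := 5) (fun hnew => ?_) (fun hnew => ?_)).weaken (by norm_num)
    · simp only [eval_get, eval_cell, eval_var, eval_one, hy₁, hz₁, hrow] at hnew
      have hab := (hE₁ a b).1 hnew
      refine ⟨⟨T ++ [(a, b)], ?_, fun a' b' => ?_, ?_, ?_, fun a' b' => ?_⟩, le_rfl⟩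
      · rw [List.nodup_append]
        refine ⟨hT1, by simp, ?_⟩
        rintro p hp q hq rfl
        exact hab (List.mem_singleton.1 hq ▸ hp)
      · rw [hR2, List.mem_append, hT2, List.mem_singleton, Prod.mk.injEq]
      · simp [Cmd.run, Store.setV_v, hne₁]
      · have := (hW₁.push a).push b
        simpa [Cmd.run, Store.setV_v, Store.setA_a, hy₁, hz₁] using this
      · have : (a' + 1 = (a : ℕ) + 1 ∧ b' + 1 = (b : ℕ) + 1) ↔ (a' = a ∧ b' = b) := by
          simp [Fin.ext_iff]
        simp only [Cmd.run, Store.setA_a, Store.setV_a, eval_cell, eval_var, eval_one, hy₁, hz₁, hrow,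
          reduceCtorEq, if_false, if_true]
        rw [update_stride _ (hlt' b) (hlt' b')]
        simp only [this, List.mem_append, List.mem_singleton, Prod.mk.injEq, not_or]
        split_ifs with hc
        · simp [hc]
        · rw [hE₁]; tauto
    · simp only [eval_get, eval_cell, eval_var, eval_one, hy₁, hz₁, hrow] at hnew
      have hab : (a, b) ∈ T := by
        by_contra hc; exact hnew ((hE₁ a b).2 hc)
      refine (Spec.skip ⟨T, hT1, fun a' b' => ?_, hne₁, hW₁, hE₁⟩).weaken (by norm_num)
      rw [hR2, hT2]
      refine ⟨Or.inl, ?_⟩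
      rintro (h | ⟨rfl, rfl⟩)
      · exact h
      · exact (hT2 _ _).1 hab
  · simp only [eval_zero, eval_var, hz₁] at hlt
    refine (Spec.skip ⟨T, hT1, fun a' b' => ?_, hne₁, hW₁, hE₁⟩).weaken (by norm_num)
    rw [hR, hT2]
    refine ⟨Or.inl, ?_⟩
    rintro (h | ⟨-, h2, -, h4⟩)
    · exact h
    · have := hK.comp_eq b' x h4
      rw [h2] at this
      omega

/-- Each edge of `D` is listed in one orientation only, so a pair of classes and its reverse are
never both listed. This makes distinctness of ordered pairs enough. -/
theorem isEdgeList_tree {K : Classes D l (Fin m)} (hts : IsEdgeList D.tree ts)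
    {T : List (Fin m × Fin m)} (hT : T.Nodup)
    (h : ∀ a b, (a, b) ∈ T ↔ (K.node a, K.node b) ∈ ts ∧ ∃ x, x ∈ K.cls a ∧ x ∈ K.cls b) :
    IsEdgeList K.tree T := by
  have hadj : ∀ {u v}, (u, v) ∈ ts → D.tree.Adj u v := fun huv =>
    (hts.2 _ _).2 (List.mem_map.2 ⟨_, huv, rfl⟩)
  have hanti : ∀ {u v}, (u, v) ∈ ts → (v, u) ∈ ts → False := by
    intro u v h1 h2
    have := List.inj_on_of_nodup_map hts.1 h1 h2 Sym2.eq_swap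
    rw [Prod.mk.injEq] at this
    exact (hadj h1).ne this.1
  refine ⟨hT.map_on ?_, fun a b => ⟨?_, ?_⟩⟩
  · rintro ⟨a, b⟩ hab ⟨c, d⟩ hcd heq
    rcases Sym2.eq_iff.1 heq with ⟨h1, h2⟩ | ⟨h1, h2⟩
    · exact Prod.ext h1 h2
    · simp only at h1 h2
      subst h1; subst h2
      exact (hanti ((h _ _).1 hab).1 ((h _ _).1 hcd).1).elim
  · rintro ⟨h1, x, hx1, hx2⟩
    obtain ⟨⟨u, v⟩, huv, heq⟩ := List.mem_map.1 ((hts.2 _ _).1 h1)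
    rcases Sym2.eq_iff.1 heq with ⟨h1, h2⟩ | ⟨h1, h2⟩
    · simp only at h1 h2
      subst h1; subst h2
      exact List.mem_map.2 ⟨(a, b), (h a b).2 ⟨huv, x, hx1, hx2⟩, rfl⟩
    · simp only at h1 h2
      subst h1; subst h2
      exact List.mem_map.2 ⟨(b, a), (h b a).2 ⟨huv, x, hx2, hx1⟩, Sym2.eq_swap⟩
  · intro hab
    obtain ⟨⟨c, d⟩, hcd, heq⟩ := List.mem_map.1 hab
    obtain ⟨h1, x, hx1, hx2⟩ := (h c d).1 hcd
    have hcd' : K.tree.Adj c d := ⟨hadj h1, x, hx1, hx2⟩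
    rcases Sym2.eq_iff.1 heq with ⟨h1, h2⟩ | ⟨h1, h2⟩
    · simp only at h1 h2
      subst h1; subst h2
      exact hcd'
    · simp only at h1 h2
      subst h1; subst h2
      exact hcd'.symm

theorem HoldsClasses.of_frame {K : Classes D l (Fin m)} {lst : Fin m → List (Fin n)}
    {s s' : Store Arr} (h : HoldsClasses K S lst s) (h1 : s'.v .nc = s.v .nc)
    (h2 : s'.a .cst = s.a .cst) (h3 : s'.a .que = s.a .que) (h4 : s'.a .comp = s.a .comp) :
    HoldsClasses K S lst s' := by
  constructor
  · exact h1.trans h.vnc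
  · exact h.isList
  · rw [h2]; exact h.cst_zero
  · rw [h2]; exact h.cst_succ
  · rw [h2, h3]; exact h.que_eq
  · rw [h4]; exact h.comp_eq
  · rw [h4]; exact h.comp_zero

theorem treeOutCmd_spec {K : Classes D l (Fin m)} {lst : Fin m → List (Fin n)} {s : Store Arr}
    (hbs : IsBagList D.bag bs) (hts : IsEdgeList D.tree ts) {k : ℕ} (hk : ∀ t, (bs t).length ≤ k)
    (hB : Base l S es ts bs s) (hm : m < S) (hK : HoldsClasses K S lst s)
    (hemat : s.a .emat = fun _ => 0) :
    Spec treeOutCmd s (fun s' => ∃ T, IsEdgeList K.tree T ∧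
      Written (encodeGraph m T) (s'.v .op) (s'.a .out)) (5 + ts.length * (4 + k * 11)) := by
  refine (Spec.put_seq (Spec.set_seq (Spec.set_seq (Spec.seq
    (T := 1 + ts.length * ((1 + k * (9 + 2)) + 2 + 1)) (U := 1)
    (P := Linked m S (s.a .out 1) fun a b => (K.node a, K.node b) ∈ ts ∧
      ∃ x, x ∈ K.cls a ∧ x ∈ K.cls b) ?_ ?_)))).weaken ?_
  · set s₀ : Store Arr := Store.setV _ _ _ with hs₀
    have hB₀ : Base l S es ts bs s₀ := ((hB.setA .out _ _ rfl).setV .op _ rfl).setV .ne _ rfl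
    have hK₀ : HoldsClasses K S lst s₀ := hK.of_frame (by simp [hs₀, Store.setV_v])
      (by simp [hs₀, Store.setA_a]) (by simp [hs₀, Store.setA_a]) (by simp [hs₀, Store.setA_a])
    refine (Spec.loop (b := ts.length) (fun e s' => Linked m S (s.a .out 1) (fun a b =>
      (K.node a, K.node b) ∈ ts.take e ∧ ∃ x, x ∈ K.cls a ∧ x ∈ K.cls b) s') (by exact hB₀.vmt)
      ?_ ?_).imp ?_
    · refine ⟨[], by simp, by simp, by simp [hs₀, Store.setV_v], ⟨by simp [hs₀, Store.setV_v], ?_⟩,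
        by simp [hs₀, Store.setA_a, hemat]⟩
      intro i hi
      simp only [List.flatMap_nil, List.length_cons, List.length_nil] at hi
      interval_cases i <;> simp [hs₀, Store.setA_a, hK.vnc]
    · intro e he s₁ h₁ hf₁
      have hB₁ := hB₀.of_frame hf₁ rfl
      obtain ⟨te1, te2⟩ := hB₁.tedge e he
      refine Spec.set_seq (Spec.set_seq ?_)
      set s₂ : Store Arr := Store.setV _ _ _ with hs₂
      have hB₂ : Base l S es ts bs s₂ := ((hB₁.setV .e e rfl).setV .u _ rfl).setV .v _ rfl
      have hu : s₂.v .u = ts[e].1 := by simp [hs₂, Store.setV_v, te1]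
      have hv : s₂.v .v = ts[e].2 := by simp [hs₂, Store.setV_v, te2]
      have hK₂ : HoldsClasses K S lst s₂ := hK₀.of_frame
        (by simp [hs₂, Store.setV_v, hf₁.v .nc rfl]) (hf₁.a .cst rfl) (hf₁.a .que rfl)
        (hf₁.a .comp rfl)
      have hbag : ∀ x, x ∈ bs ts[e].1 ↔ x ∈ D.bag ts[e].1 := fun x => (hbs _).2 x
      refine (bagLoop_spec hB₂ (t := ts[e].1) (tv := .u) (iv := .i) (xv := .x) hu (hk _)
        (fun i s' => Linked m S (s.a .out 1) (fun a b =>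
          ((K.node a, K.node b) ∈ ts.take e ∧ ∃ x, x ∈ K.cls a ∧ x ∈ K.cls b) ∨
          ∃ x ∈ (bs ts[e].1).take i, K.node a = ts[e].1 ∧ K.node b = ts[e].2 ∧
            x ∈ K.cls a ∧ x ∈ K.cls b) s') ?_ rfl rfl ?_).imp ?_
      · obtain ⟨T, hT1, hT2, hT3, hT4, hT5⟩ := h₁
        exact ⟨T, hT1, fun a b => by rw [hT2]; simp, by simpa [hs₂, Store.setV_v] using hT3,
          by simpa [hs₂, Store.setV_v] using hT4, hT5⟩
      · intro i hi s₃ h₃ hf₃ hB₃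
        obtain ⟨T, hT1, hT2, hT3, hT4, hT5⟩ := h₃
        refine linkStep_spec hB₃ hm (K := K) (lst := lst) (u := ts[e].1) (v := ts[e].2)
          (x := (bs ts[e].1)[i]) (hK₂.of_frame
            (by simp [Store.setV_v, hf₃.v .nc rfl]) (hf₃.a .cst rfl) (hf₃.a .que rfl)
            (hf₃.a .comp rfl)) ((hbag _).1 (List.getElem_mem hi))
          ⟨T, hT1, hT2, by simpa [Store.setV_v] using hT3, by simpa [Store.setV_v] using hT4, hT5⟩
          (by simp [Store.setV_v, hf₃.v .u rfl, hu]) (by simp [Store.setV_v, hf₃.v .v rfl, hv])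
          (by simp [Store.setV_v]) ?_
        intro a b
        rw [or_assoc]
        refine or_congr_right ?_
        simp only [mem_take_succ hi, or_and_right, exists_or, exists_eq_left]
      · rintro s₃ ⟨T, hT1, hT2, hT3, hT4, hT5⟩ -
        refine ⟨T, hT1, fun a b => ?_, hT3, hT4, hT5⟩
        rw [hT2]
        simp only [List.take_length, mem_take_succ he]
        constructor
        · rintro (⟨h1, h2⟩ | ⟨x, hx, h1, h2, h3⟩)
          · exact ⟨Or.inl h1, h2⟩
          · exact ⟨Or.inr (Prod.ext h1 h2), x, h3⟩
        · rintro ⟨h1 | h1, x, h2, h3⟩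
          · exact Or.inl ⟨h1, x, h2, h3⟩
          · have e1 : K.node a = ts[e].1 := congrArg Prod.fst h1
            exact Or.inr ⟨x, (hbag x).2 (e1 ▸ K.subset a h2), e1, congrArg Prod.snd h1, h2, h3⟩
    · rintro s₁ ⟨T, hT1, hT2, hT3, hT4, hT5⟩ -
      exact ⟨T, hT1, by simpa using hT2, hT3, hT4, hT5⟩
  · rintro s₁ ⟨T, hT1, hT2, hT3, hT4, hT5⟩ -
    refine Spec.put ⟨T, isEdgeList_tree hts hT1 hT2, ?_⟩
    have := Written.fill (w := [m]) hT4 T.length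
    simpa [Store.setA_a, hT3, encodeGraph] using this
  · apply le_of_eq; ring

end TreeOut

/-! ### Writing the bags -/

section BagsOut

variable {n L l S m : ℕ} {es : List (Fin n × Fin n)} {ts : List (Fin L × Fin L)}
  {bs : Fin L → List (Fin n)} {G : SimpleGraph (Fin n)} {D : TreeDecomposition G (Fin L)}

/-- The elements `xs` of bag `c` have been written, after the word `w` and a cell for the size. -/
structure Emitted (c : ℕ) (w : List ℕ) (r : ℕ) (xs : List (Fin n)) (s : Store Arr) : Prop where
  vc : s.v .c = c
  written : Written (w ++ r :: xs.map Fin.val) (s.v .op) (s.a .out)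
  stamp : ∀ v : Fin n, s.a .stamp v < c + 1 ↔ v ∉ xs
  stamp_le : ∀ v : Fin n, s.a .stamp v < c + 2
  nodup : xs.Nodup

theorem Emitted.of_eq {c : ℕ} {w : List ℕ} {r : ℕ} {xs : List (Fin n)} {s s' : Store Arr}
    (h : Emitted c w r xs s) (h1 : s'.v .c = s.v .c) (h2 : s'.v .op = s.v .op)
    (h3 : s'.a .out = s.a .out) (h4 : s'.a .stamp = s.a .stamp) : Emitted c w r xs s' :=
  ⟨h1.trans h.vc, by rw [h2, h3]; exact h.written, by rw [h4]; exact h.stamp,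
    by rw [h4]; exact h.stamp_le, h.nodup⟩

theorem emitCmd_spec {c : ℕ} {w : List ℕ} {r : ℕ} {xs : List (Fin n)} {s : Store Arr}
    (h : Emitted c w r xs s) {z : Var} {v : Fin n} (hz : s.v z = v) (hv : v ∉ xs) :
    Spec (emitCmd z) s (Emitted c w r (xs ++ [v])) 3 := by
  have hst : ((emitCmd z).run s).a .stamp = Function.update (s.a .stamp) v (c + 1) := by
    simp [emitCmd, Cmd.run, Store.setA_a, hz, h.vc]
  refine ⟨⟨?_, ?_, fun a => ?_, fun a => ?_, ?_⟩, le_rfl⟩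
  · simp [emitCmd, Cmd.run, Store.setV_v, h.vc]
  · have := h.written.push v
    simpa [emitCmd, Cmd.run, Store.setV_v, Store.setA_a, hz] using this
  · rw [hst, Function.update_apply, List.mem_append, List.mem_singleton]
    have := h.stamp a
    by_cases hav : a = v
    · subst hav; simp
    · have hav' : (a : ℕ) ≠ v := fun e => hav (Fin.ext e)
      simp [hav, hav', this]
  · rw [hst, Function.update_apply]
    have := h.stamp_le a
    split_ifs <;> omega
  · rw [List.nodup_append]
    refine ⟨h.nodup, by simp, ?_⟩
    rintro a ha b hb rfl
    exact hv (List.mem_singleton.1 hb ▸ ha)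

theorem emitIfNew_spec {c : ℕ} {w : List ℕ} {r : ℕ} {xs : List (Fin n)} {s : Store Arr}
    (h : Emitted c w r xs s) {v : Fin n} (hz : s.v .z = v) :
    Spec (.ite (.get .stamp Var.z) (Var.c + 1) (emitCmd .z) .skip) s
      (fun s' => ∃ xs', Emitted c w r xs' s' ∧ ∀ a, a ∈ xs' ↔ a ∈ xs ∨ a = v) 4 := by
  refine (Spec.ite (T := 3) (fun hlt => ?_) (fun hlt => ?_)).weaken (by norm_num)
  · simp only [eval_get, eval_add, eval_var, eval_one, hz, h.vc, h.stamp] at hlt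
    exact (emitCmd_spec h hz hlt).imp fun s' hs' _ => ⟨_, hs', by simp⟩
  · simp only [eval_get, eval_add, eval_var, eval_one, hz, h.vc, h.stamp, not_not] at hlt
    refine (Spec.skip ⟨xs, h, fun a => ⟨Or.inl, ?_⟩⟩).weaken (by norm_num)
    rintro (ha | rfl) <;> assumption

/-- The stack of pairs still to be split. -/
structure Stacked (st : List (Fin n × Fin n)) (sp : ℕ) (sta stb : ℕ → ℕ) : Prop where
  sp_eq : sp = st.length
  fst_eq : ∀ i (h : i < st.length), sta i = (st[i].1 : ℕ)
  snd_eq : ∀ i (h : i < st.length), stb i = (st[i].2 : ℕ)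

theorem Stacked.push {st : List (Fin n × Fin n)} {sp : ℕ} {sta stb : ℕ → ℕ}
    (h : Stacked st sp sta stb) (u v : Fin n) :
    Stacked (st ++ [(u, v)]) (sp + 1) (Function.update sta sp u) (Function.update stb sp v) := by
  refine ⟨by simp [h.sp_eq], fun i hi => ?_, fun i hi => ?_⟩ <;>
  · simp only [List.length_append, List.length_singleton] at hi
    by_cases hi' : i = st.length
    · subst hi'; simp [h.sp_eq]
    · have hi2 : i < st.length := by omega
      simp [h.sp_eq, hi', List.getElem_append_left hi2, h.fst_eq i hi2, h.snd_eq i hi2]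

theorem Stacked.pop {st : List (Fin n × Fin n)} {p : Fin n × Fin n} {sp : ℕ} {sta stb : ℕ → ℕ}
    (h : Stacked (st ++ [p]) sp sta stb) :
    sp = st.length + 1 ∧ sta st.length = p.1 ∧ stb st.length = p.2 ∧
      Stacked st st.length sta stb := by
  refine ⟨by simpa using h.sp_eq, ?_, ?_, rfl, fun i hi => ?_, fun i hi => ?_⟩
  · simpa using h.fst_eq st.length (by simp)
  · simpa using h.snd_eq st.length (by simp)
  · rw [h.fst_eq i (by simp; omega), List.getElem_append_left hi]
  · rw [h.snd_eq i (by simp; omega), List.getElem_append_left hi]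

/-- The number of splitting steps that a pair at distance `d` takes. -/
def splitSteps (d : ℕ) : ℕ := max 1 (2 * d - 1)

/-- The state of the expansion after `f` of at most `b` steps; `R` describes the final bag. -/
structure Expanding (D : TreeDecomposition G (Fin L)) (mid : Fin n → Fin n → Fin n) (c : ℕ)
    (w : List ℕ) (r : ℕ) (R : Fin n → Prop) (b f : ℕ) (st : List (Fin n × Fin n))
    (xs : List (Fin n)) (s : Store Arr) : Prop where
  emitted : Emitted c w r xs s
  stacked : Stacked st (s.v .sp) (s.a .sta) (s.a .stb)
  bag : ∀ p ∈ st, ∃ t, p.1 ∈ D.bag t ∧ p.2 ∈ D.bag t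
  mem : ∀ v, (v ∈ xs ∨ ∃ p ∈ st, Inner G mid p.1 p.2 v) ↔ R v
  steps : st = [] ∨ (st.map fun p => splitSteps (G.dist p.1 p.2)).sum + f ≤ b

theorem inner_iff {V : Type*} {G : SimpleGraph V} {mid : V → V → V} {x y v : V} :
    Inner G mid x y v ↔ 1 < G.dist x y ∧
      (v = mid x y ∨ Inner G mid x (mid x y) v ∨ Inner G mid (mid x y) y v) := by
  constructor
  · rintro (h | ⟨h, h'⟩ | ⟨h, h'⟩)
    · exact ⟨h, Or.inl rfl⟩
    · exact ⟨h, Or.inr (Or.inl h')⟩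
    · exact ⟨h, Or.inr (Or.inr h')⟩
  · rintro ⟨h, rfl | h' | h'⟩
    · exact .mid h
    · exact .left h h'
    · exact .right h h'

/-- The sum of `splitSteps` over the stack is a potential that falls in each round: a split into
positive parts `a` and `b` turns `2(a + b) - 1` into `(2a - 1) + (2b - 1)`. The set described by `R`
stays the same, by unfolding `Inner` once. -/
theorem splitCmd_spec (hG : G.Connected) {mid : Fin n → Fin n → Fin n} (hmid : IsMid D mid)
    {s : Store Arr} (hB : Base l S es ts bs s)
    (hdist : ∀ t, ∀ x ∈ D.bag t, ∀ y ∈ D.bag t, vmat n S (s.a .dist) x y = G.dist x y)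
    (hmids : ∀ t, ∀ x ∈ D.bag t, ∀ y ∈ D.bag t, 1 < G.dist x y →
      vmat n S (s.a .mid) x y = mid x y)
    {c : ℕ} {w : List ℕ} {r : ℕ} {R : Fin n → Prop} {b f : ℕ} {st : List (Fin n × Fin n)}
    {xs : List (Fin n)} (h : Expanding D mid c w r R b f st xs s) :
    Spec splitCmd s (fun s' => ∃ st' xs', Expanding D mid c w r R b (f + 1) st' xs' s') 15 := by
  refine (Spec.ite (T := 14) (fun hlt => ?_) (fun hlt => ?_)).weaken (by norm_num)
  · rcases List.eq_nil_or_concat st with rfl | ⟨st, ⟨u, v⟩, rfl⟩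
    · have := h.stacked.sp_eq
      simp [this] at hlt
    rw [List.concat_eq_append] at h
    obtain ⟨hsp, hsu, hsv, hst⟩ := h.stacked.pop
    obtain ⟨t, hut, hvt⟩ := h.bag (u, v) (by simp)
    simp only at hsu hsv hut hvt
    have hsteps : (st.map fun p => splitSteps (G.dist p.1 p.2)).sum +
        splitSteps (G.dist u v) + f ≤ b := by
      have := h.steps.resolve_left (by simp)
      simpa using this
    refine (Spec.set_seq (Spec.set_seq (Spec.set_seq (T := 11) ?_))).weaken (by norm_num)
    set s₁ : Store Arr := Store.setV _ _ _ with hs₁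
    have hB₁ : Base l S es ts bs s₁ := ((hB.setV .sp _ rfl).setV .u _ rfl).setV .v _ rfl
    have ha₁ : s₁.a = s.a := rfl
    have hsp₁ : s₁.v .sp = st.length := by simp [hs₁, Store.setV_v, hsp]
    have hu₁ : s₁.v .u = u := by simp [hs₁, Store.setV_v, hsp, hsu]
    have hv₁ : s₁.v .v = v := by simp [hs₁, Store.setV_v, hsp, hsv]
    have he₁ : Emitted c w r xs s₁ := h.emitted.of_eq (by simp [hs₁, Store.setV_v])
      (by simp [hs₁, Store.setV_v]) rfl rfl
    have hd : s.a .dist (u * S + v) = G.dist u v := hdist t u hut v hvt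
    refine (Spec.ite (T := 10) (fun hlt' => ?_) (fun hlt' => ?_)).weaken (by norm_num)
    · simp only [eval_one, eval_get, eval_cell, eval_var, hu₁, hv₁, hB₁.row_fin, ha₁, hd] at hlt'
      obtain ⟨t', h1, h2, h3, h4, h5, h6⟩ := hmid t u v hut hvt hlt'
      have hm : s.a .mid (u * S + v) = mid u v := hmids t u hut v hvt hlt'
      have hez : ∀ i, Emitted c w r xs (s₁.setV .z i) := fun i =>
        he₁.of_eq (by simp [Store.setV_v]) (by simp [Store.setV_v]) rfl rfl
      refine Spec.set_seq (T := 9) (Spec.seq (T := 4) (U := 5) (emitIfNew_spec (v := mid u v)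
        (hez _) ?_) ?_)
      · simp only [Store.setV_v, if_true, eval_get, eval_cell, eval_var, hu₁, hv₁, hB₁.row_fin, ha₁,
          hm]
      · rintro s₂ ⟨xs', he₂, hxs'⟩ hf₂
        have hu₂ : s₂.v .u = u := by simp [hf₂.v .u rfl, Store.setV_v, hu₁]
        have hv₂ : s₂.v .v = v := by simp [hf₂.v .v rfl, Store.setV_v, hv₁]
        have hz₂ : s₂.v .z = mid u v := by
          simp [hf₂.v .z rfl, Store.setV_v, hu₁, hv₁, hB₁.row_fin, ha₁, hm]
        have hsp₂ : s₂.v .sp = st.length := by simp [hf₂.v .sp rfl, Store.setV_v, hsp₁]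
        have hst₂ : Stacked st st.length (s₂.a .sta) (s₂.a .stb) := by
          rw [hf₂.a .sta rfl, hf₂.a .stb rfl]; exact hst
        have hps := (hst₂.push u (mid u v)).push (mid u v) v
        refine ⟨⟨st ++ [(u, mid u v)] ++ [(mid u v, v)], xs', he₂.of_eq ?_ ?_ ?_ ?_, ?_, ?_,
          fun a => ?_, Or.inr ?_⟩, le_rfl⟩
        · simp [Cmd.run, Store.setV_v]
        · simp [Cmd.run, Store.setV_v]
        · simp [Cmd.run, Store.setA_a]
        · simp [Cmd.run, Store.setA_a]
        · simpa [Cmd.run, Store.setV_v, Store.setA_a, hu₂, hv₂, hz₂, hsp₂] using hps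
        · intro p hp
          simp only [List.mem_append, List.mem_singleton] at hp
          rcases hp with (hp | rfl) | rfl
          · exact h.bag p (List.mem_append_left _ hp)
          · exact ⟨t', h1, h3⟩
          · exact ⟨t', h3, h2⟩
        · rw [← h.mem a, hxs']
          simp only [List.mem_append, List.mem_singleton, or_and_right, exists_or, exists_eq_left,
            inner_iff (x := u) (y := v), hlt', true_and]
          generalize (∃ p ∈ st, Inner G mid p.1 p.2 a) = E
          tauto
        · have p1 := hG.pos_dist_of_ne h4.symm
          have p2 := hG.pos_dist_of_ne h5
          simp only [List.map_append, List.map_cons, List.map_nil, List.sum_append, List.sum_cons,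
            List.sum_nil]
          have e1 : splitSteps (G.dist u v) = 2 * G.dist u v - 1 := max_eq_right (by omega)
          have e2 : splitSteps (G.dist u (mid u v)) = 2 * G.dist u (mid u v) - 1 :=
            max_eq_right (by omega)
          have e3 : splitSteps (G.dist (mid u v) v) = 2 * G.dist (mid u v) v - 1 :=
            max_eq_right (by omega)
          omega
    · simp only [eval_one, eval_get, eval_cell, eval_var, hu₁, hv₁, hB₁.row_fin, ha₁, hd] at hlt'
      refine (Spec.skip ⟨st, xs, he₁, by rw [hsp₁]; exact hst, fun p hp =>
        h.bag p (List.mem_append_left _ hp), fun a => ?_, Or.inr ?_⟩).weaken (by norm_num)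
      · rw [← h.mem a]
        simp only [List.mem_append, List.mem_singleton, or_and_right, exists_or, exists_eq_left,
          inner_iff (x := u) (y := v), hlt', false_and, or_false]
      · have : 1 ≤ splitSteps (G.dist u v) := le_max_left _ _
        omega
  · simp only [eval_zero, eval_var, h.stacked.sp_eq] at hlt
    obtain rfl : st = [] := List.length_eq_zero_iff.1 (by omega)
    exact (Spec.skip ⟨[], xs, h.emitted, h.stacked, h.bag, h.mem, Or.inl rfl⟩).weaken (by norm_num)

theorem expandCmd_spec (hG : G.Connected) {mid : Fin n → Fin n → Fin n} (hmid : IsMid D mid)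
    (hl : 1 ≤ l) {s : Store Arr} (hB : Base l S es ts bs s)
    (hdist : ∀ t, ∀ x ∈ D.bag t, ∀ y ∈ D.bag t, vmat n S (s.a .dist) x y = G.dist x y)
    (hmids : ∀ t, ∀ x ∈ D.bag t, ∀ y ∈ D.bag t, 1 < G.dist x y →
      vmat n S (s.a .mid) x y = mid x y)
    {c : ℕ} {w : List ℕ} {r : ℕ} {xs : List (Fin n)} (h : Emitted c w r xs s)
    {t : Fin L} {x y : Fin n} (hx : x ∈ D.bag t) (hy : y ∈ D.bag t) (hxy : G.dist x y ≤ l)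
    (hvx : s.v .x = x) (hvy : s.v .y = y) :
    Spec expandCmd s (fun s' => ∃ xs', Emitted c w r xs' s' ∧
      ∀ v, v ∈ xs' ↔ v ∈ xs ∨ Inner G mid x y v) (4 + 32 * l) := by
  refine (Spec.put_seq (Spec.put_seq (Spec.set_seq (T := 1 + (l + l) * (15 + 1)) ?_))).weaken
    (by omega)
  set s₁ : Store Arr := Store.setV _ _ _ with hs₁
  have hB₁ : Base l S es ts bs s₁ := ((hB.setA .sta _ _ rfl).setA .stb _ _ rfl).setV .sp _ rfl
  have he₁ : Emitted c w r xs s₁ := h.of_eq (by simp [hs₁, Store.setV_v])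
    (by simp [hs₁, Store.setV_v]) (by simp [hs₁, Store.setA_a]) (by simp [hs₁, Store.setA_a])
  have hd₁ : s₁.a .dist = s.a .dist := by simp [hs₁, Store.setA_a]
  have hm₁ : s₁.a .mid = s.a .mid := by simp [hs₁, Store.setA_a]
  refine (Spec.loop (b := l + l) (fun f (s' : Store Arr) => ∃ st xs', Expanding D mid c w r
    (fun v => v ∈ xs ∨ Inner G mid x y v) (l + l) f st xs' s') ?_
    ⟨[(x, y)], xs, he₁, ?_, ?_, ?_, Or.inr ?_⟩ ?_).imp ?_
  · simp [hs₁, Store.setV_v, hB.vl]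
  · exact ⟨by simp [hs₁, Store.setV_v], by simp [hs₁, Store.setA_a, hvx],
      by simp [hs₁, Store.setA_a, hvy]⟩
  · simpa using ⟨t, hx, hy⟩
  · simp
  · simp only [List.map_cons, List.map_nil, List.sum_cons, List.sum_nil, splitSteps]
    omega
  · rintro f - s₂ ⟨st, xs', h₂⟩ hf₂
    refine splitCmd_spec hG hmid ((hB₁.of_frame hf₂ rfl).setV .f f rfl) ?_ ?_ (st := st) (xs := xs')
      ⟨?_, ?_, h₂.bag, h₂.mem, h₂.steps⟩
    · simp only [Store.setV_a, hf₂.a .dist rfl, hd₁]; exact hdist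
    · simp only [Store.setV_a, hf₂.a .mid rfl, hm₁]; exact hmids
    · exact h₂.emitted.of_eq (by simp [Store.setV_v]) (by simp [Store.setV_v]) rfl rfl
    · simpa [Store.setV_v] using h₂.stacked
  · rintro s₂ ⟨st, xs', h₂⟩ -
    -- After `2l` rounds the whole budget is spent, whereas a remaining pair would still need at
    -- least one step.
    have hst : st = [] := by
      by_contra hst
      refine hst (h₂.steps.resolve_right fun hle => ?_)
      cases st with
      | nil => exact hst rfl
      | cons p st =>
        have : 1 ≤ splitSteps (G.dist p.1 p.2) := le_max_left _ _
        simp only [List.map_cons, List.sum_cons] at hle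
        omega
    subst hst
    exact ⟨xs', h₂.emitted, fun v => by simpa using h₂.mem v⟩

/-- The variables and arrays that the bags are computed from. -/
structure BagData {K : Classes D l (Fin m)} (mid : Fin n → Fin n → Fin n) (S : ℕ)
    (lst : Fin m → List (Fin n)) (s : Store Arr) : Prop extends HoldsClasses K S lst s where
  dist_eq : ∀ t, ∀ x ∈ D.bag t, ∀ y ∈ D.bag t, vmat n S (s.a .dist) x y = G.dist x y
  mid_eq : ∀ t, ∀ x ∈ D.bag t, ∀ y ∈ D.bag t, 1 < G.dist x y →
    vmat n S (s.a .mid) x y = mid x y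

theorem BagData.of_eq {K : Classes D l (Fin m)} {mid : Fin n → Fin n → Fin n}
    {lst : Fin m → List (Fin n)} {s s' : Store Arr} (h : BagData (K := K) mid S lst s)
    (h1 : s'.v .nc = s.v .nc) (h2 : s'.a .cst = s.a .cst) (h3 : s'.a .que = s.a .que)
    (h4 : s'.a .comp = s.a .comp) (h5 : s'.a .dist = s.a .dist) (h6 : s'.a .mid = s.a .mid) :
    BagData (K := K) mid S lst s' :=
  ⟨h.toHoldsClasses.of_frame h1 h2 h3 h4, by rw [h5]; exact h.dist_eq, by rw [h6]; exact h.mid_eq⟩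

theorem BagData.frame {K : Classes D l (Fin m)} {mid : Fin n → Fin n → Fin n}
    {lst : Fin m → List (Fin n)} {s s' : Store Arr} (h : BagData (K := K) mid S lst s) {c : Cmd Arr}
    (hf : Frame c s s') (h1 : c.writesV .nc = false) (h2 : c.writesA .cst = false)
    (h3 : c.writesA .que = false) (h4 : c.writesA .comp = false) (h5 : c.writesA .dist = false)
    (h6 : c.writesA .mid = false) : BagData (K := K) mid S lst s' :=
  h.of_eq (hf.v _ h1) (hf.a _ h2) (hf.a _ h3) (hf.a _ h4) (hf.a _ h5) (hf.a _ h6)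

theorem pairs_spec (hG : G.Connected) {K : Classes D l (Fin m)} {mid : Fin n → Fin n → Fin n}
    (hmid : IsMid D mid) (hl : 1 ≤ l) {s : Store Arr} (hB : Base l S es ts bs s)
    {lst : Fin m → List (Fin n)} (hK : BagData (K := K) mid S lst s) {c : Fin m} {w : List ℕ}
    {r : ℕ} (h : Emitted c w r (lst c) s) (hlo : s.v .lo = s.a .cst c)
    (hhi : s.v .hi = s.a .cst (c + 1)) {k : ℕ} (hk : (lst c).length ≤ k) :
    Spec (.loop .i (Var.hi - Var.lo) (.set .x (.get .que (Var.lo + Var.i)) ;;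
      .loop .j (Var.hi - Var.lo) (.set .y (.get .que (Var.lo + Var.j)) ;;
        .ite Var.l (.get .dist (cell Var.x Var.y)) .skip expandCmd))) s
      (fun s' => ∃ xs, Emitted c w r xs s' ∧ ∀ v, v ∈ xs ↔ K.InBag mid c v)
      (1 + (lst c).length * (3 + k * (7 + 32 * l))) := by
  have hlen : s.v .hi - s.v .lo = (lst c).length := by rw [hlo, hhi, hK.cst_succ]; omega
  have hmem : ∀ x, x ∈ lst c ↔ x ∈ K.cls c := fun x => (hK.isList c).2 x
  have hbag : ∀ x ∈ lst c, x ∈ D.bag (K.node c) := fun x hx => K.subset c ((hmem x).1 hx)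
  refine ((Spec.loop (b := (lst c).length) (T := (1 + k * ((6 + 32 * l) + 1)) + 1)
    (fun i (s' : Store Arr) => ∃ xs, Emitted c w r xs s' ∧
      ∀ v, v ∈ xs ↔ v ∈ lst c ∨ ∃ x ∈ (lst c).take i, ∃ y ∈ lst c, G.dist x y ≤ l ∧
        Inner G mid x y v) (by exact hlen) ⟨lst c, h, by simp⟩ ?_).imp ?_).weaken ?_
  · rintro i hi s₁ ⟨xs, h₁, hxs⟩ hf₁
    have hB₁ := hB.of_frame hf₁ rfl
    have hK₁ := hK.frame hf₁ rfl rfl rfl rfl rfl rfl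
    have hx : s₁.a .que (s₁.v .lo + i) = (lst c)[i] := by
      rw [hf₁.v .lo rfl, hlo, ← hf₁.a .cst rfl]; exact hK₁.que_eq c i hi
    apply Spec.set_seq
    set s₂ : Store Arr := Store.setV _ _ _ with hs₂
    have hB₂ : Base l S es ts bs s₂ := (hB₁.setV .i i rfl).setV .x _ rfl
    have hK₂ : BagData (K := K) mid S lst s₂ := hK₁.of_eq (by simp [hs₂, Store.setV_v]) rfl rfl rfl
      rfl rfl
    have hx₂ : s₂.v .x = (lst c)[i] := by simp [hs₂, Store.setV_v, hx]
    have hlo₂ : s₂.v .lo = s₂.a .cst c := by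
      simp [hs₂, Store.setV_v, hf₁.v .lo rfl, hf₁.a .cst rfl, hlo]
    have hlen₂ : s₂.v .hi - s₂.v .lo = (lst c).length := by
      simpa [hs₂, Store.setV_v, hf₁.v .lo rfl, hf₁.v .hi rfl] using hlen
    have h₂ : Emitted c w r xs s₂ := h₁.of_eq (by simp [hs₂, Store.setV_v])
      (by simp [hs₂, Store.setV_v]) rfl rfl
    refine ((Spec.loop (b := (lst c).length) (T := 6 + 32 * l) (s := s₂) (e := Var.hi - Var.lo)
      (fun j (s' : Store Arr) => ∃ xs', Emitted c w r xs' s' ∧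
        ∀ v, v ∈ xs' ↔ v ∈ xs ∨ ∃ y ∈ (lst c).take j, G.dist (lst c)[i] y ≤ l ∧
          Inner G mid (lst c)[i] y v) hlen₂ ⟨xs, h₂, by simp⟩ ?_).imp ?_).weaken
      (Nat.add_le_add_left (Nat.mul_le_mul_right _ hk) _)
    · rintro j hj s₃ ⟨xs', h₃, hxs'⟩ hf₃
      have hB₃ := hB₂.of_frame hf₃ rfl
      have hK₃ := hK₂.frame hf₃ rfl rfl rfl rfl rfl rfl
      have hy : s₃.a .que (s₃.v .lo + j) = (lst c)[j] := by
        rw [hf₃.v .lo rfl, hlo₂, ← hf₃.a .cst rfl]; exact hK₃.que_eq c j hj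
      refine (Spec.set_seq (T := 5 + 32 * l) ?_).weaken (by omega)
      set s₄ : Store Arr := Store.setV _ _ _ with hs₄
      have hB₄ : Base l S es ts bs s₄ := (hB₃.setV .j j rfl).setV .y _ rfl
      have hK₄ : BagData (K := K) mid S lst s₄ := hK₃.of_eq (by simp [hs₄, Store.setV_v]) rfl rfl
        rfl rfl rfl
      have hx₄ : s₄.v .x = (lst c)[i] := by simp [hs₄, Store.setV_v, hf₃.v .x rfl, hx₂]
      have hy₄ : s₄.v .y = (lst c)[j] := by simp [hs₄, Store.setV_v, hy]
      have h₄ : Emitted c w r xs' s₄ := h₃.of_eq (by simp [hs₄, Store.setV_v])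
        (by simp [hs₄, Store.setV_v]) rfl rfl
      have hxi := hbag _ (List.getElem_mem hi)
      have hyj := hbag _ (List.getElem_mem hj)
      have hd : s₄.a .dist ((lst c)[i] * S + (lst c)[j]) = G.dist (lst c)[i] (lst c)[j] :=
        hK₄.dist_eq _ _ hxi _ hyj
      refine (Spec.ite (T := 4 + 32 * l) (fun hlt => ?_) (fun hlt => ?_)).weaken (by omega)
      · simp only [eval_var, eval_get, eval_cell, hx₄, hy₄, hB₄.row_fin, hd, hB₄.vl] at hlt
        refine (Spec.skip ⟨xs', h₄, fun v => ?_⟩).weaken (by omega)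
        simp only [hxs', mem_take_succ hj, or_and_right, exists_or, exists_eq_left, not_le.2 hlt,
          false_and, or_false]
      · simp only [eval_var, eval_get, eval_cell, hx₄, hy₄, hB₄.row_fin, hd, hB₄.vl, not_lt] at hlt
        refine (expandCmd_spec hG hmid hl hB₄ hK₄.dist_eq hK₄.mid_eq h₄ hxi hyj hlt hx₄ hy₄).imp ?_
        rintro s₅ ⟨xs'', h₅, hxs''⟩ -
        refine ⟨xs'', h₅, fun v => ?_⟩
        simp only [hxs'', hxs', mem_take_succ hj, or_and_right, exists_or, exists_eq_left, hlt,
          true_and, or_assoc]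
    · rintro s₃ ⟨xs', h₃, hxs'⟩ -
      refine ⟨xs', h₃, fun v => ?_⟩
      simp only [hxs', hxs, mem_take_succ hi, or_and_right, exists_or, exists_eq_left,
        List.take_length, or_assoc]
  · rintro s₁ ⟨xs, h₁, hxs⟩ -
    refine ⟨xs, h₁, fun v => ?_⟩
    simp only [hxs, List.take_length, hmem, Classes.InBag]
  · exact Nat.add_le_add_left (Nat.mul_le_mul_left _ (by rw [show 6 + 32 * l + 1 = 7 + 32 * l by ring]; omega)) _

theorem bagOutCmd_spec (hG : G.Connected) {K : Classes D l (Fin m)}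
    {mid : Fin n → Fin n → Fin n} (hmid : IsMid D mid) (hl : 1 ≤ l) {s : Store Arr}
    (hB : Base l S es ts bs s) {lst : Fin m → List (Fin n)} (hK : BagData (K := K) mid S lst s)
    {c : Fin m} {w : List ℕ} (hw : Written w (s.v .op) (s.a .out)) (hvc : s.v .c = c)
    (hstamp : ∀ v : Fin n, s.a .stamp v < c + 1) {k : ℕ} (hk : (lst c).length ≤ k) :
    Spec bagOutCmd s (fun s' => ∃ xs : List (Fin n), xs.Nodup ∧ (∀ v, v ∈ xs ↔ K.InBag mid c v) ∧
      Written (w ++ xs.length :: xs.map Fin.val) (s'.v .op) (s'.a .out) ∧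
      ∀ v : Fin n, s'.a .stamp v < c + 2)
      (7 + (lst c).length * (8 + k * (7 + 32 * l))) := by
  refine (Spec.set_seq (Spec.set_seq (Spec.set_seq (Spec.set_seq
    (T := (1 + (lst c).length * ((3 + 1) + 1)) + ((1 + (lst c).length * (3 + k * (7 + 32 * l))) + 1))
    ?_)))).weaken (by apply le_of_eq; ring)
  set s₁ : Store Arr := Store.setV _ _ _ with hs₁
  have hB₁ : Base l S es ts bs s₁ :=
    (((hB.setV .lo _ rfl).setV .hi _ rfl).setV .p _ rfl).setV .op _ rfl
  have hK₁ : BagData (K := K) mid S lst s₁ := hK.of_eq (by simp [hs₁, Store.setV_v]) rfl rfl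
    rfl rfl rfl
  have hlo₁ : s₁.v .lo = s₁.a .cst c := by simp [hs₁, Store.setV_v, hvc]
  have hhi₁ : s₁.v .hi = s₁.a .cst (c + 1) := by simp [hs₁, Store.setV_v, hvc]
  have hp₁ : s₁.v .p = w.length := by simp [hs₁, Store.setV_v, hw.op_eq]
  have hlen : s₁.v .hi - s₁.v .lo = (lst c).length := by rw [hlo₁, hhi₁, hK₁.cst_succ]; omega
  have h₁ : Emitted c w (s.a .out (s.v .op)) ([] : List (Fin n)) s₁ := by
    refine ⟨by simp [hs₁, Store.setV_v, hvc], ?_, fun v => by simp [hs₁, hstamp v],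
      fun v => Nat.lt_succ_of_lt (hstamp v), List.nodup_nil⟩
    have := hw.reserve
    simpa [hs₁, Store.setV_v] using this
  refine Spec.seq (P := Emitted c w (s.a .out (s.v .op)) (lst c)) ?_ ?_
  · refine (Spec.loop (b := (lst c).length) (fun i (s' : Store Arr) =>
      Emitted c w (s.a .out (s.v .op)) ((lst c).take i) s') (by exact hlen) (by simpa using h₁)
      ?_).imp fun s' hs' _ => by rwa [List.take_length] at hs'
    intro i hi s₂ h₂ hf₂
    have hK₂ := hK₁.frame hf₂ rfl rfl rfl rfl rfl rfl
    have hx : s₂.a .que (s₂.v .lo + i) = (lst c)[i] := by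
      rw [hf₂.v .lo rfl, hlo₁, ← hf₂.a .cst rfl]; exact hK₂.que_eq c i hi
    have h₂' : ∀ a, Emitted c w (s.a .out (s.v .op)) ((lst c).take i) ((s₂.setV .i i).setV .x a) :=
      fun a => h₂.of_eq (by simp [Store.setV_v]) (by simp [Store.setV_v]) rfl rfl
    refine Spec.set_seq ((emitCmd_spec (h₂' _) (v := (lst c)[i])
      (by simp [Store.setV_v, hx]) ?_).imp fun s' hs' _ => ?_)
    · have hnd := (hK.isList c).1
      intro hmem
      obtain ⟨j, hj, heq⟩ := List.getElem_of_mem hmem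
      rw [List.getElem_take] at heq
      rw [List.length_take] at hj
      have := (hnd.getElem_inj_iff).1 heq
      omega
    · rwa [List.take_add_one, List.getElem?_eq_getElem hi]
  · intro s₂ h₂ hf₂
    have hK₂ := hK₁.frame hf₂ rfl rfl rfl rfl rfl rfl
    refine Spec.seq (pairs_spec hG hmid hl (hB₁.of_frame hf₂ rfl) hK₂ h₂ ?_ ?_ hk) ?_
    · rw [hf₂.v .lo rfl, hf₂.a .cst rfl, hlo₁]
    · rw [hf₂.v .hi rfl, hf₂.a .cst rfl, hhi₁]
    · rintro s₃ ⟨xs, h₃, hxs⟩ hf₃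
      refine Spec.put ⟨xs, h₃.nodup, hxs, ?_, fun v => ?_⟩
      · have hp : s₃.v .p = w.length := by rw [hf₃.v .p rfl, hf₂.v .p rfl, hp₁]
        have hop := h₃.written.op_eq
        have := h₃.written.fill (s₃.v .op - s₃.v .p - 1)
        simp only [Store.setA_v, Store.setA_a, if_true, eval_var, eval_sub, eval_one]
        rw [hp] at this ⊢
        rwa [show s₃.v .op - w.length - 1 = xs.length by rw [hop]; simp] at this ⊢
      · simpa [Store.setA_a] using h₃.stamp_le v

/-- The time is summed over the classes with their own sizes. Charging `k` elements to every class
would lose a factor of `k`. -/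
theorem bagsOutCmd_spec (hG : G.Connected) {K : Classes D l (Fin m)}
    {mid : Fin n → Fin n → Fin n} (hmid : IsMid D mid) (hl : 1 ≤ l) {s : Store Arr}
    (hB : Base l S es ts bs s) {lst : Fin m → List (Fin n)} (hK : BagData (K := K) mid S lst s)
    {w : List ℕ} (hw : Written w (s.v .op) (s.a .out)) (hstamp : s.a .stamp = fun _ => 0) {k : ℕ}
    (hk : ∀ c, (lst c).length ≤ k) :
    Spec bagsOutCmd s (fun s' => ∃ bs' : Fin m → List (Fin n),
      (∀ c, (bs' c).Nodup ∧ ∀ v, v ∈ bs' c ↔ K.InBag mid c v) ∧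
      Written (w ++ encodeBags bs') (s'.v .op) (s'.a .out))
      (1 + (m * 8 + (∑ c, (lst c).length) * (8 + k * (7 + 32 * l)))) := by
  refine ((Spec.loop_sum (b := m) (fun c (s' : Store Arr) => ∃ B : List (List (Fin n)),
    B.length = c ∧ (∀ i (h : i < m) (h' : i < B.length), B[i].Nodup ∧
      ∀ v, v ∈ B[i] ↔ K.InBag mid ⟨i, h⟩ v) ∧
    Written (w ++ B.flatMap fun b => b.length :: b.map Fin.val) (s'.v .op) (s'.a .out) ∧
    ∀ v : Fin n, s'.a .stamp v < c + 1)
    (fun c => if h : c < m then 7 + (lst ⟨c, h⟩).length * (8 + k * (7 + 32 * l)) else 0)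
    (by exact hK.vnc) ⟨[], rfl, by simp, by simpa using hw, by simp [hstamp]⟩ ?_).imp ?_).weaken ?_
  · rintro c hc s₁ ⟨B, hB1, hB2, hB3, hB4⟩ hf₁
    rw [dif_pos hc]
    refine (bagOutCmd_spec hG hmid hl ((hB.of_frame hf₁ rfl).setV .c c rfl)
      ((hK.frame hf₁ rfl rfl rfl rfl rfl rfl).of_eq (by simp [Store.setV_v]) rfl rfl rfl rfl rfl)
      (c := ⟨c, hc⟩) (w := w ++ B.flatMap fun b => b.length :: b.map Fin.val)
      (by simpa [Store.setV_v] using hB3) (by simp [Store.setV_v]) hB4 (hk _)).imp ?_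
    rintro s₂ ⟨xs, h1, h2, h3, h4⟩ -
    refine ⟨B ++ [xs], by simp [hB1], fun i hi hi' => ?_, by simpa using h3, h4⟩
    simp only [List.length_append, List.length_singleton] at hi'
    by_cases hic : i = c
    · subst hic
      subst hB1
      simp only [List.getElem_concat_length]
      exact ⟨h1, h2⟩
    · have : i < B.length := by omega
      rw [List.getElem_append_left this]
      exact hB2 i hi this
  · rintro s₁ ⟨B, hB1, hB2, hB3, -⟩ -
    subst hB1
    refine ⟨fun c => B[c], fun c => hB2 c c.2 c.2, ?_⟩
    have : encodeBags (fun c : Fin B.length => B[c]) =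
        B.flatMap fun b => b.length :: b.map Fin.val := by
      rw [encodeBags]
      congr 1
      exact List.ofFn_getElem
    rwa [this]
  · refine Nat.add_le_add_left (le_of_eq ?_) _
    rw [Finset.sum_range]
    simp only [Fin.is_lt, dif_pos, Fin.eta]
    rw [Finset.sum_add_distrib, Finset.sum_add_distrib, ← Finset.sum_mul]
    simp
    ring

end BagsOut

/-! ### Reading the input -/

/-- The values of `f` from `a` on are the entries of `w`. -/
def ReadsAt (f : ℕ → ℕ) (a : ℕ) (w : List ℕ) : Prop := ∀ i (h : i < w.length), f (a + i) = w[i]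

theorem readsAt_cons {f : ℕ → ℕ} {a x : ℕ} {w : List ℕ} :
    ReadsAt f a (x :: w) ↔ f a = x ∧ ReadsAt f (a + 1) w := by
  constructor
  · intro h
    refine ⟨h 0 (by simp), fun i hi => ?_⟩
    have := h (i + 1) (by simpa using hi)
    rw [List.getElem_cons_succ] at this
    rw [← this]
    congr 1
    omega
  · rintro ⟨h0, h1⟩ i hi
    cases i with
    | zero => simpa using h0
    | succ i =>
      rw [List.getElem_cons_succ, ← h1 i (by simpa using hi)]
      congr 1
      omega

theorem readsAt_append {f : ℕ → ℕ} {a : ℕ} {w w' : List ℕ} :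
    ReadsAt f a (w ++ w') ↔ ReadsAt f a w ∧ ReadsAt f (a + w.length) w' := by
  induction w generalizing a with
  | nil => simp [ReadsAt]
  | cons x w ih =>
    rw [List.cons_append, readsAt_cons, ih, readsAt_cons, and_assoc, List.length_cons,
      show a + 1 + w.length = a + (w.length + 1) by omega]

theorem ReadsAt.pairs {n a : ℕ} {f : ℕ → ℕ} {es : List (Fin n × Fin n)}
    (h : ReadsAt f a (es.flatMap fun e => [e.1.val, e.2.val])) (i : ℕ) (hi : i < es.length) :
    f (a + i + i) = (es[i].1 : ℕ) ∧ f (a + i + i + 1) = (es[i].2 : ℕ) := by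
  induction es generalizing a i with
  | nil => simp at hi
  | cons e es ih =>
    rw [List.flatMap_cons, readsAt_append, readsAt_cons, readsAt_cons] at h
    cases i with
    | zero => exact ⟨h.1.1, h.1.2.1⟩
    | succ i =>
      have := ih h.2 i (by simpa using hi)
      simp only [List.length_cons, List.length_nil, Nat.zero_add] at this
      rw [show a + (1 + 1) + i + i = a + (i + 1) + (i + 1) by omega] at this
      exact this

theorem length_pairs {n : ℕ} (es : List (Fin n × Fin n)) :
    (es.flatMap fun e => [e.1.val, e.2.val]).length = es.length + es.length := by
  induction es with
  | nil => rfl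
  | cons e es ih => simp only [List.flatMap_cons, List.length_append, List.length_cons,
      List.length_nil, ih]; omega

section Header

variable {n L l : ℕ} {es : List (Fin n × Fin n)} {ts : List (Fin L × Fin L)}
  {bs : Fin L → List (Fin n)}

/-- The position of bag `t` in the word that encodes the bags, if this word starts at `a`. -/
def bagPos (bs : Fin L → List (Fin n)) (a t : ℕ) : ℕ :=
  a + ∑ i ∈ Finset.range t, if h : i < L then (bs ⟨i, h⟩).length + 1 else 0

theorem bagPos_succ {a t : ℕ} (ht : t < L) :
    bagPos bs a (t + 1) = bagPos bs a t + ((bs ⟨t, ht⟩).length + 1) := by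
  rw [bagPos, Finset.sum_range_succ, dif_pos ht, bagPos, add_assoc]

theorem bagPos_eq (a : ℕ) : bagPos bs a L = a + ((∑ t, (bs t).length) + L) := by
  rw [bagPos, Finset.sum_range]
  simp [Finset.sum_add_distrib]

theorem length_encodeBags : (encodeBags bs).length = (∑ t, (bs t).length) + L := by
  rw [encodeBags, List.length_flatMap, List.map_ofFn, List.sum_ofFn]
  simp [Finset.sum_add_distrib]

theorem ReadsAt.bags {f : ℕ → ℕ} {a : ℕ} (h : ReadsAt f a (encodeBags bs)) (t : Fin L) :
    f (bagPos bs a t) = (bs t).length ∧ ReadsAt f (bagPos bs a t + 1) ((bs t).map Fin.val) := by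
  induction L generalizing a with
  | zero => exact t.elim0
  | succ L ih =>
    rw [encodeBags, List.ofFn_succ, List.flatMap_cons, readsAt_append, readsAt_cons] at h
    cases t using Fin.cases with
    | zero => simpa [bagPos] using h.1
    | succ t =>
      have hpos : bagPos bs a t.succ =
          bagPos (fun i => bs i.succ) (a + ((bs 0).length + 1)) t := by
        simp only [bagPos, Fin.val_succ, Finset.sum_range_succ', Nat.zero_lt_succ, dif_pos,
          Nat.add_lt_add_iff_right]
        change a + (_ + ((bs 0).length + 1)) = _
        rw [add_comm _ ((bs 0).length + 1), ← add_assoc]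
        rfl
      have := ih h.2 t
      rw [List.length_cons, List.length_map] at this
      rw [hpos]
      exact this

/-- The word that encodes the input. -/
def inputWord (l : ℕ) (es : List (Fin n × Fin n)) (ts : List (Fin L × Fin L))
    (bs : Fin L → List (Fin n)) : List ℕ :=
  l :: (encodeGraph n es ++ (encodeGraph L ts ++ encodeBags bs))

theorem length_inputWord : (inputWord l es ts bs).length =
    5 + (es.length + es.length) + (ts.length + ts.length) + ((∑ t, (bs t).length) + L) := by
  simp only [inputWord, encodeGraph, List.length_cons, List.length_append, length_pairs,
    length_encodeBags]
  omega

/-- The parts of the input word. -/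
structure InputAt (l : ℕ) (es : List (Fin n × Fin n)) (ts : List (Fin L × Fin L))
    (bs : Fin L → List (Fin n)) (f : ℕ → ℕ) : Prop where
  l_eq : f 0 = l
  n_eq : f 1 = n
  m_eq : f 2 = es.length
  edges : ∀ i (h : i < es.length), f (3 + i + i) = (es[i].1 : ℕ) ∧ f (3 + i + i + 1) = (es[i].2 : ℕ)
  L_eq : f (3 + es.length + es.length) = L
  mt_eq : f (3 + es.length + es.length + 1) = ts.length
  tedges : ∀ i (h : i < ts.length), f (3 + es.length + es.length + 2 + i + i) = (ts[i].1 : ℕ) ∧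
    f (3 + es.length + es.length + 2 + i + i + 1) = (ts[i].2 : ℕ)
  bags : ∀ t : Fin L,
    f (bagPos bs (3 + es.length + es.length + 2 + ts.length + ts.length) t) = (bs t).length ∧
    ReadsAt f (bagPos bs (3 + es.length + es.length + 2 + ts.length + ts.length) t + 1)
      ((bs t).map Fin.val)

theorem inputAt_of_readsAt {f : ℕ → ℕ} (h : ReadsAt f 0 (inputWord l es ts bs)) :
    InputAt l es ts bs f := by
  simp only [inputWord, encodeGraph, List.cons_append, readsAt_cons, readsAt_append,
    length_pairs, zero_add, Nat.reduceAdd] at h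
  obtain ⟨h0, h1, h2, h3, h4, h5, h6, h7⟩ := h
  simp only [← add_assoc] at h4 h5 h6 h7
  exact ⟨h0, h1, h2, h3.pairs, h4, h5, h6.pairs, h7.bags⟩

theorem headerCmd_spec {s : Store Arr} {S : ℕ} (h : InputAt l es ts bs (s.a .inp))
    (hS : S = (inputWord l es ts bs).length) (hlen : s.v .len = S)
    (hn : n ≤ ∑ t, (bs t).length) :
    Spec headerCmd s (Base l S es ts bs) (11 + L * 4 + S * 3) := by
  rw [length_inputWord] at hS
  refine (Spec.set_seq (Spec.set_seq (Spec.set_seq (Spec.set_seq (Spec.set_seq (Spec.set_seq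
    (Spec.set_seq (Spec.set_seq (T := (1 + L * (3 + 1)) + (1 + S * (2 + 1) + 1)) ?_)))))))).weaken
    (by omega)
  set s₁ : Store Arr := Store.setV _ _ _ with hs₁
  set a := 3 + es.length + es.length + 2 + ts.length + ts.length with ha
  have ha₁ : s₁.a = s.a := rfl
  have v1 : s₁.v .l = l := by simp [hs₁, Store.setV_v, h.l_eq]
  have v2 : s₁.v .n = n := by simp [hs₁, Store.setV_v, h.n_eq]
  have v3 : s₁.v .m = es.length := by simp [hs₁, Store.setV_v, h.m_eq]
  have v4 : s₁.v .L = L := by simp [hs₁, Store.setV_v, h.m_eq, h.L_eq]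
  have v5 : s₁.v .mt = ts.length := by simp [hs₁, Store.setV_v, h.m_eq, h.mt_eq]
  have v6 : s₁.v .tb = 3 + es.length + es.length + 2 := by simp [hs₁, Store.setV_v, h.m_eq]
  have v7 : s₁.v .q = a := by simp [hs₁, Store.setV_v, h.m_eq, h.mt_eq, ha]
  have v8 : s₁.v .len = S := by simp [hs₁, Store.setV_v, hlen]
  refine Spec.seq (P := fun s' => ∀ t : Fin L, s'.a .bsz t = (bs t).length ∧
    s'.a .bst t = bagPos bs a t + 1) ?_ ?_
  · refine (Spec.loop (b := L) (fun t (s' : Store Arr) => s'.v .q = bagPos bs a t ∧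
      ∀ i : Fin L, i < t → s'.a .bsz i = (bs i).length ∧ s'.a .bst i = bagPos bs a i + 1)
      (by exact v4) ⟨by simp [v7, bagPos], by simp⟩ ?_).imp fun s' hs' _ t => hs'.2 t t.2
    rintro t ht s₂ ⟨hq, hp⟩ hf₂
    have hb : s.a .inp (bagPos bs a t) = (bs ⟨t, ht⟩).length := (h.bags ⟨t, ht⟩).1
    have hinp : s₂.a .inp = s.a .inp := by rw [hf₂.a .inp rfl, ha₁]
    refine ⟨⟨?_, fun i hi => ?_⟩, le_rfl⟩
    · rw [bagPos_succ ht]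
      simp [Cmd.run, Store.setV_v, Store.setA_a, hq, hinp, hb]
      omega
    · by_cases hit : (i : ℕ) = t
      · obtain rfl : i = ⟨t, ht⟩ := Fin.ext hit
        simp [Cmd.run, Store.setV_v, Store.setA_a, hq, hinp, hb]
      · have := hp i (by omega)
        simp [Cmd.run, Store.setV_v, Store.setA_a, hit, this]
  · intro s₂ h₂ hf₂
    refine Spec.set_seq ?_
    refine (Spec.loop (b := S) (fun i (s' : Store Arr) => s'.v .acc = i * S ∧
      ∀ j < i, s'.a .row j = j * S) ?_ ⟨by simp [Store.setV_v], by simp⟩ ?_).imp ?_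
    · simp [Store.setV_v, hf₂.v .len rfl, v8]
    · rintro i hi s₃ ⟨hacc, hrow⟩ hf₃
      have hl₃ : s₃.v .len = S := by simp [hf₃.v .len rfl, Store.setV_v, hf₂.v .len rfl, v8]
      refine ⟨⟨?_, fun j hj => ?_⟩, le_rfl⟩
      · simp [Cmd.run, Store.setV_v, hacc, hl₃, Nat.succ_mul]
      · by_cases hji : j = i
        · subst hji; simp [Cmd.run, Store.setV_v, Store.setA_a, hacc]
        · simp [Cmd.run, Store.setV_v, Store.setA_a, hji, hrow j (by omega)]
    · rintro s₃ ⟨-, hrow⟩ hf₃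
      have hv : ∀ x : Var, x ≠ .acc → x ≠ .i → x ≠ .t → x ≠ .q → s₃.v x = s₁.v x := by
        intro x h1 h2 h3 h4
        have e1 := hf₃.v x (by simp [Cmd.writesV, Ne.symm h1, Ne.symm h2])
        have e2 := hf₂.v x (by simp [Cmd.writesV, Ne.symm h3, Ne.symm h4])
        rw [e1, Store.setV_v, if_neg h1, e2]
      have hinp : s₃.a .inp = s.a .inp := by
        rw [hf₃.a .inp rfl, Store.setV_a, hf₂.a .inp rfl, ha₁]
      have hbsz : s₃.a .bsz = s₂.a .bsz := hf₃.a .bsz rfl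
      have hbst : s₃.a .bst = s₂.a .bst := hf₃.a .bst rfl
      have htb : s₃.v .tb = 3 + es.length + es.length + 2 := by
        rw [hv .tb (by decide) (by decide) (by decide) (by decide), v6]
      constructor
      · rw [hv .l (by decide) (by decide) (by decide) (by decide), v1]
      · rw [hv .n (by decide) (by decide) (by decide) (by decide), v2]
      · rw [hv .m (by decide) (by decide) (by decide) (by decide), v3]
      · rw [hv .L (by decide) (by decide) (by decide) (by decide), v4]
      · rw [hv .mt (by decide) (by decide) (by decide) (by decide), v5]
      · rw [hinp]; exact h.edges
      · rw [hinp, htb]; exact h.tedges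
      · intro t; rw [hbsz]; exact (h₂ t).1
      · intro t i hi
        rw [hinp, hbst, (h₂ t).2]
        exact ((h.bags t).2 i (by simpa using hi)).trans (by rw [List.getElem_map])
      · exact hrow
      all_goals omega

end Header

/-! ### The whole program -/

section Main

variable {n L l : ℕ} {es : List (Fin n × Fin n)} {ts : List (Fin L × Fin L)}
  {bs : Fin L → List (Fin n)} {G : SimpleGraph (Fin n)} {D : TreeDecomposition G (Fin L)}

/-- The result of the main phase. -/
def HasResult (D : TreeDecomposition G (Fin L)) (l : ℕ) (w : List ℕ) : Prop :=
  ∃ (m : ℕ) (K : Classes D l (Fin m)) (mid : Fin n → Fin n → Fin n) (T : List (Fin m × Fin m))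
    (bs' : Fin m → List (Fin n)), IsMid D mid ∧ IsEdgeList K.tree T ∧
    (∀ c, (bs' c).Nodup ∧ ∀ v, v ∈ bs' c ↔ K.InBag mid c v) ∧
    w = encodeGraph m T ++ encodeBags bs'

theorem card_le_sum_bags (hbs : IsBagList D.bag bs) : n ≤ ∑ t, (bs t).length := by
  classical
  have h1 : (Finset.univ : Finset (Fin n)) ⊆ Finset.univ.biUnion D.bag := fun x _ => by
    obtain ⟨t, ht⟩ := D.vertex_mem x
    exact Finset.mem_biUnion.2 ⟨t, Finset.mem_univ _, ht⟩
  have h2 := (Finset.card_le_card h1).trans Finset.card_biUnion_le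
  simpa [hbs.length_eq] using h2

theorem mainCmd_spec (hG : G.Connected) (hl : 1 ≤ l) (hes : IsEdgeList G es)
    (hts : IsEdgeList D.tree ts) (hbs : IsBagList D.bag bs) {k : ℕ} (hk : ∀ t, (bs t).length ≤ k)
    {s : Store Arr} {S : ℕ} (h : InputAt l es ts bs (s.a .inp))
    (hS : S = (inputWord l es ts bs).length) (hlen : s.v .len = S)
    (hzero : ∀ q, q ≠ .inp → s.a q = fun _ => 0) :
    Spec mainCmd s (fun s' => ∃ w, HasResult D l w ∧ Written w (s'.v .op) (s'.a .out))
      ((11 + L * 4 + S * 3) + ((1 + ts.length * 7) + ((4 + 3 * L + 12 * ts.length) +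
        ((2 + L * (2 + k * (3 + k * 5)) + es.length * 5) +
        ((2 + 2 * (L * (3 + k * (3 + k * (3 + k * 5))))) +
        ((4 + L * (2 + k * (10 + k * (5 + k * 7)))) + ((5 + ts.length * (4 + k * 11)) +
        (1 + (L * k * 8 + L * k * (8 + k * (7 + 32 * l)))))))))))  := by
  have hsum : ∑ t, (bs t).length ≤ L * k := by
    simpa using Finset.sum_le_sum fun t (_ : t ∈ Finset.univ) => hk t
  have hsum' : ∑ t, (bs t).length = ∑ t, (D.bag t).card :=
    Finset.sum_congr rfl fun t _ => hbs.length_eq t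
  obtain ⟨t₀⟩ := D.isTree.connected.nonempty
  refine Spec.seq (headerCmd_spec h hS hlen (card_le_sum_bags hbs)) fun s₁ hB₁ hf₁ => ?_
  refine Spec.seq (adjacencyCmd_spec hB₁ ?_) fun s₂ hA hf₂ => ?_
  · rw [hf₁.a .deg rfl, hzero .deg (by decide)]
  obtain ⟨nb, hnb, hnbs, hnbm⟩ := hA
  have hB₂ := hB₁.of_frame hf₂ rfl
  refine Spec.seq (searchCmd_spec hB₂ hts hnb hnbs hnbm ?_) fun s₃ hO hf₃ => ?_
  · rw [hf₂.a .vis rfl, hf₁.a .vis rfl, hzero .vis (by decide)]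
  obtain ⟨o, ho, hord⟩ := hO
  have hB₃ := hB₂.of_frame hf₃ rfl
  refine Spec.seq (initDistCmd_spec hG hes hbs hk hB₃ ?_) fun s₄ hd hf₄ => ?_
  · rw [hf₃.a .dist rfl, hf₂.a .dist rfl, hf₁.a .dist rfl, hzero .dist (by decide)]
  have hB₄ := hB₃.of_frame hf₄ rfl
  refine Spec.seq (sweepCmd_spec hG hbs hk hB₄ hd ho ?_) fun s₅ hw hf₅ => ?_
  · rw [hf₄.a .ord rfl]; exact hord
  obtain ⟨hdist, mid, hmid, hmids⟩ := hw
  have hB₅ := hB₄.of_frame hf₅ rfl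
  refine Spec.seq (classesCmd_spec hbs hk hB₅ ?_ t₀ hdist) fun s₆ hc hf₆ => ?_
  · rw [hf₅.a .comp rfl, hf₄.a .comp rfl, hf₃.a .comp rfl, hf₂.a .comp rfl, hf₁.a .comp rfl,
      hzero .comp (by decide)]
  obtain ⟨m, K, lst, hK⟩ := hc
  have hB₆ := hB₅.of_frame hf₆ rfl
  have hm : m ≤ ∑ t, (bs t).length := hsum' ▸ K.card_le
  have hA : ∑ c, (lst c).length ≤ ∑ t, (bs t).length := by
    rw [hsum', Finset.sum_congr rfl fun c _ => hK.isList.length_eq c]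
    exact K.sum_card_le
  refine Spec.seq (treeOutCmd_spec hbs hts hk hB₆ (hm.trans_lt hB₆.tot_lt) hK ?_)
    fun s₇ hT hf₇ => ?_
  · rw [hf₆.a .emat rfl, hf₅.a .emat rfl, hf₄.a .emat rfl, hf₃.a .emat rfl, hf₂.a .emat rfl,
      hf₁.a .emat rfl, hzero .emat (by decide)]
  obtain ⟨T, hT, hwT⟩ := hT
  have hB₇ := hB₆.of_frame hf₇ rfl
  have hD : BagData (K := K) mid S lst s₇ := by
    refine ⟨hK.of_frame (hf₇.v .nc rfl) (hf₇.a .cst rfl) (hf₇.a .que rfl) (hf₇.a .comp rfl), ?_, ?_⟩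
    · rw [hf₇.a .dist rfl, hf₆.a .dist rfl]; exact hdist
    · rw [hf₇.a .mid rfl, hf₆.a .mid rfl]; exact hmids
  refine ((bagsOutCmd_spec hG hmid hl hB₇ hD hwT ?_ (k := k) fun c => ?_).imp ?_).weaken ?_
  · rw [hf₇.a .stamp rfl, hf₆.a .stamp rfl, hf₅.a .stamp rfl, hf₄.a .stamp rfl, hf₃.a .stamp rfl,
      hf₂.a .stamp rfl, hf₁.a .stamp rfl, hzero .stamp (by decide)]
  · rw [hK.isList.length_eq]
    exact (Finset.card_le_card (K.subset c)).trans (hbs.length_eq (K.node c) ▸ hk _)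
  · rintro s₈ ⟨bs', hbs', hw'⟩ -
    exact ⟨_, ⟨m, K, mid, T, bs', hmid, hT, hbs', rfl⟩, hw'⟩
  · refine Nat.add_le_add_left (Nat.add_le_add ?_ ?_) _
    · exact Nat.mul_le_mul_right _ (hm.trans hsum)
    · exact Nat.mul_le_mul_right _ (hA.trans hsum)

/-! ### Loading, main phase and storing on one memory -/

/-- Find the end of the input, and copy the input there with stride `32`. -/
def loadCmd : Cmd Unit :=
  .set .m (.get () 2) ;; .set .q (3 + Var.m + Var.m) ;; .set .L (.get () Var.q) ;;
  .set .mt (.get () (Var.q + 1)) ;; .set .q (Var.q + 2 + Var.mt + Var.mt) ;;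
  .loop .t Var.L (.set .q (Var.q + 1 + .get () Var.q)) ;;
  .set .len Var.q ;; .set .acc Var.q ;;
  .loop .i Var.len (.put () Var.acc (.get () Var.i) ;; .set .acc (Var.acc + 32))

/-- Copy the output, which has stride `32`, to the start of the memory. -/
def storeCmd : Cmd Unit :=
  .set .acc (Var.len + 17) ;;
  .loop .j Var.op (.put () Var.j (.get () Var.acc) ;; .set .acc (Var.acc + 32))

/-- Copies go to addresses from `S` on, beyond the cells still to be read. All memory there was
zero, so the other 31 offsets of each block are zero arrays for the main phase. -/
theorem loadCmd_spec {s : Store Unit} {S : ℕ} (h : InputAt l es ts bs (s.a ()))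
    (hS : S = (inputWord l es ts bs).length) (hz : ∀ i, S ≤ i → s.a () i = 0) :
    Spec loadCmd s (fun s' => s'.v .len = S ∧ ∀ i r, r < 32 →
      s'.a () (S + 32 * i + r) = if r = 0 then s.a () i else 0) (9 + 2 * L + 3 * S) := by
  have hS' := hS
  rw [length_inputWord] at hS'
  refine (Spec.set_seq (Spec.set_seq (Spec.set_seq (Spec.set_seq (Spec.set_seq
    (T := (1 + L * (1 + 1)) + (1 + S * (2 + 1) + 1 + 1)) ?_))))).weaken (by omega)
  set s₁ : Store Unit := Store.setV _ _ _ with hs₁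
  set a := 3 + es.length + es.length + 2 + ts.length + ts.length with ha
  have v4 : s₁.v .L = L := by simp [hs₁, Store.setV_v, h.m_eq, h.L_eq]
  have v7 : s₁.v .q = a := by simp [hs₁, Store.setV_v, h.m_eq, h.mt_eq, ha]
  have hend : bagPos bs a L = S := by rw [bagPos_eq]; omega
  refine Spec.seq (P := fun s' => s'.v .q = S) ?_ ?_
  · refine (Spec.loop (b := L) (fun t (s' : Store Unit) => s'.v .q = bagPos bs a t) (by exact v4)
      (by simp [v7, bagPos]) ?_).imp fun s' hs' _ => hs'.trans hend
    intro t ht s₂ hq hf₂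
    have hb : s.a () (bagPos bs a t) = (bs ⟨t, ht⟩).length := (h.bags ⟨t, ht⟩).1
    have hinp : s₂.a () = s.a () := hf₂.a () rfl
    refine ⟨?_, le_rfl⟩
    rw [bagPos_succ ht]
    simp [Cmd.run, Store.setV_v, hq, hinp, hb]
    omega
  · intro s₂ hq hf₂
    refine Spec.set_seq (Spec.set_seq ?_)
    set s₃ : Store Unit := Store.setV _ _ _ with hs₃
    have v8 : s₃.v .len = S := by simp [hs₃, Store.setV_v, hq]
    have v9 : s₃.v .acc = S := by simp [hs₃, Store.setV_v, hq]
    have ha₃ : s₃.a () = s.a () := hf₂.a () rfl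
    refine (Spec.loop (b := S) (fun i (s' : Store Unit) => s'.v .acc = S + 32 * i ∧
      (∀ j < S, s'.a () j = s.a () j) ∧ ∀ j r, r < 32 →
        s'.a () (S + 32 * j + r) = if r = 0 ∧ j < i then s.a () j else 0) (by exact v8)
      ⟨by simp [v9], by simp [ha₃], fun j r _ => ?_⟩ ?_).imp ?_
    · simp [ha₃, hz (S + 32 * j + r) (by omega)]
    · rintro i hi s₄ ⟨hacc, hold, hnew⟩ -
      have hrun : ((Cmd.put () Var.acc (.get () Var.i) ;; .set .acc (Var.acc + 32)).run
          (s₄.setV .i i)).a () = Function.update (s₄.a ()) (S + 32 * i) (s.a () i) := by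
        simp [Cmd.run, Store.setA_a, Store.setV_v, hacc, hold i hi]
      refine ⟨⟨?_, fun j hj => ?_, fun j r hr => ?_⟩, le_rfl⟩
      · simp only [Cmd.run, Store.setV_v, Store.setA_v, if_true, eval_add, eval_var, hacc,
          reduceCtorEq, if_false]
        change S + 32 * i + 32 = _
        omega
      · rw [hrun, Function.update_of_ne (by omega), hold j hj]
      · rw [hrun, Function.update_apply, hnew j r hr]
        split_ifs with h1 h2 h3 h4 h5 <;> first | rfl | (exfalso; omega) | skip
        · rw [show j = i by omega]
    · rintro s₄ ⟨-, -, hnew⟩ hf₄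
      refine ⟨by rw [hf₄.v .len rfl, v8], fun i r hr => ?_⟩
      rw [hnew i r hr]
      by_cases hi : i < S
      · simp [hi]
      · simp [hi, hz i (by omega)]

/-- The offset 17 is the index of `out` among the arrays. Copying downwards in increasing order is
safe: when cell `j` is written, every source still to be read has a larger address. -/
theorem storeCmd_spec {s : Store Unit} {S : ℕ} {w : List ℕ} (hlen : s.v .len = S)
    (hop : s.v .op = w.length) (h : ∀ i (hi : i < w.length), s.a () (S + 32 * i + 17) = w[i]) :
    Spec storeCmd s (fun s' => ∀ i (hi : i < w.length), s'.a () i = w[i]) (2 + 3 * w.length) := by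
  refine (Spec.set_seq (T := 1 + w.length * (2 + 1)) ?_).weaken (by omega)
  set s₁ : Store Unit := Store.setV _ _ _ with hs₁
  have hacc₁ : s₁.v .acc = S + 17 := by
    simp only [hs₁, Store.setV_v, if_true, eval_add, eval_var, hlen]; rfl
  have hop₁ : s₁.v .op = w.length := by simp [hs₁, Store.setV_v, hop]
  refine (Spec.loop (s := s₁) (b := w.length) (fun j (s' : Store Unit) =>
    s'.v .acc = S + 32 * j + 17 ∧
    (∀ i (hi : i < w.length), i < j → s'.a () i = w[i]) ∧ ∀ i, j ≤ i → s'.a () i = s.a () i)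
    (by exact hop₁) ⟨by simp [hacc₁], by simp, fun i _ => rfl⟩ ?_).imp
    fun s' hs' _ i hi => hs'.2.1 i hi hi
  rintro j hj s₂ ⟨hacc, hnew, hold⟩ -
  have hrun : ((Cmd.put () Var.j (.get () Var.acc) ;; .set .acc (Var.acc + 32)).run
      (s₂.setV .j j)).a () = Function.update (s₂.a ()) j w[j] := by
    simp [Cmd.run, Store.setA_a, Store.setV_v, hacc, hold (S + 32 * j + 17) (by omega), h j hj]
  refine ⟨⟨?_, fun i hi hij => ?_, fun i hij => ?_⟩, le_rfl⟩
  · simp only [Cmd.run, Store.setV_v, Store.setA_v, if_true, eval_add, eval_var, hacc,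
      reduceCtorEq, if_false]
    change S + 32 * j + 17 + 32 = _
    omega
  · rw [hrun, Function.update_apply]
    split_ifs with h1
    · subst h1; rfl
    · exact hnew i hi (by omega)
  · rw [hrun, Function.update_of_ne (by omega), hold i (by omega)]

/-- The layout of the whole memory as one array. -/
def rawLayout : Layout Unit where
  b := 1
  hb := le_rfl
  sh := 0
  off _ := 0
  off_lt _ := by norm_num
  off_inj _ _ _ := rfl

/-- The layout of the main phase. -/
def mainLayout : Layout Arr where
  b := 0
  hb := Nat.zero_le _
  sh := 5
  off q := q.ctorIdx
  off_lt q := by cases q <;> decide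
  off_inj q r h := by cases q <;> cases r <;> first | rfl | (exfalso; revert h; decide)

/-- A program with three phases. -/
def phases (load : Cmd Unit) (main : Cmd Arr) (store : Cmd Unit) : Prog :=
  .seq (load.compile rawLayout 0) (.seq (.add 0 (vreg .len) 1)
    (.seq (main.compile mainLayout 0) (.seq (store.compile rawLayout 0) (.const 0 0))))

/-- Between the phases only the view of the memory changes. Setting register `0` to `S` turns the
flat memory into interleaved arrays of stride 32, with `inp` at offset 0. Afterwards register `1`
gives base 0 and the flat view again. The final assignment makes register `0` the address of the
output. -/
theorem exec_phases {load store : Cmd Unit} {main : Cmd Arr} {w : List ℕ} {S T₁ T₂ : ℕ}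
    {T₃ : ℕ → ℕ} (R : List ℕ → Prop) (hmlen : main.writesV .len = false)
    (hload : ∀ s : Store Unit, s.a () = (fun i => w.getD i 0) →
      Spec load s (fun s' => s'.v .len = S ∧ ∀ i r, r < 32 →
        s'.a () (S + 32 * i + r) = if r = 0 then w.getD i 0 else 0) T₁)
    (hmain : ∀ s : Store Arr, s.a .inp = (fun i => w.getD i 0) → s.v .len = S →
      (∀ q, q ≠ .inp → s.a q = fun _ => 0) →
      Spec main s (fun s' => ∃ w', R w' ∧ Written w' (s'.v .op) (s'.a .out)) T₂)
    (hstore : ∀ (s : Store Unit) (w' : List ℕ), s.v .len = S → s.v .op = w'.length →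
      (∀ i (hi : i < w'.length), s.a () (S + 32 * i + 17) = w'[i]) →
      Spec store s (fun s' => ∀ i (hi : i < w'.length), s'.a () i = w'[i]) (T₃ w'.length)) :
    ∃ s t w', Exec (phases load main store) (initState w) s t ∧ R w' ∧ s.HoldsAt (s.reg 0) w' ∧
      t ≤ load.cost rawLayout * T₁ + main.cost mainLayout * T₂ +
        store.cost rawLayout * T₃ w'.length + 2 := by
  set σ₀ : Store Unit := ⟨fun _ => 0, fun _ i => w.getD i 0⟩ with hσ₀
  have r₀ : Rep rawLayout 0 σ₀ (initState w) :=
    ⟨fun _ => rfl, rfl, rfl, fun _ i => by simp [rawLayout, initState, hσ₀]⟩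
  obtain ⟨s₁, t₁, x₁, le₁, r₁, -⟩ := load.exec_compile rawLayout 0 0 σ₀ _ r₀
  have l₁ := hload σ₀ rfl
  obtain ⟨hlen, hcopy⟩ := l₁.post
  set σ₁ := load.run σ₀ with hσ₁
  set σ₂ : Store Arr := ⟨σ₁.v, fun q i => if q = .inp then w.getD i 0 else 0⟩ with hσ₂
  have x₂ := Exec.add 0 (vreg .len) 1 s₁
  set s₂ := s₁.setReg 0 (s₁.reg (vreg .len) + s₁.reg 1) with hs₂
  have r₂ : Rep mainLayout S σ₂ s₂ := by
    refine ⟨fun x => ?_, ?_, ?_, fun q i => ?_⟩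
    · rw [hs₂, State.setReg_reg, if_neg (by unfold vreg; omega)]; exact r₁.v x
    · rw [hs₂, State.setReg_reg, if_neg (by omega)]; exact r₁.one
    · change s₂.reg 0 = S
      rw [hs₂, State.setReg_reg, if_pos rfl, r₁.v, r₁.one]; exact hlen
    · have h1 := r₁.a () (S + 32 * i + q.ctorIdx)
      have h2 := hcopy i q.ctorIdx (mainLayout.off_lt q)
      have h3 : q.ctorIdx = 0 ↔ q = .inp := by cases q <;> simp [Arr.ctorIdx]
      simp only [rawLayout, pow_zero, one_mul, zero_add, add_zero] at h1
      change s₁.mem (S + 2 ^ 5 * i + q.ctorIdx) = if q = .inp then w.getD i 0 else 0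
      rw [← if_congr h3 rfl rfl, ← h2, ← h1]
      norm_num
  obtain ⟨s₃, t₃, x₃, le₃, r₃, -⟩ := main.exec_compile mainLayout 0 S σ₂ _ r₂
  have l₃ := hmain σ₂ (by simp [hσ₂]) hlen (fun q hq => by simp [hσ₂, hq])
  obtain ⟨w', hR, hW⟩ := l₃.post
  have f₃ := main.frame σ₂
  set σ₃ := main.run σ₂ with hσ₃
  set σ₄ : Store Unit := ⟨σ₃.v, fun _ i => s₃.mem i⟩ with hσ₄
  have r₄ : Rep rawLayout 0 σ₄ s₃ :=
    ⟨r₃.v, r₃.one, r₃.one, fun _ i => by simp [rawLayout, hσ₄]⟩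
  obtain ⟨s₅, t₅, x₅, le₅, r₅, -⟩ := store.exec_compile rawLayout 0 0 σ₄ _ r₄
  have l₅ := hstore σ₄ w' ((f₃.v .len hmlen).trans hlen) hW.op_eq
    (fun i hi => by
      rw [← hW.out_eq i hi, ← r₃.a .out i]
      change s₃.mem (S + 32 * i + 17) = s₃.mem (S + 2 ^ 5 * i + 17)
      norm_num)
  refine ⟨_, _, w', Exec.seq x₁ (Exec.seq x₂ (Exec.seq x₃ (Exec.seq x₅ (Exec.const 0 0 s₅)))), hR,
    fun i hi => ?_, ?_⟩
  · have h1 := r₅.a () i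
    have h2 := l₅.post i hi
    simp only [rawLayout, pow_zero, one_mul, zero_add, add_zero] at h1
    rw [State.setReg_reg, if_pos rfl, zero_add, State.setReg_mem, h1, h2]
  · have e1 := le₁.trans (Nat.mul_le_mul_left _ l₁.time)
    have e3 := le₃.trans (Nat.mul_le_mul_left _ l₃.time)
    have e5 := le₅.trans (Nat.mul_le_mul_left _ l₅.time)
    omega

end Main

/-! ### Bounds on the sizes of input and output -/

theorem IsEdgeList.length_le {n : ℕ} {T : SimpleGraph (Fin n)} {ts : List (Fin n × Fin n)}
    (h : IsEdgeList T ts) (hT : T.IsTree) : ts.length ≤ n := by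
  classical
  have h1 := hT.card_edgeFinset
  have h2 : (ts.map fun e => s(e.1, e.2)).toFinset = T.edgeFinset := by
    ext e
    induction e using Sym2.ind with
    | _ x y => rw [List.mem_toFinset, mem_edgeFinset, mem_edgeSet, h.2]
  rw [← h2, List.toFinset_card_of_nodup h.1, List.length_map, Fintype.card_fin] at h1
  omega

section Bounds

variable {n L l : ℕ} {es : List (Fin n × Fin n)} {ts : List (Fin L × Fin L)}
  {bs : Fin L → List (Fin n)} {G : SimpleGraph (Fin n)} {D : TreeDecomposition G (Fin L)}

/-- Every edge lies in a bag, and a bag of size `c` carries at most `c(c + 1)/2 ≤ c²` unordered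
pairs. -/
theorem length_edges_le (hes : IsEdgeList G es) {k : ℕ} (hk : ∀ t, (D.bag t).card ≤ k) :
    es.length ≤ L * k ^ 2 := by
  classical
  have h1 : (es.map fun e => s(e.1, e.2)).toFinset ⊆
      Finset.univ.biUnion fun t => (D.bag t).sym2 := by
    intro e
    induction e using Sym2.ind with
    | _ x y =>
      intro he
      obtain ⟨t, hx, hy⟩ := D.edge_mem x y ((hes.2 x y).2 (List.mem_toFinset.1 he))
      exact Finset.mem_biUnion.2 ⟨t, Finset.mem_univ _, Finset.mk_mem_sym2_iff.2 ⟨hx, hy⟩⟩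
  have h2 := (Finset.card_le_card h1).trans (Finset.card_biUnion_le_card_mul _ _ (k ^ 2) ?_)
  · rw [List.toFinset_card_of_nodup hes.1, List.length_map, Finset.card_univ, Fintype.card_fin] at h2
    exact h2
  · intro t _
    rw [Finset.card_sym2, Nat.choose_two_right, Nat.add_sub_cancel]
    have := hk t
    refine (Nat.div_le_of_le_mul ?_).trans (Nat.pow_le_pow_left this 2)
    nlinarith [Nat.le_mul_self (D.bag t).card]

/-- The time for copying the output is proportional to its length. Bounding one factor of each
squared class size by `k` leaves the sum of class sizes, which is at most `L k`. -/
theorem HasResult.length_le (hG : G.Connected) (hl : 1 ≤ l)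
    (hcyc : ∀ (v : Fin n) (c : G.Walk v v), IsGeodesicCycle G c → c.length ≤ l) {k : ℕ}
    (hk : ∀ t, (D.bag t).card ≤ k) {w : List ℕ} (h : HasResult D l w) :
    w.length ≤ 2 + 3 * (L * k) + L * k ^ 2 * l := by
  obtain ⟨m, K, mid, T, bs', hmid, hT, hbs', rfl⟩ := h
  have hsum : ∑ t, (D.bag t).card ≤ L * k := by
    simpa using Finset.sum_le_sum fun t (_ : t ∈ Finset.univ) => hk t
  have h1 := hT.length_le (K.tree_isTree hG hl hcyc)
  have h2 := K.card_le
  have h3 : ∑ c, (bs' c).length ≤ L * k ^ 2 * l := by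
    calc ∑ c, (bs' c).length ≤ ∑ c, (K.cls c).card * (k * l) := by
          refine Finset.sum_le_sum fun c _ => ?_
          rw [← List.toFinset_card_of_nodup (hbs' c).1]
          refine (K.card_le_of_inBag hG hmid c _ (fun v hv => ((hbs' c).2 v).1
            (List.mem_toFinset.1 hv)) hl).trans ?_
          rw [pow_two, mul_assoc]
          exact Nat.mul_le_mul_left _ (Nat.mul_le_mul_right _
            ((Finset.card_le_card (K.subset c)).trans (hk _)))
      _ = (∑ c, (K.cls c).card) * (k * l) := by rw [Finset.sum_mul]
      _ ≤ L * k * (k * l) := Nat.mul_le_mul_right _ (K.sum_card_le.trans hsum)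
      _ = L * k ^ 2 * l := by ring
  simp only [encodeGraph, List.length_append, List.length_cons, length_pairs, length_encodeBags]
  omega

end Bounds

/-- For positive `L`, `k`, `l` every monomial that occurs is at most `L k³` or `L k² l`. The
constants 44, 226 and 20 are the sums of all coefficients after expansion. -/
theorem time_bounds {L k l e f S : ℕ} (hL : 1 ≤ L) (hk : 1 ≤ k) (hl : 1 ≤ l)
    (he : e ≤ L * k ^ 2) (hf : f ≤ L) (hS : S ≤ 5 + (e + e) + (f + f) + (L * k + L)) :
    9 + 2 * L + 3 * S ≤ 44 * (L * k ^ 2 * (k + l)) ∧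
    (11 + L * 4 + S * 3) + ((1 + f * 7) + ((4 + 3 * L + 12 * f) +
      ((2 + L * (2 + k * (3 + k * 5)) + e * 5) +
      ((2 + 2 * (L * (3 + k * (3 + k * (3 + k * 5))))) +
      ((4 + L * (2 + k * (10 + k * (5 + k * 7)))) + ((5 + f * (4 + k * 11)) +
      (1 + (L * k * 8 + L * k * (8 + k * (7 + 32 * l))))))))))
      ≤ 226 * (L * k ^ 2 * (k + l)) ∧
    2 + 3 * (2 + 3 * (L * k) + L * k ^ 2 * l) ≤ 20 * (L * k ^ 2 * (k + l)) := by
  have hU : L * k ^ 2 * (k + l) = L * k ^ 3 + L * k ^ 2 * l := by ring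
  have u1 : L ≤ L * k := Nat.le_mul_of_pos_right _ hk
  have u2 : L * k ≤ L * k ^ 2 := by
    rw [pow_two, ← mul_assoc]; exact Nat.le_mul_of_pos_right _ hk
  have u3 : L * k ^ 2 ≤ L * k ^ 3 := by
    rw [pow_succ k 2, ← mul_assoc]; exact Nat.le_mul_of_pos_right _ hk
  have u4 : L * k ^ 2 ≤ L * k ^ 2 * l := Nat.le_mul_of_pos_right _ hl
  have u5 : f * k ≤ L * k := Nat.mul_le_mul_right _ hf
  have e1 : L * (2 + k * (3 + k * 5)) = 2 * L + 3 * (L * k) + 5 * (L * k ^ 2) := by ring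
  have e2 : L * (3 + k * (3 + k * (3 + k * 5))) =
      3 * L + 3 * (L * k) + 3 * (L * k ^ 2) + 5 * (L * k ^ 3) := by ring
  have e3 : L * (2 + k * (10 + k * (5 + k * 7))) =
      2 * L + 10 * (L * k) + 5 * (L * k ^ 2) + 7 * (L * k ^ 3) := by ring
  have e4 : f * (4 + k * 11) = 4 * f + 11 * (f * k) := by ring
  have e5 : L * k * (8 + k * (7 + 32 * l)) =
      8 * (L * k) + 7 * (L * k ^ 2) + 32 * (L * k ^ 2 * l) := by ring
  rw [hU, e1, e2, e3, e4, e5]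
  generalize L * k ^ 2 * l = a at *
  generalize L * k ^ 3 = b at *
  generalize L * k ^ 2 = c at *
  generalize L * k = d at *
  generalize f * k = g at *
  omega

theorem weighted_sum_le {a b c x y z p q r u : ℕ} (hx : x ≤ p * u) (hy : y ≤ q * u)
    (hz : z ≤ r * u) (hu : 1 ≤ u) :
    a * x + b * y + c * z + 2 ≤ (a * p + b * q + c * r + 2) * u := by
  have h1 := Nat.mul_le_mul_left a hx
  have h2 := Nat.mul_le_mul_left b hy
  have h3 := Nat.mul_le_mul_left c hz
  simp only [add_mul, mul_assoc]
  omega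

end ConnTD

theorem mainTheorem3 :
    ∃ (P : ConnTD.Prog) (C : ℕ),
      ∀ (n L k l : ℕ) (G : SimpleGraph (Fin n)) (D : ConnTD.TreeDecomposition G (Fin L)),
        G.Connected → D.maxBagSize = k → 3 < l →
        (∀ (v : Fin n) (c : G.Walk v v), ConnTD.IsGeodesicCycle G c → c.length ≤ l) →
        ∀ w : List ℕ, ConnTD.EncodesInput l G D w →
          ∃ (s : ConnTD.State) (t : ℕ),
            ConnTD.Exec P (ConnTD.initState w) s t ∧
            t ≤ C * (L * k ^ 2 * (k + l)) ∧
            ∃ (L' : ℕ) (D' : ConnTD.TreeDecomposition G (Fin L')) (w' : List ℕ),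
              D'.HasConnectedBags ∧
              (∀ i, (D'.bag i).card ≤ k ^ 2 * l) ∧
              ConnTD.EncodesDecomposition D' w' ∧
              s.HoldsAt (s.reg 0) w' := by
  open ConnTD in
  refine ⟨phases loadCmd mainCmd storeCmd, loadCmd.cost rawLayout * 44 +
    mainCmd.cost mainLayout * 226 + storeCmd.cost rawLayout * 20 + 2, ?_⟩
  intro n L k l G D hG hk hl hcyc w hw
  obtain ⟨es, w₁, hes, ⟨ts, bs, hts, hbs, rfl⟩, rfl⟩ := hw
  change ∃ s t, Exec _ (initState (inputWord l es ts bs)) s t ∧ _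
  have hl' : 1 ≤ l := by omega
  have hbag : ∀ t, (D.bag t).card ≤ k := fun t => hk ▸ Finset.le_sup
    (f := fun i => (D.bag i).card) (Finset.mem_univ t)
  have hbs' : ∀ t, (bs t).length ≤ k := fun t => (hbs.length_eq t).trans_le (hbag t)
  obtain ⟨x⟩ := hG.nonempty
  obtain ⟨t₀, ht₀⟩ := D.vertex_mem x
  -- A connected graph has a vertex, so some bag is nonempty. Positivity of `k` and `L` allows
  -- additive constants to be absorbed in the time bound.
  have hk1 : 1 ≤ k := (Finset.card_pos.2 ⟨x, ht₀⟩).trans_le (hbag t₀)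
  have hread : InputAt l es ts bs fun i => (inputWord l es ts bs).getD i 0 :=
    inputAt_of_readsAt fun i hi => by
      rw [zero_add, List.getD_eq_getElem _ _ hi]
  obtain ⟨s, t, w', hex, hres, hholds, htime⟩ := exec_phases (HasResult D l)
    (load := loadCmd) (main := mainCmd) (store := storeCmd) (T₃ := fun i => 2 + 3 * i) (w := inputWord l es ts bs) rfl
    (fun s hs => by
      have := loadCmd_spec (s := s) (l := l) (es := es) (ts := ts) (bs := bs) (hs ▸ hread) rfl
        (fun i hi => by rw [hs]; exact List.getD_eq_default _ _ hi)
      rwa [hs] at this)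
    (fun s hs hlen hz => mainCmd_spec hG hl' hes hts hbs hbs' (hs ▸ hread) rfl hlen hz)
    (fun s w' => storeCmd_spec)
  have hlen' := hres.length_le hG hl' hcyc hbag
  obtain ⟨b1, b2, b3⟩ := time_bounds (e := es.length) (f := ts.length) t₀.pos hk1 hl'
    (length_edges_le hes hbag) (hts.length_le D.isTree)
    (S := (inputWord l es ts bs).length) (by
      rw [length_inputWord]
      have : ∑ t, (bs t).length ≤ L * k := by
        simpa using Finset.sum_le_sum fun t (_ : t ∈ Finset.univ) => hbs' t
      omega)
  refine ⟨s, t, hex, ?_, ?_⟩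
  · have hU : 1 ≤ L * k ^ 2 * (k + l) :=
      Nat.mul_pos (Nat.mul_pos t₀.pos (pow_pos hk1 2)) (by omega)
    have c3 : 2 + 3 * w'.length ≤ 20 * (L * k ^ 2 * (k + l)) := by omega
    exact htime.trans (weighted_sum_le b1 b2 c3 hU)
  · obtain ⟨m, K, mid, T, bs₂, hmid, hT, hbs₂, hw'⟩ := hres
    have hmem : ∀ c v, v ∈ (bs₂ c).toFinset ↔ K.InBag mid c v := fun c v => by
      rw [List.mem_toFinset, (hbs₂ c).2]
    refine ⟨m, K.decomposition hG hl' hcyc hmid (fun c => (bs₂ c).toFinset) hmem, w',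
      fun c => K.induce_inBag_connected hG hmid c _ fun v => ?_, fun c => ?_,
      ⟨T, bs₂, hT, fun c => ⟨(hbs₂ c).1, fun v => List.mem_toFinset.symm⟩, hw'⟩, hholds⟩
    · exact Finset.mem_coe.trans (hmem c v)
    · refine (K.card_le_of_inBag hG hmid c _ (fun v hv => (hmem c v).1 hv) hl').trans ?_
      exact Nat.mul_le_mul_right _ (Nat.pow_le_pow_left
        ((Finset.card_le_card (K.subset c)).trans (hbag _)) 2)
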